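/- Let $D$ be one of the Dynkin diagrams $D_4, E_6, E_7, E_8$. Its affinization is a star with $m=4,3,3,3$ legs; let $d_k-1$ be the length of the $k$-th leg, so $(d_1,\dots,d_m)=(2,2,2,2),(3,3,3),(2,4,4),(2,3,6)$, and let $\ell=2,3,4,6$ respectively. Let $B$ be the algebra over $\mathbb C[q^{\pm1}]$ generated by $T_1,\dots,T_m$ with relations $T_k^{d_k}=1$ and $T_1\cdots T_m=q$; for $q_0\in\mathbb C^*$ put $B(q_0)=B/(q-q_0)$. Let $A_Q$ be the algebra generated by $X^{\pm1},P^{\pm1}$ with $PX=QXP$, and let $\mathbb Z_\ell$ act on $A_{q^\ell}$ through the automorphism $a\mapsto s^{-1}as$ of order dividing $\ell$ ($s$ a generator of $\mathbb Z_\ell$) given by - $X\mapsto X^{-1},\ P\mapsto P^{-1}$ for $D_4$; - $X\mapsto q^{-1}P^{-1}X^{-1},\ P\mapsto q^2X$ for $E_6$; - $X\mapsto q^{-2}P^{-1},\ P\mapsto q^2X$ for $E_7$; - $X\mapsto q^{-2}XP^{-1},\ P\mapsto qX$ for $E_8$. Let $\tau_{kj}$ ($1\le k\le m$, $1\le j\le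 d_k$) be formal parameters subject only to $\sum_j\tau_{kj}=0$ for each $k$, and put $t_{kj}=e^{\tau_{kj}}$, $u_{kj}=e^{2\pi i j/d_k}t_{kj}$. Let $\widehat{\mathbf H}$ be the algebra topologically generated over $\mathbb C[q^{\pm1}][[\tau]]$ by $T_1,\dots,T_m$ with defining relations $\prod_{j=1}^{d_k}(T_k-u_{kj})=0$ for all $k$ and $T_1\cdots T_m=q$; that is, the quotient of the $\tau$-adically completed free algebra by the closed two-sided ideal generated by these relations. Put $\widehat{\mathbf H}(q_0)=\widehat{\mathbf H}/(q-q_0)$. For a commutative ring $K$ and a $K$-algebra $A_0$, a *flat formal deformation* of $A_0$ over $K[[\tau]]$ is a $K[[\tau]]$-algebra $A$ with an isomorphism of $K$-algebras $A/(\tau)A\cong A_0$ such that $A/(\tau)^nA$ is flat over $K[[\tau]]/(\tau)^n$ for all $n$ and $A$ is topologically free, i.e. $A\cong A_0[[\tau]]$ as $K[[\tau]]$-modules, compatibly with $A/(\tau)A\cong A_0$. Then: 1. $B\cong\mathbb C[\mathbb Z_\ell]\ltimes A_{q^\ell}$ as $\mathbb C[q^{\pm1}]$-algebras (with $A_{q^\ell}$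 taken over $\mathbb C[q^{\pm1}]$), and $\widehat{\mathbf H}$ is a flat formal deformation of $B$ over $\mathbb C[q^{\pm1}][[\tau]]$, the isomorphism $\widehat{\mathbf H}/(\tau)\widehat{\mathbf H}\cong B$ sending $T_k$ to $T_k$. 2. For every $q_0\in\mathbb C^*$, $B(q_0)\cong\mathbb C[\mathbb Z_\ell]\ltimes A_{q_0^\ell}$ as $\mathbb C$-algebras, and $\widehat{\mathbf H}(q_0)$ is a flat formal deformation of $B(q_0)$ over $\mathbb C[[\tau]]$, the isomorphism $\widehat{\mathbf H}(q_0)/(\tau)\widehat{\mathbf H}(q_0)\cong B(q_0)$ sending $T_k$ to $T_k$. -/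

import Mathlib

open scoped LaurentPolynomial

noncomputable section

namespace GDAHA

/-! ### The affine star-shaped diagrams -/

/-- The simply laced Dynkin diagrams whose affinization is a star. -/
inductive Diagram
  | D4 | E6 | E7 | E8

namespace Diagram

/-- The number of legs of the affine diagram. -/
def m : Diagram → ℕ
  | D4 => 4
  | E6 => 3
  | E7 => 3
  | E8 => 3

/-- The lengths of the legs of the affine diagram, in the chosen cyclic order. -/
def legLength : (D : Diagram) → Fin D.m → ℕ
  | D4 => ![1, 1, 1, 1]
  | E6 => ![2, 2, 2]
  | E7 => ![1, 3, 3]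
  | E8 => ![1, 2, 5]

/-- The number `d k`: the length of the `k`-th leg plus one. -/
def d (D : Diagram) (k : Fin D.m) : ℕ := D.legLength k + 1

/-- The order `ℓ` of the rotation group. -/
def ell : Diagram → ℕ
  | D4 => 2
  | E6 => 3
  | E7 => 4
  | E8 => 6

/-- Index set of the independent formal parameters `τ k j`, `j = 1, …, d k - 1`;
the remaining ones are determined by `∑ j, τ k j = 0`. -/
abbrev Param (D : Diagram) : Type := Σ k : Fin D.m, Fin (D.legLength k)

end Diagram

/-! ### The quantum torus and its crossed product with `ℤ/ℓ` -/

section Torus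

variable (K : Type*) [CommRing K]

/-- Names of the generators `X, X⁻¹, P, P⁻¹`. -/
inductive TorusGen
  | X | Xinv | P | Pinv

open FreeAlgebra in
/-- Defining relations of the `Q`-Weyl algebra. -/
inductive TorusRel (Q : Kˣ) : FreeAlgebra K TorusGen → FreeAlgebra K TorusGen → Prop
  | X_mul : TorusRel Q (ι K .X * ι K .Xinv) 1
  | mul_X : TorusRel Q (ι K .Xinv * ι K .X) 1
  | P_mul : TorusRel Q (ι K .P * ι K .Pinv) 1
  | mul_P : TorusRel Q (ι K .Pinv * ι K .P) 1
  | comm : TorusRel Q (ι K .P * ι K .X) ((Q : K) • (ι K .X * ι K .P))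

variable {K}

/-- The algebra `A_{q^ℓ}`, that is the `Q`-Weyl algebra generated over `K` by `X^{±1}, P^{±1}`
with the relation `P X = Q X P`, for `Q = q^ℓ`. -/
def Torus (D : Diagram) (q : Kˣ) : Type _ := RingQuot (TorusRel K (q ^ D.ell))

namespace Torus

variable (D : Diagram) (q : Kˣ)

instance : Ring (Torus D q) := inferInstanceAs (Ring (RingQuot _))

instance : Algebra K (Torus D q) := inferInstanceAs (Algebra K (RingQuot _))

/-- The image of a generator in the `Q`-Weyl algebra. -/
def gen (g : TorusGen) : Torus D q :=
  RingQuot.mkAlgHom K (TorusRel K (q ^ D.ell)) (FreeAlgebra.ι K g)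

theorem rel {a b : FreeAlgebra K TorusGen} (h : TorusRel K (q ^ D.ell) a b) :
    (RingQuot.mkAlgHom K (TorusRel K (q ^ D.ell)) a : Torus D q) =
      RingQuot.mkAlgHom K (TorusRel K (q ^ D.ell)) b :=
  RingQuot.mkAlgHom_rel K h

/-- The invertible generator `X`. -/
def X : (Torus D q)ˣ where
  val := gen D q .X
  inv := gen D q .Xinv
  val_inv := by
    have h := rel D q .X_mul
    rw [map_mul, map_one] at h
    exact h
  inv_val := by
    have h := rel D q .mul_X
    rw [map_mul, map_one] at h
    exact h

/-- The invertible generator `P`. -/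
def P : (Torus D q)ˣ where
  val := gen D q .P
  inv := gen D q .Pinv
  val_inv := by
    have h := rel D q .P_mul
    rw [map_mul, map_one] at h
    exact h
  inv_val := by
    have h := rel D q .mul_P
    rw [map_mul, map_one] at h
    exact h

/-- The scalar `q` as a unit of an algebra. -/
def scal (A : Type*) [Ring A] [Algebra K A] : Aˣ := Units.map (algebraMap K A) q

theorem scal_comm {A : Type*} [Ring A] [Algebra K A] (u : Aˣ) : scal q A * u = u * scal q A :=
  Units.ext (Algebra.commutes _ _)

theorem P_mul_X : P D q * X D q = scal q (Torus D q) ^ D.ell * (X D q * P D q) := by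
  apply Units.ext
  have h := rel D q .comm
  rw [map_smul, map_mul, map_mul, Algebra.smul_def, Units.val_pow_eq_pow_val, map_pow] at h
  rw [Units.val_mul, Units.val_mul, Units.val_mul, Units.val_pow_eq_pow_val]
  exact h

variable {D q}

/-- The algebra map out of the `Q`-Weyl algebra given by two units with `p x = q^ℓ x p`. -/
def lift {A : Type*} [Ring A] [Algebra K A] (x p : Aˣ)
    (h : p * x = scal q A ^ D.ell * (x * p)) : Torus D q →ₐ[K] A :=
  RingQuot.liftAlgHom K ⟨FreeAlgebra.lift K fun
    | .X => (x : A)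
    | .Xinv => ((x⁻¹ : Aˣ) : A)
    | .P => (p : A)
    | .Pinv => ((p⁻¹ : Aˣ) : A), by
      intro a b hab
      cases hab with
      | comm =>
        have h' := congrArg Units.val h
        simpa [scal, Algebra.smul_def] using h'
      | _ => simp⟩

theorem lift_gen {A : Type*} [Ring A] [Algebra K A] (x p : Aˣ)
    (h : p * x = scal q A ^ D.ell * (x * p)) :
    Units.map (lift x p h : Torus D q →* A) (X D q) = x ∧
      Units.map (lift x p h : Torus D q →* A) (P D q) = p := by
  constructor
  · apply Units.ext
    change lift x p h (RingQuot.mkAlgHom K _ (FreeAlgebra.ι K .X)) = x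
    unfold lift
    erw [RingQuot.liftAlgHom_mkAlgHom_apply]
    simp
  · apply Units.ext
    change lift x p h (RingQuot.mkAlgHom K _ (FreeAlgebra.ι K .P)) = p
    unfold lift
    erw [RingQuot.liftAlgHom_mkAlgHom_apply]
    simp

theorem map_scal {A : Type*} [Ring A] [Algebra K A] (f : Torus D q →ₐ[K] A) :
    Units.map (f : Torus D q →* A) (scal q (Torus D q)) = scal q A :=
  Units.ext (f.commutes _)

theorem algHom_ext {A : Type*} [Ring A] [Algebra K A] {f g : Torus D q →ₐ[K] A}
    (hX : Units.map (f : Torus D q →* A) (X D q) = Units.map (g : Torus D q →* A) (X D q))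
    (hP : Units.map (f : Torus D q →* A) (P D q) = Units.map (g : Torus D q →* A) (P D q)) :
    f = g := by
  apply RingQuot.ringQuot_ext'
  apply FreeAlgebra.hom_ext
  funext i
  cases i
  · exact congrArg Units.val hX
  · exact congrArg Units.inv hX
  · exact congrArg Units.val hP
  · exact congrArg Units.inv hP

variable (D q)

/-- The image of `X` under the rotation `a ↦ s⁻¹ a s`. -/
def rotX : (D : Diagram) → (q : Kˣ) → (Torus D q)ˣ
  | .D4, q => (X .D4 q)⁻¹
  | .E6, q => scal q _ ^ (-1 : ℤ) * (P .E6 q)⁻¹ * (X .E6 q)⁻¹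
  | .E7, q => scal q _ ^ (-2 : ℤ) * (P .E7 q)⁻¹
  | .E8, q => scal q _ ^ (-2 : ℤ) * X .E8 q * (P .E8 q)⁻¹

/-- The image of `P` under the rotation `a ↦ s⁻¹ a s`. -/
def rotP : (D : Diagram) → (q : Kˣ) → (Torus D q)ˣ
  | .D4, q => (P .D4 q)⁻¹
  | .E6, q => scal q _ ^ (2 : ℤ) * X .E6 q
  | .E7, q => scal q _ ^ (2 : ℤ) * X .E7 q
  | .E8, q => scal q _ ^ (1 : ℤ) * X .E8 q

/-- The monomial `q^a X^i P^j`. -/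
def mon (a i j : ℤ) : (Torus D q)ˣ := scal q _ ^ a * X D q ^ i * P D q ^ j

theorem group_comm {G : Type*} [Group G] {c x p : G} (hx : Commute c x) (hp : Commute c p)
    {n : ℕ} (h : p * x = c ^ n * (x * p)) (i j : ℤ) :
    p ^ j * x ^ i = c ^ (n * i * j : ℤ) * (x ^ i * p ^ j) := by
  have h1 : SemiconjBy p x (c ^ (n : ℤ) * x) := by
    rw [SemiconjBy, h, zpow_natCast, mul_assoc]
  have h2 : ∀ i : ℤ, p * x ^ i = c ^ (n * i : ℤ) * x ^ i * p := by
    intro i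
    have := (h1.zpow_right i).eq
    rwa [(hx.zpow_left _).mul_zpow, ← zpow_mul] at this
  have h3 : SemiconjBy (x ^ i) (c ^ (n * i : ℤ) * p) p := by
    have := h2 i
    rw [SemiconjBy, this, mul_assoc, ← mul_assoc (x ^ i), ← ((hx.zpow_left _).zpow_right _).eq,
      mul_assoc]
  have h4 := (h3.zpow_right j).eq
  rw [(hp.zpow_left _).mul_zpow, ← zpow_mul] at h4
  rw [← h4, ← mul_assoc, ← ((hx.zpow_left _).zpow_right _).eq, mul_assoc]

theorem mon_mul (a i j b k l : ℤ) :
    mon D q a i j * mon D q b k l = mon D q (a + b + D.ell * k * j) (i + k) (j + l) := by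
  have hc := group_comm (c := scal q (Torus D q)) (scal_comm q _) (scal_comm q _) (P_mul_X D q) k j
  have hX : ∀ (e f : ℤ), X D q ^ f * scal q (Torus D q) ^ e =
      scal q (Torus D q) ^ e * X D q ^ f := fun e f =>
    (((show Commute (scal q (Torus D q)) (X D q) from scal_comm q _).zpow_left e).zpow_right f).eq.symm
  have hP : ∀ (e f : ℤ), P D q ^ f * scal q (Torus D q) ^ e =
      scal q (Torus D q) ^ e * P D q ^ f := fun e f =>
    (((show Commute (scal q (Torus D q)) (P D q) from scal_comm q _).zpow_left e).zpow_right f).eq.symm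
  unfold mon
  calc _ = scal q _ ^ a * X D q ^ i * (P D q ^ j * scal q _ ^ b) * X D q ^ k * P D q ^ l := by
        simp only [mul_assoc]
    _ = scal q _ ^ a * (X D q ^ i * scal q _ ^ b) * (P D q ^ j * X D q ^ k) * P D q ^ l := by
        rw [hP]; simp only [mul_assoc]
    _ = scal q _ ^ a * scal q _ ^ b * (X D q ^ i * scal q _ ^ (D.ell * k * j : ℤ)) *
          X D q ^ k * P D q ^ j * P D q ^ l := by
        rw [hc, hX]; simp only [mul_assoc]
    _ = _ := by
        rw [hX]; simp only [zpow_add, mul_assoc]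

theorem mon_one : mon D q 0 0 0 = 1 := by simp [mon]

theorem mon_inv (a i j : ℤ) :
    (mon D q a i j)⁻¹ = mon D q (-a + D.ell * i * j) (-i) (-j) := by
  rw [inv_eq_iff_mul_eq_one, mon_mul, ← mon_one D q]
  congr 1 <;> ring

theorem scal_eq (a : ℤ) : scal q (Torus D q) ^ a = mon D q a 0 0 := by simp [mon]
theorem X_eq : X D q = mon D q 0 1 0 := by simp [mon]
theorem P_eq : P D q = mon D q 0 0 1 := by simp [mon]

theorem rot_comm : (D : Diagram) → (q : Kˣ) →
    rotP D q * rotX D q = scal q (Torus D q) ^ D.ell * (rotX D q * rotP D q) := by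
  intro D q
  rw [← zpow_natCast, scal_eq]
  cases D <;> simp only [rotX, rotP]
  all_goals
    simp only [scal_eq, X_eq, P_eq, mon_inv, mon_mul, Diagram.ell]
    congr 1

/-- The rotation `a ↦ s⁻¹ a s` of the `Q`-Weyl algebra, as an endomorphism. -/
def rot : Torus D q →ₐ[K] Torus D q := lift (rotX D q) (rotP D q) (rot_comm D q)

theorem rot_mon (a i j : ℤ) : Units.map (rot D q : Torus D q →* Torus D q) (mon D q a i j) =
    mon D q a 0 0 * rotX D q ^ i * rotP D q ^ j := by
  have h := lift_gen (rotX D q) (rotP D q) (rot_comm D q)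
  rw [← scal_eq]
  simp only [mon, map_mul, map_zpow]
  rw [map_scal, rot, h.1, h.2]

theorem rotX_eq (D : Diagram) (q : Kˣ) : rotX D q = match D with
    | .D4 => mon .D4 q 0 (-1) 0
    | .E6 => mon .E6 q 2 (-1) (-1)
    | .E7 => mon .E7 q (-2) 0 (-1)
    | .E8 => mon .E8 q (-2) 1 (-1) := by
  cases D <;> simp only [rotX, scal_eq, X_eq, P_eq, mon_inv, mon_mul, Diagram.ell] <;> congr 1

theorem rotP_eq (D : Diagram) (q : Kˣ) : rotP D q = match D with
    | .D4 => mon .D4 q 0 0 (-1)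
    | .E6 => mon .E6 q 2 1 0
    | .E7 => mon .E7 q 2 1 0
    | .E8 => mon .E8 q 1 1 0 := by
  cases D <;> simp only [rotP, scal_eq, X_eq, P_eq, mon_inv, mon_mul, Diagram.ell] <;> congr 1

theorem rot_iterate (D : Diagram) (q : Kˣ) :
    (⇑(Units.map (rot D q : Torus D q →* Torus D q)))^[D.ell] (X D q) = X D q ∧
    (⇑(Units.map (rot D q : Torus D q →* Torus D q)))^[D.ell] (P D q) = P D q := by
  cases D <;> constructor <;>
    simp [Diagram.ell, X_eq, P_eq, rot_mon, rotX_eq, rotP_eq, mon_inv, mon_mul]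

theorem rot_pow (D : Diagram) (q : Kˣ) : rot D q ^ D.ell = 1 := by
  have key : ∀ n : ℕ, ∀ u : (Torus D q)ˣ,
      Units.map ((rot D q ^ n : Torus D q →ₐ[K] Torus D q) : Torus D q →* Torus D q) u =
        (⇑(Units.map (rot D q : Torus D q →* Torus D q)))^[n] u := by
    intro n
    induction n with
    | zero => intro u; rfl
    | succ n ih => intro u; rw [Function.iterate_succ_apply, ← ih, pow_succ]; rfl
  apply algHom_ext
  · rw [key, (rot_iterate D q).1]; rfl
  · rw [key, (rot_iterate D q).2]; rfl

theorem ell_pos (D : Diagram) : 0 < D.ell := by cases D <;> decide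

/-- The rotation `a ↦ s⁻¹ a s` as an automorphism. -/
def rotEquiv : Torus D q ≃ₐ[K] Torus D q :=
  AlgEquiv.ofAlgHom (rot D q) (rot D q ^ (D.ell - 1))
    (by
      change rot D q * rot D q ^ (D.ell - 1) = 1
      rw [← pow_succ', Nat.sub_add_cancel (ell_pos D), rot_pow])
    (by
      change rot D q ^ (D.ell - 1) * rot D q = 1
      rw [← pow_succ, Nat.sub_add_cancel (ell_pos D), rot_pow])

theorem rotEquiv_pow : rotEquiv D q ^ D.ell = 1 := by
  have key : ∀ n : ℕ, ∀ a, (rotEquiv D q ^ n) a = (rot D q ^ n) a := by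
    intro n
    induction n with
    | zero => intro a; rfl
    | succ n ih => intro a; rw [pow_succ, pow_succ]; exact ih _
  ext a
  rw [key, rot_pow]
  rfl

/-- The homomorphism from `ℤ/ℓ` to the automorphisms of the `Q`-Weyl algebra which sends the
generator `1` to the rotation. -/
def rotHom : Multiplicative (ZMod D.ell) →* (Torus D q ≃ₐ[K] Torus D q) :=
  AddMonoidHom.toMultiplicativeLeft
    (ZMod.lift D.ell ⟨zmultiplesHom _ (Additive.ofMul (rotEquiv D q)), by
      rw [zmultiplesHom_apply, natCast_zsmul, ← ofMul_pow, rotEquiv_pow, ofMul_one]⟩)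

theorem rotHom_one : rotHom D q (Multiplicative.ofAdd 1) = rotEquiv D q := by
  have h := ZMod.lift_coe D.ell (⟨zmultiplesHom _ (Additive.ofMul (rotEquiv D q)), by
      rw [zmultiplesHom_apply, natCast_zsmul, ← ofMul_pow, rotEquiv_pow, ofMul_one]⟩ :
      {f : ℤ →+ Additive (Torus D q ≃ₐ[K] Torus D q) // f D.ell = 0}) 1
  rw [Int.cast_one] at h
  have h2 : rotHom D q (Multiplicative.ofAdd 1) = Additive.toMul _ := congrArg Additive.toMul h
  rw [h2]
  simp

instance : MulSemiringAction (Multiplicative (ZMod D.ell)) (Torus D q) :=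
  MulSemiringAction.compHom _ (rotHom D q)

theorem smul_eq (g : Multiplicative (ZMod D.ell)) (a : Torus D q) : g • a = rotHom D q g a := rfl

instance : SMulCommClass (Multiplicative (ZMod D.ell)) K (Torus D q) where
  smul_comm g c a := map_smul (rotHom D q g) c a

end Torus

/-- The crossed product `ℂ[ℤ/ℓ] ⋉ A_{q^ℓ}`: finite formal sums of `a g` with `a` in the
`q^ℓ`-Weyl algebra and `g ∈ ℤ/ℓ`, multiplied by `(a g) (b h) = a (g • b) (g h)`. -/
abbrev CrossedProduct (D : Diagram) (q : Kˣ) : Type _ :=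
  SkewMonoidAlgebra (Torus D q) (Multiplicative (ZMod D.ell))

end Torus

/-! ### The algebra `B` and its specializations -/

/-- The variable `q` as a unit of `ℂ[q, q⁻¹]`. -/
def qvar : ℂ[T;T⁻¹]ˣ where
  val := LaurentPolynomial.T 1
  inv := LaurentPolynomial.T (-1)
  val_inv := by rw [← LaurentPolynomial.T_add]; rfl
  inv_val := by rw [← LaurentPolynomial.T_add]; rfl

open FreeAlgebra in
/-- Defining relations of `B`. -/
inductive BRel (D : Diagram) :
    FreeAlgebra ℂ[T;T⁻¹] (Fin D.m) → FreeAlgebra ℂ[T;T⁻¹] (Fin D.m) → Prop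
  | pow (k : Fin D.m) : BRel D (ι _ k ^ D.d k) 1
  | prod : BRel D (List.ofFn fun k => ι _ k).prod (algebraMap ℂ[T;T⁻¹] _ qvar)

/-- The algebra `B` over `ℂ[q, q⁻¹]`, generated by `T k` with relations `T k ^ d k = 1`
and `T 1 ⋯ T m = q`. -/
def B (D : Diagram) : Type := RingQuot (BRel D)

instance (D : Diagram) : Ring (B D) := inferInstanceAs (Ring (RingQuot _))

instance (D : Diagram) : Algebra ℂ[T;T⁻¹] (B D) := inferInstanceAs (Algebra _ (RingQuot _))

instance (D : Diagram) : Algebra ℂ (B D) := inferInstanceAs (Algebra ℂ (RingQuot _))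

/-- The generators `T k` of `B`. -/
def B.gen (D : Diagram) (k : Fin D.m) : B D :=
  RingQuot.mkAlgHom ℂ[T;T⁻¹] (BRel D) (FreeAlgebra.ι _ k)

/-- The single relation `q = q₀` imposed on an algebra over `ℂ[q, q⁻¹]`. -/
inductive SpecRel (A : Type*) [Ring A] [Algebra ℂ[T;T⁻¹] A] (q₀ : ℂˣ) : A → A → Prop
  | rel : SpecRel A q₀ (algebraMap ℂ[T;T⁻¹] A qvar)
      (algebraMap ℂ[T;T⁻¹] A (algebraMap ℂ ℂ[T;T⁻¹] q₀))

/-- The specialization `A(q₀) = A / (q - q₀)`. -/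
def Spec (A : Type*) [Ring A] [Algebra ℂ[T;T⁻¹] A] (q₀ : ℂˣ) : Type _ :=
  RingQuot (SpecRel A q₀)

instance (A : Type*) [Ring A] [Algebra ℂ[T;T⁻¹] A] (q₀ : ℂˣ) : Ring (Spec A q₀) :=
  inferInstanceAs (Ring (RingQuot _))

instance (S A : Type*) [CommRing S] [Ring A] [Algebra ℂ[T;T⁻¹] A] [Algebra S A] (q₀ : ℂˣ) :
    Algebra S (Spec A q₀) :=
  inferInstanceAs (Algebra S (RingQuot _))

/-- The quotient map `A → A(q₀)`. -/
def Spec.mk {A : Type*} [Ring A] [Algebra ℂ[T;T⁻¹] A] (q₀ : ℂˣ) : A →+* Spec A q₀ :=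
  RingQuot.mkRingHom (SpecRel A q₀)

/-! ### The formal generalized double affine Hecke algebra -/

/-- `A[[τ]]` is an algebra over `K[[τ]]`, for `A` a free algebra over a `K`-algebra `L`. -/
instance seriesAlgebra (σ K L X : Type*) [CommRing K] [CommRing L] [Algebra K L] :
    Algebra (MvPowerSeries σ K) (MvPowerSeries σ (FreeAlgebra L X)) :=
  RingHom.toAlgebra' (MvPowerSeries.map (algebraMap K (FreeAlgebra L X))) (by
    classical
    intro f x
    ext n
    rw [MvPowerSeries.coeff_mul, MvPowerSeries.coeff_mul,
      ← Finset.sum_equiv (Equiv.prodComm _ _) (s := Finset.HasAntidiagonal.antidiagonal n)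
        (fun p => by simp [add_comm]) (fun p _ => rfl)]
    refine Finset.sum_congr rfl fun p _ => ?_
    simp only [MvPowerSeries.coeff_map]
    exact Algebra.commutes _ _)

variable (D : Diagram)

/-- The formal parameters `τ k j`, with `∑ j, τ k j = 0` for each `k`: all but the last one
are independent variables. -/
def tau (k : Fin D.m) : Fin (D.d k) → MvPowerSeries D.Param ℂ :=
  Fin.snoc (α := fun _ => MvPowerSeries D.Param ℂ)
    (fun j : Fin (D.legLength k) => MvPowerSeries.X ⟨k, j⟩)
    (-∑ j : Fin (D.legLength k), MvPowerSeries.X ⟨k, j⟩)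

/-- The series `t k j = exp (τ k j)`. -/
def t (k : Fin D.m) (j : Fin (D.d k)) : MvPowerSeries D.Param ℂ :=
  (PowerSeries.exp ℂ).subst (tau D k j)

/-- The series `u k j = exp (2πi j / d k) t k j`, where `j` runs over `1, …, d k`
(so the element `j` of `Fin (d k)` stands for the index `j + 1`). -/
def u (k : Fin D.m) (j : Fin (D.d k)) : MvPowerSeries D.Param ℂ :=
  MvPowerSeries.C (Complex.exp (2 * Real.pi * Complex.I * ((j : ℕ) + 1) / (D.d k))) * t D k j

/-- The completed free algebra over `ℂ[q, q⁻¹][[τ]]` on the generators `T k`: formal power series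
in the central variables `τ` with coefficients noncommutative polynomials in the `T k`. -/
abbrev FreeHat : Type := MvPowerSeries D.Param (FreeAlgebra ℂ[T;T⁻¹] (Fin D.m))

/-- The free generator `T k`. -/
def FreeHat.gen (k : Fin D.m) : FreeHat D := MvPowerSeries.C (FreeAlgebra.ι _ k)

/-- The relators `∏ j, (T k - u k j)` and `∏ k, T k - q`. -/
inductive IsRelator : FreeHat D → Prop
  | eigen (k : Fin D.m) : IsRelator (List.ofFn fun j : Fin (D.d k) =>
      FreeHat.gen D k - algebraMap (MvPowerSeries D.Param ℂ) (FreeHat D) (u D k j)).prod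
  | prod : IsRelator ((List.ofFn fun k => FreeHat.gen D k).prod -
      algebraMap ℂ[T;T⁻¹] (FreeHat D) qvar)

/-- Congruence modulo the closure, in the `τ`-adic topology, of the two-sided ideal generated by
the relators: to any order, the difference agrees with an element of that ideal. -/
def HRel (x y : FreeHat D) : Prop :=
  ∀ n : ℕ, ∃ z ∈ TwoSidedIdeal.span {r | IsRelator D r},
    ∀ e : D.Param →₀ ℕ, e.degree < n → MvPowerSeries.coeff e (x - y) = MvPowerSeries.coeff e z

/-- The algebra topologically generated over `ℂ[q, q⁻¹][[τ]]` by the `T k`, with defining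
relations `∏ j, (T k - u k j) = 0` and `∏ k, T k = q`. -/
def HHat : Type := RingQuot (HRel D)

instance : Ring (HHat D) := inferInstanceAs (Ring (RingQuot _))

instance : Algebra (MvPowerSeries D.Param ℂ[T;T⁻¹]) (HHat D) :=
  inferInstanceAs (Algebra _ (RingQuot (HRel D)))

instance : Algebra (MvPowerSeries D.Param ℂ) (HHat D) :=
  inferInstanceAs (Algebra _ (RingQuot (HRel D)))

instance : Algebra ℂ[T;T⁻¹] (HHat D) := inferInstanceAs (Algebra _ (RingQuot (HRel D)))

/-- The generators `T k`. -/
def HHat.gen (k : Fin D.m) : HHat D := RingQuot.mkRingHom (HRel D) (FreeHat.gen D k)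

end GDAHA

namespace GDAHA

/-! ### Flat formal deformations -/

/-- The ideal generated by the formal parameters in `K[[τ]]`. -/
def paramIdeal (σ K : Type*) [CommRing K] : Ideal (MvPowerSeries σ K) :=
  Ideal.span (Set.range MvPowerSeries.X)

/-- The `K[[τ]]`-algebra `A`, together with `π : A → A₀`, is a flat formal deformation of the
`K`-algebra `A₀`: `π` identifies `A / (τ) A` with `A₀` as `K`-algebras, every
`A / (τ)^n A` is flat over `K[[τ]] / (τ)^n`, and `A` is topologically free, i.e. isomorphic to
`A₀[[τ]]` as a `K[[τ]]`-module, compatibly with `π`. -/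
structure IsFlatFormalDeformation {σ K A₀ A : Type*} [CommRing K] [Ring A₀] [Algebra K A₀]
    [Ring A] [Algebra (MvPowerSeries σ K) A] (π : A →+* A₀) : Prop where
  map_smul : ∀ (f : MvPowerSeries σ K) (a : A), π (f • a) = MvPowerSeries.constantCoeff f • π a
  surjective : Function.Surjective π
  ker : ∀ a : A, π a = 0 ↔
    a ∈ (paramIdeal σ K • ⊤ : Submodule (MvPowerSeries σ K) A)
  flat : ∀ n : ℕ, Module.Flat (MvPowerSeries σ K ⧸ paramIdeal σ K ^ n)
    (A ⧸ (paramIdeal σ K ^ n • ⊤ : Submodule (MvPowerSeries σ K) A))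
  free : ∃ Φ : A ≃+ MvPowerSeries σ A₀,
    (∀ (f : MvPowerSeries σ K) (a : A), Φ (f • a) =
      MvPowerSeries.map (algebraMap K A₀) f * Φ a) ∧
    ∀ a : A, MvPowerSeries.constantCoeff (Φ a) = π a

end GDAHA

end

/-!
The isomorphism `B ≃ ℂ[ℤ/ℓ] ⋉ A_{q^ℓ}` is given by explicit words. In the group of units of `B`,
suitable words in the `T k` satisfy the relations of the crossed product
(`StarRelations.crossedRelations`); conversely, explicit monomials in the units `q`, `X`, `P`, `s`
of the crossed product satisfy the relations of `B` (`Torus.starRelations`), and the two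
substitutions are inverse to each other (`CrossedProduct.exists_equiv`). This works over
`ℂ[q, q⁻¹]` as well as at `q = q₀`. Since the monomials `X^i P^j` form a basis of the quantum torus,
`B` has a basis over `ℂ[q, q⁻¹]` on which left multiplication by `X` shifts a `ℤ`-index
(`CrossedProduct.exists_basis`).

For flatness one deforms the left regular module `B` to the formal algebra, that is, one looks for
power series `T k` in `τ` with coefficients in `End B` which satisfy the deformed relations and
which specialize to left multiplication by `T k` at `τ = 0`. Each single eigenvalue relation is
solved by deforming the eigenvalues on the spectral projections of `T k`
(`exists_eigenvalue_deformation`). The product relation is then corrected degree by degree, by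
conjugating the `T k` with series `1 + ψ k`, which does not affect the eigenvalue relations
(`exists_formal_solution`). The obstruction in each degree is an arbitrary `η ∈ End B`, to be written
as the variation of the product `T 1 ⋯ T m` under infinitesimal conjugations of its factors. Up to
right multiplication by the invertible product, these variations form a subgroup `V` of `End B`, and
every `g` in the group generated by the `T k` satisfies `ψ - g ψ g⁻¹ ∈ V` for all `ψ`
(`exists_derivProd_commutator`). Taking for `g` the element `X` times a power of `q`, which lies in
that group, `ψ ↦ ψ - g ψ g⁻¹` is onto because `X` shifts a basis: one solves a first-order
difference equation on `ℤ` (`exists_sub_conj_eq`). So there is no obstruction.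

Acting on `1 ∈ B` then gives an additive map from the formal algebra to `B[[τ]]`, which reduces to
the identity of `B` modulo `τ`; comparison of leading terms shows that it is bijective
(`exists_equiv_series`). Topological freeness implies the other properties of a flat deformation, as
`B` is free over `ℂ[q, q⁻¹]` (`isFlatFormalDeformation_of_equiv`). At `q = q₀` everything follows by
reduction modulo `q - q₀`, which acts coefficientwise on `B[[τ]]` (`isFlatFormalDeformation_spec`).
-/

noncomputable section

namespace GDAHA

/-! ### Quotients of rings by relations -/

/-- An element of the kernel of `A → RingQuot r` lies in every two-sided ideal containing the
relators. -/
theorem mem_of_mkRingHom_eq_zero {A : Type*} [Ring A] {r : A → A → Prop} (I : TwoSidedIdeal A)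
    (h : ∀ x y, r x y → x - y ∈ I) {a : A} (ha : RingQuot.mkRingHom r a = 0) : a ∈ I := by
  have hw : ∀ ⦃x y⦄, r x y → I.ringCon.mk' x = I.ringCon.mk' y := fun x y hxy =>
    (RingCon.eq _).2 ((TwoSidedIdeal.rel_iff I x y).2 (h x y hxy))
  have h1 := RingQuot.lift_mkRingHom_apply I.ringCon.mk' hw a
  rw [ha, map_zero] at h1
  have h2 : I.ringCon a 0 := (RingCon.eq _).1 (h1.symm.trans (map_zero I.ringCon.mk').symm)
  rwa [TwoSidedIdeal.rel_iff, sub_zero] at h2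

theorem smul_mkRingHom {S A : Type*} [CommRing S] [Ring A] [Algebra S A] (r : A → A → Prop) (c : S)
    (x : A) : c • RingQuot.mkRingHom r x = RingQuot.mkRingHom r (c • x) := by
  have h := DFunLike.congr_fun (RingQuot.mkAlgHom_coe S r)
  rw [← h, ← h]
  exact (map_smul (RingQuot.mkAlgHom S r) c x).symm

/-! ### Conjugation by a shift -/

/-- Every function on `ℤ` with values in an abelian group is a difference function. -/
theorem exists_antidifference {M : Type*} [AddCommGroup M] (h : ℤ → M) :
    ∃ d : ℤ → M, ∀ n, d (n + 1) = d n + h n := by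
  refine ⟨fun n => match n with
    | Int.ofNat n => ∑ i ∈ Finset.range n, h i
    | Int.negSucc n => -∑ i ∈ Finset.range (n + 1), h (Int.negSucc i), fun n => ?_⟩
  match n with
  | Int.ofNat n =>
    change ∑ i ∈ Finset.range (n + 1), h i = _
    rw [Finset.sum_range_succ]
    rfl
  | Int.negSucc 0 =>
    change ∑ i ∈ Finset.range 0, h i = -∑ i ∈ Finset.range 1, h (Int.negSucc i) + _
    simp
  | Int.negSucc (n + 1) =>
    change -∑ i ∈ Finset.range (n + 1), h (Int.negSucc i) =
      -∑ i ∈ Finset.range (n + 1 + 1), h (Int.negSucc i) + _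
    rw [Finset.sum_range_succ _ (n + 1)]
    abel

/-- If `x` permutes a basis by shifting a `ℤ`-index, then conjugation by `x` differs from the
identity by a surjective map on endomorphisms: on each orbit of `x` one solves a first-order
difference equation on `ℤ`. -/
theorem exists_sub_conj_eq {K M ι : Type*} [CommRing K] [AddCommGroup M] [Module K M]
    (b : Module.Basis (ℤ × ι) K M) (x : (Module.End K M)ˣ)
    (hx : ∀ n i, (x : Module.End K M) (b (n, i)) = b (n + 1, i)) (φ : Module.End K M) :
    ∃ ψ : Module.End K M, ψ - x * ψ * (↑x⁻¹ : Module.End K M) = φ := by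
  have hz : ∀ (n : ℤ) (v : M), (↑(x ^ (n + 1)) : Module.End K M) v =
      (x : Module.End K M) ((↑(x ^ n) : Module.End K M) v) := by
    intro n v
    rw [← Module.End.mul_apply, ← Units.val_mul, zpow_add, zpow_one, (Commute.zpow_self x n).eq]
  have hz' : ∀ (n : ℤ) (v : M), (↑(x ^ n) : Module.End K M) ((↑(x ^ (-n)) : Module.End K M) v) =
      v := by
    intro n v
    rw [← Module.End.mul_apply, ← Units.val_mul, zpow_neg, mul_inv_cancel]; rfl
  choose d hd using fun i : ι => exists_antidifference
    fun n : ℤ => (↑(x ^ (-(n + 1))) : Module.End K M) (φ (b (n + 1, i)))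
  refine ⟨b.constr K fun p => (↑(x ^ p.1) : Module.End K M) (d p.2 p.1), b.ext fun p => ?_⟩
  obtain ⟨n, i⟩ := p
  obtain ⟨n, rfl⟩ : ∃ k, n = k + 1 := ⟨n - 1, by ring⟩
  have hinv : (↑x⁻¹ : Module.End K M) (b (n + 1, i)) = b (n, i) := by
    rw [← hx, ← Module.End.mul_apply, Units.inv_mul]; rfl
  rw [LinearMap.sub_apply, Module.End.mul_apply, Module.End.mul_apply, hinv,
    Module.Basis.constr_basis, Module.Basis.constr_basis]
  dsimp only
  rw [hd, map_add, hz', hz]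
  abel

/-! ### Variation of an ordered product under conjugation of its factors -/

/-- The derivative at `T`, in the direction `δ`, of the ordered product `T 0 * T 1 * ⋯`. -/
def derivProd {A : Type*} [Ring A] : (n : ℕ) → (Fin n → A) → (Fin n → A) → A
  | 0, _, _ => 0
  | n + 1, T, δ => δ 0 * (List.ofFn fun k => T k.succ).prod +
      T 0 * derivProd n (fun k => T k.succ) fun k => δ k.succ

section

variable {A : Type*} [Ring A]

theorem derivProd_add {n : ℕ} (T δ ε : Fin n → A) :
    derivProd n T (δ + ε) = derivProd n T δ + derivProd n T ε := by
  induction n with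
  | zero => simp [derivProd]
  | succ n ih =>
    simp only [derivProd, Pi.add_apply]
    have := ih (fun k => T k.succ) (fun k => δ k.succ) (fun k => ε k.succ)
    rw [show (fun k : Fin n => δ k.succ + ε k.succ) =
      (fun k => δ k.succ) + fun k => ε k.succ from rfl, this]
    noncomm_ring

theorem derivProd_neg {n : ℕ} (T δ : Fin n → A) :
    derivProd n T (-δ) = -derivProd n T δ := by
  induction n with
  | zero => simp [derivProd]
  | succ n ih =>
    simp only [derivProd, Pi.neg_apply]
    have := ih (fun k => T k.succ) (fun k => δ k.succ)
    rw [show (fun k : Fin n => -δ k.succ) = -(fun k => δ k.succ) from rfl, this]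
    noncomm_ring

theorem derivProd_zero {n : ℕ} (T : Fin n → A) : derivProd n T 0 = 0 := by
  have := derivProd_add T 0 0
  simpa using this

/-- The logarithmic derivatives of the ordered product of the units `T k` along infinitesimal
conjugations of the `T k`. -/
def conjVariation {n : ℕ} (T : Fin n → Aˣ) : AddSubgroup A where
  carrier := {v | ∃ ψ : Fin n → A, derivProd n (fun k => (T k : A))
    (fun k => ψ k * T k - T k * ψ k) = v * (List.ofFn fun k => (T k : A)).prod}
  zero_mem' := ⟨0, by
    simp only [Pi.zero_apply, zero_mul, mul_zero, sub_zero]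
    exact derivProd_zero (fun k => (T k : A))⟩
  add_mem' := by
    rintro a b ⟨ψ, hψ⟩ ⟨χ, hχ⟩
    refine ⟨ψ + χ, ?_⟩
    rw [add_mul, ← hψ, ← hχ, ← derivProd_add]
    congr 1
    funext k
    simp only [Pi.add_apply]
    noncomm_ring
  neg_mem' := by
    rintro a ⟨ψ, hψ⟩
    refine ⟨-ψ, ?_⟩
    rw [neg_mul, ← hψ, ← derivProd_neg]
    congr 1
    funext k
    simp only [Pi.neg_apply]
    noncomm_ring

/-- The units `g` such that conjugation by `g` is congruent to the identity modulo `V`; they form a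
subgroup, although `V` need not be stable under conjugation. -/
def trivialConj (V : AddSubgroup A) : Subgroup Aˣ where
  carrier := {g | ∀ ψ : A, ψ - g * ψ * (↑g⁻¹ : A) ∈ V}
  one_mem' := fun ψ => by simp [V.zero_mem]
  mul_mem' := by
    intro g h hg hh ψ
    have := V.add_mem (hh ψ) (hg (h * ψ * (↑h⁻¹ : A)))
    rw [mul_inv_rev, Units.val_mul, Units.val_mul]
    convert this using 1
    noncomm_ring
  inv_mem' := by
    intro g hg ψ
    have := V.neg_mem (hg ((↑g⁻¹ : A) * ψ * g))
    rw [inv_inv]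
    convert this using 1
    simp [mul_assoc]

/-- Conjugating the first factor only. -/
theorem sub_conj_mem_conjVariation {n : ℕ} (T : Fin (n + 1) → Aˣ) (ψ : A) :
    ψ - T 0 * ψ * (↑(T 0)⁻¹ : A) ∈ conjVariation T := by
  refine ⟨Fin.cons ψ 0, ?_⟩
  simp only [derivProd, Fin.cons_zero, Fin.cons_succ, List.ofFn_succ, List.prod_cons]
  have := derivProd_zero (fun k : Fin n => (T k.succ : A))
  simp only [Pi.zero_apply, zero_mul, mul_zero, sub_zero]
  rw [show (fun _ : Fin n => (0 : A)) = 0 from rfl, this, sub_mul]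
  simp [mul_assoc, sub_mul]

/-- Conjugating all factors but the first. -/
theorem conj_mem_conjVariation {n : ℕ} (T : Fin (n + 1) → Aˣ) {v : A}
    (hv : v ∈ conjVariation fun k => T k.succ) :
    T 0 * v * (↑(T 0)⁻¹ : A) ∈ conjVariation T := by
  obtain ⟨ψ, hψ⟩ := hv
  refine ⟨Fin.cons 0 ψ, ?_⟩
  simp only [derivProd, Fin.cons_zero, Fin.cons_succ, List.ofFn_succ, List.prod_cons]
  rw [hψ]
  simp [mul_assoc]

/-- By induction applied to the remaining factors, `T 0 * T k * (T 0)⁻¹` lies in the subgroup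
`trivialConj`, and so does `T 0`. -/
theorem mem_trivialConj_conjVariation {n : ℕ} (T : Fin n → Aˣ) (k : Fin n) :
    T k ∈ trivialConj (conjVariation T) := by
  induction n with
  | zero => exact k.elim0
  | succ n ih =>
    have h0 : T 0 ∈ trivialConj (conjVariation T) := sub_conj_mem_conjVariation T
    refine Fin.cases h0 (fun k => ?_) k
    have h1 : T 0 * T k.succ * (T 0)⁻¹ ∈ trivialConj (conjVariation T) := by
      intro ψ
      have := conj_mem_conjVariation T (ih (fun k => T k.succ) k ((↑(T 0)⁻¹ : A) * ψ * T 0))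
      convert this using 1
      simp [mul_assoc, mul_sub, sub_mul]
    have := mul_mem (mul_mem (inv_mem h0) h1) h0
    simpa [mul_assoc] using this

/-- If some `g` in the group generated by the `T k` is such that `ψ ↦ ψ - g ψ g⁻¹` is surjective,
then every infinitesimal change of the ordered product of the `T k` comes from infinitesimal
conjugations of the `T k`. -/
theorem exists_derivProd_commutator {n : ℕ} (T : Fin n → Aˣ) {g : Aˣ}
    (hg : g ∈ Subgroup.closure (Set.range T))
    (hs : ∀ φ : A, ∃ ψ : A, ψ - g * ψ * (↑g⁻¹ : A) = φ) (η : A) :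
    ∃ ψ : Fin n → A, derivProd n (fun k => (T k : A))
      (fun k => ψ k * T k - T k * ψ k) = η := by
  have hle : Subgroup.closure (Set.range T) ≤ trivialConj (conjVariation T) := by
    rw [Subgroup.closure_le]
    rintro _ ⟨k, rfl⟩
    exact mem_trivialConj_conjVariation T k
  have hp : (List.ofFn fun k => (T k : A)).prod = ((List.ofFn T).prod : Aˣ) := by
    rw [← Units.coeHom_apply, map_list_prod, List.map_ofFn]; rfl
  obtain ⟨ψ, hψ⟩ := hs (η * (↑((List.ofFn T).prod)⁻¹ : A))
  obtain ⟨χ, hχ⟩ := hle hg ψ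
  refine ⟨χ, ?_⟩
  rw [hχ, hψ, hp, Units.inv_mul_cancel_right]

end

/-! ### Solving multiplicative equations over power series -/

section

open MvPowerSeries

variable {σ A : Type*} [Ring A]

variable (σ A) in
/-- Congruence of power series modulo terms of degree at least `n`. -/
def degCon (n : ℕ) : RingCon (MvPowerSeries σ A) where
  r x y := ∀ e : σ →₀ ℕ, e.degree < n → coeff e x = coeff e y
  iseqv := ⟨fun _ _ _ => rfl, fun h e he => (h e he).symm,
    fun h h' e he => (h e he).trans (h' e he)⟩
  add' := fun h h' e he => by rw [map_add, map_add, h e he, h' e he]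
  mul' := fun h h' e he => by
    classical
    rw [coeff_mul, coeff_mul]
    refine Finset.sum_congr rfl fun p hp => ?_
    have hd : p.1.degree + p.2.degree = e.degree := by
      rw [← map_add, Finset.HasAntidiagonal.mem_antidiagonal.1 hp]
    rw [h p.1 (by omega), h' p.2 (by omega)]

theorem degCon_iff {n : ℕ} {x y : MvPowerSeries σ A} :
    degCon σ A n x y ↔ ∀ e : σ →₀ ℕ, e.degree < n → coeff e x = coeff e y := Iff.rfl

theorem degCon_sub {n : ℕ} {x y : MvPowerSeries σ A} :
    degCon σ A n x y ↔ degCon σ A n (x - y) 0 := by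
  simp only [degCon_iff, map_sub, map_zero, sub_eq_zero]

theorem degCon_mono {m n : ℕ} (hmn : m ≤ n) {x y : MvPowerSeries σ A} (h : degCon σ A n x y) :
    degCon σ A m x y := fun e he => h e (he.trans_le hmn)

theorem eq_of_forall_degCon {x y : MvPowerSeries σ A} (h : ∀ n, degCon σ A n x y) : x = y :=
  MvPowerSeries.ext fun e => h (e.degree + 1) e (Nat.lt_succ_self _)

/-- A `τ`-adic Cauchy sequence converges. -/
theorem exists_degCon_limit (s : ℕ → MvPowerSeries σ A)
    (h : ∀ n, degCon σ A n (s (n + 1)) (s n)) : ∃ x, ∀ n, degCon σ A n x (s n) := by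
  have h' : ∀ n i, degCon σ A n (s (n + i)) (s n) := by
    intro n i
    induction i with
    | zero => exact (degCon σ A n).refl _
    | succ i ih => exact (degCon σ A n).trans (degCon_mono (by omega) (h (n + i))) ih
  refine ⟨fun e => coeff e (s (e.degree + 1)), fun n e he => ?_⟩
  obtain ⟨i, rfl⟩ : ∃ i, n = e.degree + 1 + i := ⟨n - (e.degree + 1), by omega⟩
  exact (h' (e.degree + 1) i e (Nat.lt_succ_self _)).symm

theorem degCon_listProd {n m : ℕ} {x y : Fin m → MvPowerSeries σ A}
    (h : ∀ k, degCon σ A n (x k) (y k)) :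
    degCon σ A n (List.ofFn x).prod (List.ofFn y).prod := by
  rw [← RingCon.eq, ← RingCon.coe_mk', map_list_prod, map_list_prod, List.map_ofFn, List.map_ofFn]
  congr 2
  funext k
  exact (RingCon.eq _).2 (h k)

/-- The product of terms of degree at least `m` and at least `n` has degree at least `m + n`. -/
theorem degCon_mul_zero {m n : ℕ} {x y : MvPowerSeries σ A} (hx : degCon σ A m x 0)
    (hy : degCon σ A n y 0) : degCon σ A (m + n) (x * y) 0 := by
  classical
  intro e he
  rw [coeff_mul, map_zero]
  refine Finset.sum_eq_zero fun p hp => ?_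
  have hd : p.1.degree + p.2.degree = e.degree := by
    rw [← map_add, Finset.HasAntidiagonal.mem_antidiagonal.1 hp]
  by_cases h : p.1.degree < m
  · rw [hx _ h, map_zero, zero_mul]
  · rw [hy _ (by omega), map_zero, mul_zero]

theorem coeff_mul_of_degCon_zero {n : ℕ} {x y : MvPowerSeries σ A} (hy : degCon σ A n y 0)
    {e : σ →₀ ℕ} (he : e.degree ≤ n) : coeff e (x * y) = constantCoeff x * coeff e y := by
  classical
  rw [coeff_mul, Finset.sum_eq_single (0, e)]
  · rw [coeff_zero_eq_constantCoeff_apply]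
  · intro p hp hne
    have hd : p.1.degree + p.2.degree = e.degree := by
      rw [← map_add, Finset.HasAntidiagonal.mem_antidiagonal.1 hp]
    have : p.1.degree ≠ 0 := by
      intro h0
      have h1 : p.1 = 0 := (Finsupp.degree_eq_zero_iff _).1 h0
      apply hne
      rw [← Finset.HasAntidiagonal.mem_antidiagonal.1 hp, h1, zero_add]
      exact Prod.ext h1 rfl
    rw [hy p.2 (by omega), map_zero, mul_zero]
  · intro h
    exact (h (by simp)).elim

theorem coeff_mul_of_zero_degCon {n : ℕ} {x y : MvPowerSeries σ A} (hx : degCon σ A n x 0)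
    {e : σ →₀ ℕ} (he : e.degree ≤ n) : coeff e (x * y) = coeff e x * constantCoeff y := by
  classical
  rw [coeff_mul, Finset.sum_eq_single (e, 0)]
  · rw [coeff_zero_eq_constantCoeff_apply]
  · intro p hp hne
    have hd : p.1.degree + p.2.degree = e.degree := by
      rw [← map_add, Finset.HasAntidiagonal.mem_antidiagonal.1 hp]
    have : p.2.degree ≠ 0 := by
      intro h0
      have h1 : p.2 = 0 := (Finsupp.degree_eq_zero_iff _).1 h0
      apply hne
      rw [← Finset.HasAntidiagonal.mem_antidiagonal.1 hp, h1, add_zero]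
      exact Prod.ext rfl h1
    rw [hx p.1 (by omega), map_zero, zero_mul]
  · intro h
    exact (h (by simp)).elim

theorem constantCoeff_listProd {m : ℕ} (T : Fin m → MvPowerSeries σ A) :
    constantCoeff (List.ofFn T).prod = (List.ofFn fun k => constantCoeff (T k)).prod := by
  rw [map_list_prod, List.map_ofFn]; rfl

/-- To leading order, changing the factors of a product changes it by the derivative. -/
theorem coeff_listProd_add {n m : ℕ} (hn : 1 ≤ n) (T δ : Fin m → MvPowerSeries σ A)
    (hδ : ∀ k, degCon σ A n (δ k) 0) {e : σ →₀ ℕ} (he : e.degree ≤ n) :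
    coeff e (List.ofFn fun k => T k + δ k).prod = coeff e (List.ofFn T).prod +
      derivProd m (fun k => constantCoeff (T k)) (fun k => coeff e (δ k)) := by
  induction m with
  | zero => simp [derivProd]
  | succ m ih =>
    rw [List.ofFn_succ, List.prod_cons, List.ofFn_succ, List.prod_cons, derivProd]
    set P := (List.ofFn fun k => T k.succ).prod with hP
    obtain ⟨ε, hε⟩ : ∃ ε, (List.ofFn fun k : Fin m => T k.succ + δ k.succ).prod = P + ε :=
      ⟨_, (add_sub_cancel _ _).symm⟩
    have h1 : degCon σ A n ε 0 := by
      have : degCon σ A n (P + ε) P := by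
        rw [← hε]
        refine degCon_listProd fun k => ?_
        rw [degCon_sub, add_sub_cancel_left]
        exact hδ _
      rwa [degCon_sub, add_sub_cancel_left] at this
    have h2 := ih (fun k => T k.succ) (fun k => δ k.succ) fun k => hδ _
    rw [hε, map_add, add_right_inj] at h2
    have h3 : coeff e (δ 0 * ε) = 0 := degCon_mul_zero (hδ 0) h1 e (by omega)
    rw [hε, ← h2, ← constantCoeff_listProd, ← hP, ← coeff_mul_of_degCon_zero h1 he,
      ← coeff_mul_of_zero_degCon (hδ 0) he, add_mul, mul_add, mul_add, map_add, map_add, map_add,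
      h3]
    abel

/-- One plus a series without constant term, as a unit. -/
def oneAddUnit (ψ : MvPowerSeries σ A) (h : constantCoeff ψ = 0) : (MvPowerSeries σ A)ˣ where
  val := 1 + ψ
  inv := invOfUnit (1 + ψ) 1
  val_inv := mul_invOfUnit _ _ (by simp [h])
  inv_val := invOfUnit_mul _ _ (by simp [h])

/-- Conjugation by `1 + ψ` changes `T` by `[ψ, T]` to leading order. -/
theorem coeff_oneAddUnit_conj {n : ℕ} (ψ T : MvPowerSeries σ A)
    (h0 : constantCoeff ψ = 0) (hψ : degCon σ A n ψ 0) {e : σ →₀ ℕ} (he : e.degree ≤ n) :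
    coeff e ((oneAddUnit ψ h0 : MvPowerSeries σ A) * T *
        (↑(oneAddUnit ψ h0)⁻¹ : MvPowerSeries σ A) - T) =
      coeff e ψ * constantCoeff T - constantCoeff T * coeff e ψ := by
  set φ := oneAddUnit ψ h0 with hφ
  set S := φ * T * (↑φ⁻¹ : MvPowerSeries σ A) with hS
  have h1 : S * (1 + ψ) = (1 + ψ) * T := by
    change S * (φ : MvPowerSeries σ A) = φ * T
    rw [hS, mul_assoc, Units.inv_mul, mul_one]
  have h2 : S - T = ψ * T - S * ψ := by
    rw [mul_add, add_mul, mul_one, one_mul] at h1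
    rw [sub_eq_sub_iff_add_eq_add, h1, add_comm]
  have hc : constantCoeff S = constantCoeff T := by
    have := congrArg constantCoeff h2
    clear_value S
    rwa [map_sub, map_sub, map_mul, map_mul, h0, zero_mul, mul_zero, sub_zero, sub_eq_zero] at this
  rw [h2, map_sub, coeff_mul_of_degCon_zero hψ he, coeff_mul_of_zero_degCon hψ he, hc]

theorem conj_listProd {N : Type*} [Ring N] {d : ℕ} (φ : Nˣ) (x : N) (u : Fin d → N)
    (hu : ∀ j y, Commute (u j) y) :
    (List.ofFn fun j => φ * x * (↑φ⁻¹ : N) - u j).prod =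
      φ * (List.ofFn fun j => x - u j).prod * (↑φ⁻¹ : N) := by
  induction d with
  | zero => simp
  | succ d ih =>
    rw [List.ofFn_succ, List.prod_cons, List.ofFn_succ, List.prod_cons,
      ih (fun j => u j.succ) fun j => hu _]
    have : φ * x * (↑φ⁻¹ : N) - u 0 = φ * (x - u 0) * (↑φ⁻¹ : N) := by
      rw [mul_sub, sub_mul, ← (hu 0 φ).eq, mul_assoc (u 0), Units.mul_inv, mul_one]
    rw [this]
    simp only [mul_assoc, Units.inv_mul_cancel_left]

/-- Formal solution of `T 0 * ⋯ * T (m - 1) = c` with prescribed "eigenvalues" `u k j` of the `T k`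
and prescribed constant terms, provided the linearized equation is solvable: starting from a
solution of the eigenvalue equations one corrects the product degree by degree, conjugating each
factor by `1 + ψ` with `ψ` homogeneous. -/
theorem exists_formal_solution {m : ℕ} {d : Fin m → ℕ} (u : ∀ k, Fin (d k) → MvPowerSeries σ A)
    (hu : ∀ k j y, Commute (u k j) y) (U : Fin m → MvPowerSeries σ A)
    (hU : ∀ k, (List.ofFn fun j => U k - u k j).prod = 0) (c : MvPowerSeries σ A)
    (hc : constantCoeff (List.ofFn U).prod = constantCoeff c)
    (hs : ∀ η : A, ∃ ψ : Fin m → A, derivProd m (fun k => constantCoeff (U k))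
      (fun k => ψ k * constantCoeff (U k) - constantCoeff (U k) * ψ k) = η) :
    ∃ T : Fin m → MvPowerSeries σ A, (∀ k, constantCoeff (T k) = constantCoeff (U k)) ∧
      (∀ k, (List.ofFn fun j => T k - u k j).prod = 0) ∧ (List.ofFn T).prod = c := by
  classical
  -- Approximate solutions modulo degree `n + 1`.
  let P : ℕ → (Fin m → MvPowerSeries σ A) → Prop := fun n T =>
    (∀ k, constantCoeff (T k) = constantCoeff (U k)) ∧
      (∀ k, (List.ofFn fun j => T k - u k j).prod = 0) ∧ degCon σ A (n + 1) (List.ofFn T).prod c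
  have step : ∀ n T, P n T → ∃ T', P (n + 1) T' ∧ ∀ k, degCon σ A (n + 1) (T' k) (T k) := by
    rintro n T ⟨h1, h2, h3⟩
    choose ψ hψ using fun e : σ →₀ ℕ => hs (coeff e (c - (List.ofFn T).prod))
    let Ψ : Fin m → MvPowerSeries σ A := fun k e => if e.degree = n + 1 then ψ e k else 0
    have hΨc : ∀ k e, coeff e (Ψ k) = if e.degree = n + 1 then ψ e k else 0 := fun k e => rfl
    have hΨ0 : ∀ k, constantCoeff (Ψ k) = 0 := by
      intro k
      rw [← coeff_zero_eq_constantCoeff_apply, hΨc, if_neg]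
      rw [map_zero]; omega
    have hΨ : ∀ k, degCon σ A (n + 1) (Ψ k) 0 := by
      intro k e he
      rw [hΨc, if_neg (by omega), map_zero]
    let T' : Fin m → MvPowerSeries σ A := fun k =>
      oneAddUnit (Ψ k) (hΨ0 k) * T k * (↑(oneAddUnit (Ψ k) (hΨ0 k))⁻¹ : MvPowerSeries σ A)
    have hδ : ∀ k e, e.degree ≤ n + 1 → coeff e (T' k - T k) =
        coeff e (Ψ k) * constantCoeff (U k) - constantCoeff (U k) * coeff e (Ψ k) := by
      intro k e he
      rw [← h1]
      exact coeff_oneAddUnit_conj _ _ _ (hΨ k) he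
    have hδ0 : ∀ k, degCon σ A (n + 1) (T' k - T k) 0 := by
      intro k e he
      rw [hδ k e (by omega), hΨ k e he]
      simp
    have hT' : T' = fun k => T k + (T' k - T k) := by funext k; abel
    refine ⟨T', ⟨fun k => ?_, fun k => ?_, fun e he => ?_⟩, fun k => degCon_sub.2 (hδ0 k)⟩
    · rw [← h1, ← sub_eq_zero, ← map_sub, ← coeff_zero_eq_constantCoeff_apply, hδ0 k 0 (by simp),
        map_zero]
    · change (List.ofFn fun j => _ * T k * _ - u k j).prod = 0
      rw [conj_listProd _ _ _ (hu k), h2, mul_zero, zero_mul]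
    · rw [hT', coeff_listProd_add (n := n + 1) (by omega) _ _ hδ0 (by omega)]
      by_cases hen : e.degree = n + 1
      · have : (fun k => coeff e (T' k - T k)) =
            fun k => ψ e k * constantCoeff (U k) - constantCoeff (U k) * ψ e k := by
          funext k
          rw [hδ k e (by omega), hΨc, if_pos hen]
        rw [this, funext h1, hψ, map_sub, add_sub_cancel]
      · have : (fun k => coeff e (T' k - T k)) = 0 := by
          funext k
          rw [hδ0 k e (by omega), map_zero]; rfl
        rw [this, derivProd_zero, add_zero, h3 e (by omega)]
  have base : P 0 U := by
    refine ⟨fun _ => rfl, hU, fun e he => ?_⟩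
    have : e = 0 := (Finsupp.degree_eq_zero_iff _).1 (by omega)
    rw [this, coeff_zero_eq_constantCoeff_apply, coeff_zero_eq_constantCoeff_apply, hc]
  choose next hnext using step
  let seq : (n : ℕ) → {T // P n T} := fun n =>
    Nat.rec ⟨U, base⟩ (fun n T => ⟨next n T.1 T.2, (hnext n T.1 T.2).1⟩) n
  have hseq : ∀ n k, degCon σ A (n + 1) ((seq (n + 1)).1 k) ((seq n).1 k) := fun n k =>
    (hnext n (seq n).1 (seq n).2).2 k
  choose T hT using fun k => exists_degCon_limit (fun n => (seq n).1 k)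
    fun n => degCon_mono (Nat.le_succ n) (hseq n k)
  refine ⟨T, fun k => ?_, fun k => ?_, ?_⟩
  · have := hT k 1 0 (by simp)
    rw [coeff_zero_eq_constantCoeff_apply, coeff_zero_eq_constantCoeff_apply] at this
    rw [this, (seq 1).2.1]
  · refine eq_of_forall_degCon fun n => ?_
    rw [← (seq n).2.2.1 k]
    exact degCon_listProd fun j => (degCon σ A n).sub (hT k n) ((degCon σ A n).refl _)
  · refine eq_of_forall_degCon fun n => ?_
    exact (degCon σ A n).trans (degCon_listProd fun k => hT k n)
      (degCon_mono (Nat.le_succ n) (seq n).2.2.2)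

end

/-! ### Deforming the eigenvalues of an element of finite order -/

section

open MvPowerSeries

/-- The `d`-th root of unity which is the constant term of `u k j`, `d = d k`. -/
def rootOfUnity (d : ℕ) (j : Fin d) : ℂ :=
  Complex.exp (2 * Real.pi * Complex.I * ((j : ℕ) + 1) / d)

theorem rootOfUnity_eq_pow (d : ℕ) (j : Fin d) :
    rootOfUnity d j = Complex.exp (2 * Real.pi * Complex.I / d) ^ ((j : ℕ) + 1) := by
  rw [rootOfUnity, ← Complex.exp_nat_mul]
  congr 1
  push_cast
  ring

theorem rootOfUnity_pow {d : ℕ} (j : Fin d) : rootOfUnity d j ^ d = 1 := by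
  have hd : d ≠ 0 := by rintro rfl; exact j.elim0
  rw [rootOfUnity_eq_pow, pow_right_comm,
    (Complex.isPrimitiveRoot_exp d hd).pow_eq_one, one_pow]

theorem rootOfUnity_ne_zero {d : ℕ} (j : Fin d) : rootOfUnity d j ≠ 0 := Complex.exp_ne_zero _

theorem rootOfUnity_injective (d : ℕ) : Function.Injective (rootOfUnity d) := by
  intro i j h
  have hd : d ≠ 0 := by rintro rfl; exact i.elim0
  have hp := Complex.isPrimitiveRoot_exp d hd
  rw [rootOfUnity_eq_pow, rootOfUnity_eq_pow, pow_succ, pow_succ] at h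
  exact Fin.ext (hp.pow_inj i.2 j.2 (mul_right_cancel₀ (hp.ne_zero hd) h))

theorem X_pow_sub_one_eq {d : ℕ} (hd : 0 < d) : (Polynomial.X ^ d - 1 : Polynomial ℂ) =
    ∏ j : Fin d, (Polynomial.X - Polynomial.C (rootOfUnity d j)) := by
  have hp := Complex.isPrimitiveRoot_exp d hd.ne'
  have himg : (Finset.univ.image (rootOfUnity d)) = Polynomial.nthRootsFinset d (1 : ℂ) := by
    apply Finset.eq_of_subset_of_card_le
    · intro x hx
      obtain ⟨j, -, rfl⟩ := Finset.mem_image.1 hx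
      exact (Polynomial.mem_nthRootsFinset hd _).2 (rootOfUnity_pow j)
    · rw [hp.card_nthRootsFinset, Finset.card_image_of_injective _ (rootOfUnity_injective d)]
      simp
  rw [Polynomial.X_pow_sub_one_eq_prod hd hp, ← himg,
    Finset.prod_image fun _ _ _ _ h => rootOfUnity_injective d h]

variable {A : Type*} [Ring A] [Algebra ℂ A]

theorem pow_sub_one_eq_prod {d : ℕ} (hd : 0 < d) (T : A) :
    T ^ d - 1 = (List.ofFn fun j : Fin d => T - algebraMap ℂ A (rootOfUnity d j)).prod := by
  have := congrArg (Polynomial.aeval T) (X_pow_sub_one_eq hd)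
  rw [map_sub, map_pow, Polynomial.aeval_X, map_one, ← List.prod_ofFn, map_list_prod,
    List.map_ofFn] at this
  rw [this]
  congr 2
  funext j
  simp

/-- The spectral projection of an element `T` with `T ^ d = 1`. -/
def spectralProj (d : ℕ) (T : A) (j : Fin d) : A :=
  (d : ℂ)⁻¹ • ∑ a ∈ Finset.range d, ((rootOfUnity d j)⁻¹ • T) ^ a

variable {d : ℕ} {T : A}

theorem mul_spectralProj (hT : T ^ d = 1) (j : Fin d) :
    T * spectralProj d T j = rootOfUnity d j • spectralProj d T j := by
  have h1 := mul_geom_sum ((rootOfUnity d j)⁻¹ • T) d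
  rw [smul_pow, hT, inv_pow, rootOfUnity_pow, inv_one, one_smul, sub_self, sub_mul, one_mul,
    sub_eq_zero, smul_mul_assoc] at h1
  rw [spectralProj, mul_smul_comm, smul_comm]
  congr 1
  nth_rewrite 2 [← h1]
  rw [smul_smul, mul_inv_cancel₀ (rootOfUnity_ne_zero j), one_smul]

theorem sum_spectralProj (hd : d ≠ 0) (T : A) : ∑ j, spectralProj d T j = 1 := by
  have hp := Complex.isPrimitiveRoot_exp d hd
  have hsum : ∀ a ∈ Finset.range d, a ≠ 0 → ∑ j : Fin d, (rootOfUnity d j)⁻¹ ^ a = 0 := by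
    intro a ha ha0
    set z := Complex.exp (2 * Real.pi * Complex.I / d) with hz
    have h1 : z ^ a ≠ 1 := hp.pow_ne_one_of_pos_of_lt ha0 (Finset.mem_range.1 ha)
    have h2 : ((z ^ a)⁻¹ - 1) * ∑ i ∈ Finset.range d, (z ^ a)⁻¹ ^ i = 0 := by
      rw [mul_geom_sum, inv_pow, ← pow_mul, mul_comm, pow_mul, hp.pow_eq_one, one_pow, inv_one,
        sub_self]
    have h3 : (z ^ a)⁻¹ - 1 ≠ 0 := by rwa [sub_ne_zero, ne_eq, inv_eq_one]
    have h4 := (mul_eq_zero.1 h2).resolve_left h3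
    have h5 : ∀ j : Fin d, (rootOfUnity d j)⁻¹ ^ a = (z ^ a)⁻¹ * (z ^ a)⁻¹ ^ (j : ℕ) := by
      intro j
      rw [rootOfUnity_eq_pow, ← hz, ← pow_succ', inv_pow, inv_pow, ← pow_mul, ← pow_mul, mul_comm]
    rw [Finset.sum_congr rfl fun j _ => h5 j, ← Finset.mul_sum,
      Fin.sum_univ_eq_sum_range (fun i => (z ^ a)⁻¹ ^ i), h4, mul_zero]
  simp only [spectralProj, smul_pow]
  rw [← Finset.smul_sum, Finset.sum_comm, Finset.sum_congr rfl fun a _ => (Finset.sum_smul).symm,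
    Finset.sum_eq_single_of_mem 0 (Finset.mem_range.2 (Nat.pos_of_ne_zero hd))
      fun a ha ha0 => by rw [hsum a ha ha0, zero_smul]]
  simp [smul_smul, hd]

theorem spectralProj_mul (hT : T ^ d = 1) (i j : Fin d) :
    spectralProj d T i * spectralProj d T j = if i = j then spectralProj d T j else 0 := by
  have hd : d ≠ 0 := by rintro rfl; exact j.elim0
  have hpow : ∀ a : ℕ, T ^ a * spectralProj d T j = rootOfUnity d j ^ a • spectralProj d T j := by
    intro a
    induction a with
    | zero => simp
    | succ a ih => rw [pow_succ, mul_assoc, mul_spectralProj hT, mul_smul_comm, ih, smul_smul,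
        pow_succ']
  set z := (rootOfUnity d i)⁻¹ * rootOfUnity d j with hz
  have h1 : spectralProj d T i * spectralProj d T j =
      ((d : ℂ)⁻¹ * ∑ a ∈ Finset.range d, z ^ a) • spectralProj d T j := by
    rw [spectralProj, smul_mul_assoc, Finset.sum_mul, mul_smul, Finset.sum_smul]
    congr 1
    refine Finset.sum_congr rfl fun a _ => ?_
    rw [smul_pow, smul_mul_assoc, hpow, smul_smul, hz, mul_pow]
  rw [h1]
  split_ifs with hij
  · have : z = 1 := by rw [hz, hij, inv_mul_cancel₀ (rootOfUnity_ne_zero j)]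
    simp [this, hd]
  · have hne : z - 1 ≠ 0 := by
      rw [sub_ne_zero, hz, ne_eq, inv_mul_eq_one₀ (rootOfUnity_ne_zero i)]
      exact fun h => hij (rootOfUnity_injective d h)
    have h2 : (z - 1) * ∑ a ∈ Finset.range d, z ^ a = 0 := by
      rw [mul_geom_sum, hz, mul_pow, inv_pow, rootOfUnity_pow, rootOfUnity_pow]
      simp
    rw [(mul_eq_zero.1 h2).resolve_left hne, mul_zero, zero_smul]

theorem commute_map_algebraMap {σ : Type*} (f : MvPowerSeries σ ℂ) (x : MvPowerSeries σ A) :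
    Commute (MvPowerSeries.map (algebraMap ℂ A) f) x := by
  classical
  ext e
  rw [coeff_mul, coeff_mul,
    ← Finset.sum_equiv (Equiv.prodComm _ _) (s := Finset.HasAntidiagonal.antidiagonal e)
      (fun p => by simp [add_comm]) (fun p _ => rfl)]
  refine Finset.sum_congr rfl fun p _ => ?_
  simp only [MvPowerSeries.coeff_map]
  exact Algebra.commutes _ _

/-- An element of order `d` deforms to a power series with prescribed eigenvalues deforming the
`d`-th roots of unity. -/
theorem exists_eigenvalue_deformation {σ : Type*} (hd : d ≠ 0) (hT : T ^ d = 1)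
    (u : Fin d → MvPowerSeries σ ℂ) (hu : ∀ j, constantCoeff (u j) = rootOfUnity d j) :
    ∃ U : MvPowerSeries σ A, constantCoeff U = T ∧
      (List.ofFn fun j => U - MvPowerSeries.map (algebraMap ℂ A) (u j)).prod = 0 := by
  set v : Fin d → MvPowerSeries σ A := fun j => MvPowerSeries.map (algebraMap ℂ A) (u j) with hv
  set p : Fin d → MvPowerSeries σ A := fun j => C (spectralProj d T j) with hp
  have hpp : ∀ i j, p i * p j = if i = j then p j else 0 := by
    intro i j
    rw [hp]
    dsimp only
    rw [← map_mul, spectralProj_mul hT]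
    split_ifs <;> simp
  have hsum : ∑ j, p j = 1 := by
    rw [hp, ← map_sum, sum_spectralProj hd, map_one]
  set U := ∑ j, v j * p j with hU
  have hUp : ∀ j, U * p j = v j * p j := by
    intro j
    rw [hU, Finset.sum_mul, Finset.sum_eq_single j]
    · rw [mul_assoc, hpp, if_pos rfl]
    · intro i _ hij
      rw [mul_assoc, hpp, if_neg hij, mul_zero]
    · simp
  have hvc : ∀ j x, Commute (v j) x := fun j x => commute_map_algebraMap _ _
  refine ⟨U, ?_, ?_⟩
  · have : ∀ j, constantCoeff (v j * p j) = T * spectralProj d T j := by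
      intro j
      have h1 : constantCoeff (v j) = algebraMap ℂ A (rootOfUnity d j) := by
        rw [← hu, hv, MvPowerSeries.constantCoeff_map]
      rw [map_mul, h1, mul_spectralProj hT, Algebra.smul_def, hp, constantCoeff_C]
    rw [hU, map_sum, Finset.sum_congr rfl fun j _ => this j, ← Finset.mul_sum,
      sum_spectralProj hd, mul_one]
  · -- The factor with index `j` kills `p j`, and all factors commute with `p j`.
    have hpU : ∀ j, Commute (p j) U := by
      intro j
      rw [hU]
      refine Commute.sum_right _ _ _ fun i _ => ?_
      refine ((hvc i (p j)).symm).mul_right ?_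
      rw [Commute, SemiconjBy, hpp, hpp]
      by_cases h : i = j
      · simp [h]
      · simp [h, Ne.symm h]
    have hkill : ∀ j, (List.ofFn fun i => U - v i).prod * p j = 0 := by
      intro j
      have hj : (U - v j) ∈ List.ofFn fun i => U - v i := by
        rw [List.mem_ofFn]; exact ⟨j, rfl⟩
      obtain ⟨l₁, l₂, hl⟩ := List.append_of_mem hj
      have hc : Commute (p j) l₂.prod := by
        refine Commute.list_prod_right _ _ fun x hx => ?_
        have hx' : x ∈ List.ofFn fun i => U - v i := by rw [hl]; simp [hx]
        obtain ⟨i, rfl⟩ := (List.mem_ofFn).1 hx'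
        exact (hpU j).sub_right (hvc i (p j)).symm
      rw [hl, List.prod_append, List.prod_cons, mul_assoc, mul_assoc, ← hc.eq,
        ← mul_assoc (U - v j), sub_mul, hUp, sub_self, zero_mul, mul_zero]
    rw [← mul_one (List.prod _), ← hsum, Finset.mul_sum]
    exact Finset.sum_eq_zero fun j _ => hkill j

end

/-! ### Extending ring homomorphisms to power series -/

section

open MvPowerSeries

variable {σ A E : Type*} [Ring A] [Ring E]

open Classical in
/-- The `τ`-adically continuous extension `∑ a_e τ^e ↦ ∑ θ(a_e) τ^e` of a function
`θ : A → E[[τ]]`. -/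
def extendFun (θ : A → MvPowerSeries σ E) (x : MvPowerSeries σ A) : MvPowerSeries σ E :=
  fun e => ∑ p ∈ Finset.HasAntidiagonal.antidiagonal e, coeff p.2 (θ (coeff p.1 x))

theorem coeff_extendFun [DecidableEq σ] (θ : A → MvPowerSeries σ E) (x : MvPowerSeries σ A)
    (e : σ →₀ ℕ) : coeff e (extendFun θ x) =
      ∑ p ∈ Finset.HasAntidiagonal.antidiagonal e, coeff p.2 (θ (coeff p.1 x)) := by
  change ∑ p ∈ _, _ = _
  congr!

theorem extendFun_C (θ : A →+* MvPowerSeries σ E) (a : A) : extendFun θ (C a) = θ a := by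
  classical
  ext e
  rw [coeff_extendFun, Finset.sum_eq_single (0, e)]
  · simp
  · intro p hp hne
    have h0 : p.1 ≠ 0 := by
      intro h1
      apply hne
      rw [← Finset.HasAntidiagonal.mem_antidiagonal.1 hp, h1, zero_add]
      exact Prod.ext h1 rfl
    rw [coeff_C, if_neg h0, map_zero, map_zero]
  · intro h
    exact (h (by simp)).elim

/-- The `τ`-adically continuous extension of a ring homomorphism `θ : A → E[[τ]]`. -/
def extendHom (θ : A →+* MvPowerSeries σ E) : MvPowerSeries σ A →+* MvPowerSeries σ E where
  toFun := extendFun θ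
  map_zero' := by
    classical
    ext e
    simp [coeff_extendFun]
  map_add' x y := by
    classical
    ext e
    simp [coeff_extendFun, Finset.sum_add_distrib]
  map_one' := by
    rw [← map_one C, extendFun_C, map_one]
  map_mul' x y := by
    classical
    ext e
    rw [coeff_mul]
    simp only [coeff_extendFun]
    simp only [coeff_mul, map_sum, map_mul, Finset.sum_mul_sum]
    simp only [← Finset.sum_product', Finset.sum_sigma']
    -- Both sides are sums over quadruples of exponents with sum `e`; swap the middle two.
    refine Finset.sum_nbij'
      (fun q => ⟨(q.2.1.1 + q.2.2.1, q.2.1.2 + q.2.2.2), (q.2.1.1, q.2.2.1), (q.2.1.2, q.2.2.2)⟩)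
      (fun q => ⟨(q.2.1.1 + q.2.2.1, q.2.1.2 + q.2.2.2), (q.2.1.1, q.2.2.1), (q.2.1.2, q.2.2.2)⟩)
      ?_ ?_ ?_ ?_ ?_
    · rintro ⟨⟨a, b⟩, ⟨c, d⟩, ⟨f, g⟩⟩ h
      simp only [Finset.mem_sigma, Finset.mem_product,
        Finset.HasAntidiagonal.mem_antidiagonal] at h ⊢
      obtain ⟨h1, h2, h3⟩ := h
      refine ⟨?_, trivial, trivial⟩
      rw [← h1, ← h2, ← h3]; abel
    · rintro ⟨⟨a, b⟩, ⟨c, d⟩, ⟨f, g⟩⟩ h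
      simp only [Finset.mem_sigma, Finset.mem_product,
        Finset.HasAntidiagonal.mem_antidiagonal] at h ⊢
      obtain ⟨h1, h2, h3⟩ := h
      refine ⟨?_, trivial, trivial⟩
      rw [← h1, ← h2, ← h3]; abel
    · rintro ⟨⟨a, b⟩, ⟨c, d⟩, ⟨f, g⟩⟩ h
      simp only [Finset.mem_sigma, Finset.mem_product,
        Finset.HasAntidiagonal.mem_antidiagonal] at h ⊢
      obtain ⟨h1, h2, h3⟩ := h
      subst h2 h3; rfl
    · rintro ⟨⟨a, b⟩, ⟨c, d⟩, ⟨f, g⟩⟩ h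
      simp only [Finset.mem_sigma, Finset.mem_product,
        Finset.HasAntidiagonal.mem_antidiagonal] at h ⊢
      obtain ⟨h1, h2, h3⟩ := h
      subst h2 h3; rfl
    · intro _ _
      rfl

theorem coeff_extendHom [DecidableEq σ] (θ : A →+* MvPowerSeries σ E) (x : MvPowerSeries σ A)
    (e : σ →₀ ℕ) : coeff e (extendHom θ x) =
      ∑ p ∈ Finset.HasAntidiagonal.antidiagonal e, coeff p.2 (θ (coeff p.1 x)) :=
  coeff_extendFun _ _ _

theorem extendHom_C (θ : A →+* MvPowerSeries σ E) (a : A) : extendHom θ (C a) = θ a :=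
  extendFun_C θ a

theorem extendHom_map {K : Type*} [Ring K] (θ : A →+* MvPowerSeries σ E) (f : K →+* A)
    (g : K →+* E) (h : ∀ c, θ (f c) = C (g c)) (x : MvPowerSeries σ K) :
    extendHom θ (MvPowerSeries.map f x) = MvPowerSeries.map g x := by
  classical
  ext e
  rw [coeff_extendHom, Finset.sum_eq_single (e, 0)]
  · simp [h]
  · intro p hp hne
    have h0 : p.2 ≠ 0 := by
      intro h1
      apply hne
      rw [← Finset.HasAntidiagonal.mem_antidiagonal.1 hp, h1, add_zero]
      exact Prod.ext rfl h1
    rw [coeff_map, h, coeff_C, if_neg h0]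
  · intro h
    exact (h (by simp)).elim

/-- The leading coefficients of `extendHom θ x` are those of `x`, reduced modulo `τ`. -/
theorem coeff_extendHom_of_degCon (θ : A →+* MvPowerSeries σ E) {n : ℕ} {x : MvPowerSeries σ A}
    (hx : degCon σ A n x 0) {e : σ →₀ ℕ} (he : e.degree ≤ n) :
    coeff e (extendHom θ x) = constantCoeff (θ (coeff e x)) := by
  classical
  rw [coeff_extendHom, Finset.sum_eq_single (e, 0)]
  · rw [coeff_zero_eq_constantCoeff_apply]
  · intro p hp hne
    have hd : p.1.degree + p.2.degree = e.degree := by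
      rw [← map_add, Finset.HasAntidiagonal.mem_antidiagonal.1 hp]
    have : p.2.degree ≠ 0 := by
      intro h0
      have h1 : p.2 = 0 := (Finsupp.degree_eq_zero_iff _).1 h0
      apply hne
      rw [← Finset.HasAntidiagonal.mem_antidiagonal.1 hp, h1, add_zero]
      exact Prod.ext rfl h1
    rw [hx p.1 (by omega), map_zero, map_zero, map_zero]
  · intro h
    exact (h (by simp)).elim

end

/-! ### Topologically free modules are flat deformations -/

section

open MvPowerSeries

/-- A series without terms of degree at most `n` is a combination of the variables with
coefficients without terms of degree less than `n`. -/
theorem exists_eq_sum_X_mul {σ A : Type*} [Fintype σ] [Ring A] {n : ℕ} {f : MvPowerSeries σ A}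
    (hf : degCon σ A (n + 1) f 0) :
    ∃ g : σ → MvPowerSeries σ A, f = ∑ i, X i * g i ∧ ∀ i, degCon σ A n (g i) 0 := by
  classical
  have hi : ∀ e : σ →₀ ℕ, ∃ i : Option σ, e ≠ 0 → ∃ j, i = some j ∧ e j ≠ 0 := by
    intro e
    by_cases he : e = 0
    · exact ⟨none, fun h => (h he).elim⟩
    · obtain ⟨j, hj⟩ := Finsupp.ne_iff.1 he
      exact ⟨some j, fun _ => ⟨j, rfl, hj⟩⟩
  -- `i e` is a variable dividing the monomial `e`.
  choose i hi using hi
  let g : σ → MvPowerSeries σ A := fun j e =>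
    if i (e + Finsupp.single j 1) = some j then coeff (e + Finsupp.single j 1) f else 0
  have hg : ∀ j e, coeff e (g j) = if i (e + Finsupp.single j 1) = some j then
    coeff (e + Finsupp.single j 1) f else 0 := fun _ _ => rfl
  refine ⟨g, ?_, ?_⟩
  · ext e
    rw [map_sum]
    have hterm : ∀ j, coeff e (X j * g j) = if i e = some j then coeff e f else 0 := by
      intro j
      rw [X, coeff_monomial_mul, one_mul, hg]
      by_cases he : e = 0
      · have h0 : coeff e f = 0 := by
          rw [hf e (by rw [he, map_zero]; omega), map_zero]
        rw [if_neg (by rw [Finsupp.single_le_iff, he, Finsupp.coe_zero, Pi.zero_apply]; omega), h0,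
          ite_self]
      obtain ⟨k, hk, hk0⟩ := hi e he
      by_cases hj : e j = 0
      · rw [if_neg (by rw [Finsupp.single_le_iff]; omega), if_neg]
        rw [hk]
        rintro ⟨⟩
        exact hk0 hj
      · have hle : Finsupp.single j 1 ≤ e := by rw [Finsupp.single_le_iff]; omega
        rw [if_pos hle, tsub_add_cancel_of_le hle]
    rw [Finset.sum_congr rfl fun j _ => hterm j]
    by_cases he : e = 0
    · have h0 : coeff e f = 0 := by
        rw [hf e (by rw [he, map_zero]; omega), map_zero]
      simp [h0]
    · obtain ⟨k, hk, -⟩ := hi e he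
      simp [hk]
  · intro j e he
    rw [hg, map_zero]
    split_ifs
    · rw [hf, map_zero]
      rw [map_add, Finsupp.degree_single]
      omega
    · rfl

theorem degCon_of_mem_paramIdeal_pow {σ K : Type*} [CommRing K] {n : ℕ} {f : MvPowerSeries σ K}
    (hf : f ∈ paramIdeal σ K ^ n) : degCon σ K n f 0 := by
  induction n generalizing f with
  | zero => intro e he; omega
  | succ n ih =>
    rw [pow_succ] at hf
    induction hf using Submodule.mul_induction_on' with
    | mem_mul_mem f hf g hg =>
      refine degCon_mul_zero (ih hf) ?_
      intro e he
      have he0 : e = 0 := (Finsupp.degree_eq_zero_iff _).1 (by omega)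
      have hle : paramIdeal σ K ≤ RingHom.ker (constantCoeff (σ := σ) (R := K)) := by
        rw [paramIdeal, Ideal.span_le]
        rintro _ ⟨i, rfl⟩
        exact constantCoeff_X i
      rw [he0, coeff_zero_eq_constantCoeff_apply, map_zero]
      exact hle hg
    | add f _ g _ hf hg =>
      simpa using (degCon σ K (n + 1)).add hf hg

variable {σ K A₀ A : Type*} [CommRing K] [Ring A₀] [Algebra K A₀] [Ring A]
  [Algebra (MvPowerSeries σ K) A]

theorem degCon_of_mem_smul_top (Φ : A ≃+ MvPowerSeries σ A₀)
    (hΦ : ∀ (f : MvPowerSeries σ K) (a : A), Φ (f • a) =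
      MvPowerSeries.map (algebraMap K A₀) f * Φ a) {n : ℕ} {a : A}
    (ha : a ∈ (paramIdeal σ K ^ n • ⊤ : Submodule (MvPowerSeries σ K) A)) :
    degCon σ A₀ n (Φ a) 0 := by
  induction ha using Submodule.smul_induction_on' with
  | smul f hf a _ =>
    rw [hΦ]
    have h1 : degCon σ A₀ n (MvPowerSeries.map (algebraMap K A₀) f) 0 := by
      intro e he
      rw [coeff_map, degCon_of_mem_paramIdeal_pow hf e he, map_zero, map_zero, map_zero]
    simpa using degCon_mul_zero (n := 0) h1 (y := Φ a) fun e he => by omega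
  | add a _ b _ ha hb =>
    rw [map_add]
    simpa using (degCon σ A₀ n).add ha hb

theorem mem_smul_top_of_degCon [Finite σ] (Φ : A ≃+ MvPowerSeries σ A₀)
    (hΦ : ∀ (f : MvPowerSeries σ K) (a : A), Φ (f • a) =
      MvPowerSeries.map (algebraMap K A₀) f * Φ a) {n : ℕ} {a : A} (ha : degCon σ A₀ n (Φ a) 0) :
    a ∈ (paramIdeal σ K ^ n • ⊤ : Submodule (MvPowerSeries σ K) A) := by
  have := Fintype.ofFinite σ
  induction n generalizing a with
  | zero => simp
  | succ n ih =>
    obtain ⟨g, hg, hg0⟩ := exists_eq_sum_X_mul ha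
    have : a = ∑ i, (X i : MvPowerSeries σ K) • Φ.symm (g i) := by
      apply Φ.injective
      rw [map_sum, hg]
      refine Finset.sum_congr rfl fun i _ => ?_
      rw [hΦ, map_X, Φ.apply_symm_apply]
    rw [this]
    refine Submodule.sum_mem _ fun i _ => ?_
    have h1 := ih (a := Φ.symm (g i)) (by rw [Φ.apply_symm_apply]; exact hg0 i)
    rw [pow_succ', Submodule.mul_smul]
    exact Submodule.smul_mem_smul (Ideal.subset_span ⟨i, rfl⟩) h1

theorem mem_smul_top_iff [Finite σ] (Φ : A ≃+ MvPowerSeries σ A₀)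
    (hΦ : ∀ (f : MvPowerSeries σ K) (a : A), Φ (f • a) =
      MvPowerSeries.map (algebraMap K A₀) f * Φ a) {n : ℕ} {a : A} :
    a ∈ (paramIdeal σ K ^ n • ⊤ : Submodule (MvPowerSeries σ K) A) ↔ degCon σ A₀ n (Φ a) 0 :=
  ⟨degCon_of_mem_smul_top Φ hΦ, mem_smul_top_of_degCon Φ hΦ⟩

theorem mem_paramIdeal_pow_iff [Finite σ] {n : ℕ} {f : MvPowerSeries σ K} :
    f ∈ paramIdeal σ K ^ n ↔ degCon σ K n f 0 := by
  have := mem_smul_top_iff (K := K) (A := MvPowerSeries σ K)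
    (AddEquiv.refl (MvPowerSeries σ K)) (fun f a => by simp) (n := n) (a := f)
  rwa [smul_eq_mul, Ideal.mul_top] at this

/-- The reduction modulo `(τ)^n` of a topologically free module is free, hence flat. -/
theorem flat_quotient [Finite σ] [Module.Free K A₀] (Φ : A ≃+ MvPowerSeries σ A₀)
    (hΦ : ∀ (f : MvPowerSeries σ K) (a : A), Φ (f • a) =
      MvPowerSeries.map (algebraMap K A₀) f * Φ a)
    (n : ℕ) :
    Module.Flat (MvPowerSeries σ K ⧸ paramIdeal σ K ^ n)
      (A ⧸ (paramIdeal σ K ^ n • ⊤ : Submodule (MvPowerSeries σ K) A)) := by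
  classical
  let b := Module.Free.chooseBasis K A₀
  set I := paramIdeal σ K ^ n with hI
  let v : Module.Free.ChooseBasisIndex K A₀ → A := fun i => Φ.symm (C (b i))
  let L := Finsupp.linearCombination (MvPowerSeries σ K ⧸ I)
    fun i => (Submodule.Quotient.mk (v i) : A ⧸ (I • ⊤ : Submodule (MvPowerSeries σ K) A))
  have hL : ∀ c : Module.Free.ChooseBasisIndex K A₀ →₀ MvPowerSeries σ K,
      L (c.mapRange (Ideal.Quotient.mk I) (map_zero _)) =
        Submodule.Quotient.mk (Finsupp.linearCombination (MvPowerSeries σ K) v c) := by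
    intro c
    induction c using Finsupp.induction_linear with
    | zero => simp
    | add c d hc hd =>
      rw [Finsupp.mapRange_add (fun x y => map_add _ x y), map_add, hc, hd, map_add,
        Submodule.Quotient.mk_add]
    | single i f =>
      rw [Finsupp.mapRange_single, Finsupp.linearCombination_single,
        Finsupp.linearCombination_single]
      rfl
  have hcoeff : ∀ (c : Module.Free.ChooseBasisIndex K A₀ →₀ MvPowerSeries σ K) (e : σ →₀ ℕ),
      coeff e (Φ (Finsupp.linearCombination (MvPowerSeries σ K) v c)) =
        Finsupp.linearCombination K b (c.mapRange (coeff e) (map_zero _)) := by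
    intro c e
    induction c using Finsupp.induction_linear with
    | zero => simp
    | add c d hc hd =>
      rw [Finsupp.mapRange_add (fun x y => map_add _ x y), map_add, map_add, map_add, hc, hd,
        map_add]
    | single i f =>
      rw [Finsupp.mapRange_single, Finsupp.linearCombination_single,
        Finsupp.linearCombination_single, hΦ, Φ.apply_symm_apply, coeff_mul_C, coeff_map,
        Algebra.smul_def]
  have hsurj : ∀ x, ∃ c : Module.Free.ChooseBasisIndex K A₀ →₀ MvPowerSeries σ K,
      c.mapRange (Ideal.Quotient.mk I) (map_zero _) = x :=
    Finsupp.mapRange_surjective _ _ Ideal.Quotient.mk_surjective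
  have hbij : Function.Bijective L := by
    constructor
    · rw [injective_iff_map_eq_zero]
      intro x hx
      obtain ⟨c, rfl⟩ := hsurj x
      rw [hL, Submodule.Quotient.mk_eq_zero, mem_smul_top_iff Φ hΦ] at hx
      ext i
      rw [Finsupp.mapRange_apply, Finsupp.zero_apply, Ideal.Quotient.eq_zero_iff_mem,
        mem_paramIdeal_pow_iff]
      intro e he
      have h1 := hx e he
      rw [hcoeff, map_zero] at h1
      have h2 := linearIndependent_iff.1 b.linearIndependent _ h1
      rw [map_zero]
      simpa using DFunLike.congr_fun h2 i
    · intro x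
      obtain ⟨a, rfl⟩ := Submodule.Quotient.mk_surjective _ x
      let S := (Finsupp.finite_of_degree_lt (σ := σ) n).toFinset
      let c : Module.Free.ChooseBasisIndex K A₀ →₀ MvPowerSeries σ K :=
        ∑ e ∈ S, (b.repr (coeff e (Φ a))).mapRange (monomial e) (map_zero _)
      refine ⟨c.mapRange (Ideal.Quotient.mk I) (map_zero _), ?_⟩
      rw [hL, Submodule.Quotient.eq, mem_smul_top_iff Φ hΦ, map_sub, ← degCon_sub]
      intro e he
      rw [hcoeff]
      have : c.mapRange (coeff e) (map_zero _) = b.repr (coeff e (Φ a)) := by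
        ext i
        rw [Finsupp.mapRange_apply, Finsupp.finsetSum_apply, map_sum,
          Finset.sum_eq_single_of_mem e (by simpa [S] using he)]
        · rw [Finsupp.mapRange_apply, coeff_monomial_same]
        · intro e' _ hne
          rw [Finsupp.mapRange_apply, coeff_monomial_ne hne.symm]
      rw [this, b.linearCombination_repr]
  exact Module.Flat.of_linearEquiv (LinearEquiv.ofBijective L hbij).symm

/-- An algebra which is topologically free over `K[[τ]]` on a free `K`-module is a flat formal
deformation. -/
theorem isFlatFormalDeformation_of_equiv [Finite σ] [Module.Free K A₀]
    (Φ : A ≃+ MvPowerSeries σ A₀)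
    (hΦ : ∀ (f : MvPowerSeries σ K) (a : A), Φ (f • a) =
      MvPowerSeries.map (algebraMap K A₀) f * Φ a)
    (π : A →+* A₀) (hπ : ∀ a, constantCoeff (Φ a) = π a) :
    IsFlatFormalDeformation (σ := σ) (K := K) π where
  map_smul f a := by
    rw [← hπ, ← hπ, hΦ, map_mul, constantCoeff_map, Algebra.smul_def]
  surjective x := ⟨Φ.symm (C x), by rw [← hπ, Φ.apply_symm_apply, constantCoeff_C]⟩
  ker a := by
    rw [← pow_one (paramIdeal σ K), mem_smul_top_iff Φ hΦ, ← hπ]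
    constructor
    · intro h e he
      have he0 : e = 0 := (Finsupp.degree_eq_zero_iff _).1 (by omega)
      rw [he0, coeff_zero_eq_constantCoeff_apply, h, map_zero]
    · intro h
      rw [← coeff_zero_eq_constantCoeff_apply, h 0 (by simp), map_zero]
  flat := flat_quotient Φ hΦ
  free := ⟨Φ, hΦ, hπ⟩

end

/-! ### The constant terms of the relators -/

section

open MvPowerSeries

theorem constantCoeff_tau (D : Diagram) (k : Fin D.m) (j : Fin (D.d k)) :
    constantCoeff (tau D k j) = 0 := by
  unfold tau
  refine Fin.lastCases ?_ (fun i => ?_) j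
  · rw [Fin.snoc_last]
    simp
  · rw [Fin.snoc_castSucc]
    simp

theorem constantCoeff_u (D : Diagram) (k : Fin D.m) (j : Fin (D.d k)) :
    constantCoeff (u D k j) = rootOfUnity (D.d k) j := by
  have hs := PowerSeries.HasSubst.of_constantCoeff_zero (constantCoeff_tau D k j)
  have ht : constantCoeff (t D k j) = 1 := by
    rw [t, PowerSeries.constantCoeff_subst hs, finsum_eq_single _ 0]
    · simp
    · intro n hn
      rw [map_pow, constantCoeff_tau, zero_pow hn, smul_zero]
  rw [u, map_mul, constantCoeff_C, ht, mul_one]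
  rfl

theorem Diagram.d_ne_zero (D : Diagram) (k : Fin D.m) : D.d k ≠ 0 := Nat.succ_ne_zero _

instance (D : Diagram) : IsScalarTower ℂ ℂ[T;T⁻¹] (B D) :=
  inferInstanceAs (IsScalarTower ℂ ℂ[T;T⁻¹] (RingQuot _))

variable (D : Diagram)

/-- The quotient map from the free algebra to `B`. -/
def B.mk : FreeAlgebra ℂ[T;T⁻¹] (Fin D.m) →ₐ[ℂ[T;T⁻¹]] B D :=
  RingQuot.mkAlgHom ℂ[T;T⁻¹] (BRel D)

theorem B.mk_surjective : Function.Surjective (B.mk D) := RingQuot.mkAlgHom_surjective _ _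

theorem B.mk_rel {a b : FreeAlgebra ℂ[T;T⁻¹] (Fin D.m)} (h : BRel D a b) :
    B.mk D a = B.mk D b := RingQuot.mkAlgHom_rel _ h

theorem B.gen_pow (k : Fin D.m) : B.gen D k ^ D.d k = 1 := by
  have := B.mk_rel D (.pow k)
  rwa [map_pow, map_one] at this

theorem B.prod_gen : (List.ofFn fun k => B.gen D k).prod = algebraMap ℂ[T;T⁻¹] (B D) qvar := by
  have := B.mk_rel D .prod
  rwa [map_list_prod, List.map_ofFn, AlgHom.commutes] at this

/-- The generators of `B` as units; they have finite order. -/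
def B.unit (k : Fin D.m) : (B D)ˣ :=
  Units.ofPowEqOne (B.gen D k) (D.d k) (B.gen_pow D k) (D.d_ne_zero k)

/-- The two-sided ideal generated by the relators of the deformed algebra. -/
def relatorIdeal : TwoSidedIdeal (FreeHat D) := TwoSidedIdeal.span {r | IsRelator D r}

theorem constantCoeff_eigen (k : Fin D.m) :
    constantCoeff (List.ofFn fun j : Fin (D.d k) =>
      FreeHat.gen D k - algebraMap (MvPowerSeries D.Param ℂ) (FreeHat D) (u D k j)).prod =
    FreeAlgebra.ι ℂ[T;T⁻¹] k ^ D.d k - 1 := by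
  rw [pow_sub_one_eq_prod (Nat.pos_of_ne_zero (D.d_ne_zero k)), constantCoeff_listProd]
  congr 2
  funext j
  rw [map_sub, FreeHat.gen, constantCoeff_C, ← constantCoeff_u]
  congr 1

theorem constantCoeff_prod : constantCoeff ((List.ofFn fun k => FreeHat.gen D k).prod -
      algebraMap ℂ[T;T⁻¹] (FreeHat D) qvar) =
    (List.ofFn fun k : Fin D.m => FreeAlgebra.ι ℂ[T;T⁻¹] k).prod -
      algebraMap ℂ[T;T⁻¹] _ qvar := by
  rw [map_sub, constantCoeff_listProd]
  congr 1

theorem mk_constantCoeff_of_mem {z : FreeHat D} (hz : z ∈ relatorIdeal D) :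
    B.mk D (constantCoeff z) = 0 := by
  let f : FreeHat D →+* B D := (B.mk D : _ →+* B D).comp constantCoeff
  have hle : relatorIdeal D ≤ TwoSidedIdeal.ker f := by
    rw [relatorIdeal, TwoSidedIdeal.span_le]
    rintro r (⟨k⟩ | _)
    · change _ ∈ TwoSidedIdeal.ker f
      rw [TwoSidedIdeal.mem_ker]
      change B.mk D (constantCoeff _) = 0
      rw [constantCoeff_eigen, map_sub, sub_eq_zero]
      exact B.mk_rel D (.pow k)
    · change _ ∈ TwoSidedIdeal.ker f
      rw [TwoSidedIdeal.mem_ker]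
      change B.mk D (constantCoeff _) = 0
      rw [constantCoeff_prod, map_sub, sub_eq_zero]
      exact B.mk_rel D .prod
  exact (TwoSidedIdeal.mem_ker _).1 (hle hz)

/-- The relations of `B` are the constant terms of those of the deformed algebra. -/
theorem exists_mem_relatorIdeal {a : FreeAlgebra ℂ[T;T⁻¹] (Fin D.m)} (ha : B.mk D a = 0) :
    ∃ z ∈ relatorIdeal D, constantCoeff z = a := by
  let I : TwoSidedIdeal (FreeAlgebra ℂ[T;T⁻¹] (Fin D.m)) :=
    TwoSidedIdeal.mk' {a | ∃ z ∈ relatorIdeal D, constantCoeff z = a}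
      ⟨0, zero_mem _, map_zero _⟩
      (by
        rintro _ _ ⟨x, hx, rfl⟩ ⟨y, hy, rfl⟩
        exact ⟨x + y, add_mem hx hy, map_add _ _ _⟩)
      (by
        rintro _ ⟨x, hx, rfl⟩
        exact ⟨-x, neg_mem hx, map_neg _ _⟩)
      (by
        rintro a _ ⟨x, hx, rfl⟩
        exact ⟨C a * x, TwoSidedIdeal.mul_mem_left _ _ _ hx, by rw [map_mul, constantCoeff_C]⟩)
      (by
        rintro _ a ⟨x, hx, rfl⟩
        exact ⟨x * C a, TwoSidedIdeal.mul_mem_right _ _ _ hx, by rw [map_mul, constantCoeff_C]⟩)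
  have hI : ∀ a, a ∈ I ↔ ∃ z ∈ relatorIdeal D, constantCoeff z = a := fun a =>
    TwoSidedIdeal.mem_mk' _ _ _ _ _ _ _
  rw [← hI]
  refine mem_of_mkRingHom_eq_zero (r := BRel D) I ?_ ?_
  · rintro x y (⟨k⟩ | _) <;> rw [hI]
    · exact ⟨_, TwoSidedIdeal.subset_span (.eigen k), constantCoeff_eigen D k⟩
    · exact ⟨_, TwoSidedIdeal.subset_span .prod, constantCoeff_prod D⟩
  · exact (DFunLike.congr_fun (RingQuot.mkAlgHom_coe ℂ[T;T⁻¹] (BRel D)) a).symm.trans ha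

end

/-! ### Maps with prescribed leading terms -/

section

open MvPowerSeries

variable {σ A A' : Type*} [Ring A] [Ring A']

theorem degCon_map_of_leading {L : MvPowerSeries σ A →+ MvPowerSeries σ A'} {p : A →+ A'}
    (h : ∀ n x, degCon σ A n x 0 → ∀ e : σ →₀ ℕ, e.degree ≤ n → coeff e (L x) = p (coeff e x))
    {n : ℕ} {x y : MvPowerSeries σ A} (hxy : degCon σ A n x y) : degCon σ A' n (L x) (L y) := by
  rw [degCon_sub] at hxy
  rw [degCon_sub, ← map_sub]
  intro e he
  rw [h n _ hxy e he.le, hxy e he, map_zero, map_zero, map_zero]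

/-- An additive map of power series which is surjective on leading terms is surjective. -/
theorem surjective_of_leading {L : MvPowerSeries σ A →+ MvPowerSeries σ A'} {p : A →+ A'}
    (h : ∀ n x, degCon σ A n x 0 → ∀ e : σ →₀ ℕ, e.degree ≤ n → coeff e (L x) = p (coeff e x))
    (hp : Function.Surjective p) : Function.Surjective L := by
  intro b
  have step : ∀ n x, degCon σ A' n (L x) b →
      ∃ y, degCon σ A' (n + 1) (L y) b ∧ degCon σ A n y x := by
    intro n x hx
    choose r hr using hp
    let δ : MvPowerSeries σ A := fun e => if e.degree = n then r (coeff e (b - L x)) else 0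
    have hδ : ∀ e, coeff e δ = if e.degree = n then r (coeff e (b - L x)) else 0 := fun _ => rfl
    have hδ0 : degCon σ A n δ 0 := by
      intro e he
      rw [hδ, if_neg (by omega), map_zero]
    refine ⟨x + δ, fun e he => ?_, ?_⟩
    · rw [map_add, map_add, h n δ hδ0 e (by omega), hδ]
      split_ifs with hn
      · rw [hr, map_sub, add_sub_cancel]
      · rw [map_zero, add_zero, hx e (by omega)]
    · rw [degCon_sub, add_sub_cancel_left]
      exact hδ0
  choose next h1 h2 using step
  let seq : (n : ℕ) → {x // degCon σ A' n (L x) b} := fun n =>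
    Nat.rec ⟨0, fun _ he => absurd he (Nat.not_lt_zero _)⟩
      (fun n x => ⟨next n x.1 x.2, h1 n x.1 x.2⟩) n
  obtain ⟨x, hx⟩ := exists_degCon_limit (fun n => (seq n).1)
    fun n => h2 n (seq n).1 (seq n).2
  exact ⟨x, eq_of_forall_degCon fun n =>
    (degCon σ A' n).trans (degCon_map_of_leading h (hx n)) (seq n).2⟩

/-- The kernel of an additive map of power series lies in the closure of an ideal on which the map
vanishes and whose elements account for the kernel on leading terms. -/
theorem exists_mem_degCon_of_leading [Finite σ] {L : MvPowerSeries σ A →+ MvPowerSeries σ A'}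
    {p : A →+ A'}
    (h : ∀ n x, degCon σ A n x 0 → ∀ e : σ →₀ ℕ, e.degree ≤ n → coeff e (L x) = p (coeff e x))
    (J : TwoSidedIdeal (MvPowerSeries σ A)) (hJ : ∀ z ∈ J, L z = 0)
    (hp : ∀ a, p a = 0 → ∃ z ∈ J, constantCoeff z = a) {x : MvPowerSeries σ A} (hx : L x = 0)
    (n : ℕ) : ∃ z ∈ J, degCon σ A n x z := by
  classical
  induction n with
  | zero => exact ⟨0, zero_mem _, fun e he => by omega⟩
  | succ n ih =>
    obtain ⟨z, hz, hxz⟩ := ih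
    have hy : ∀ e : σ →₀ ℕ, e.degree ≤ n → p (coeff e (x - z)) = 0 := by
      intro e he
      rw [← h n _ (degCon_sub.1 hxz) e he, map_sub, hx, hJ z hz, sub_zero, map_zero]
    have hw : ∀ e : σ →₀ ℕ, ∃ w ∈ J, e.degree ≤ n → constantCoeff w = coeff e (x - z) := by
      intro e
      by_cases he : e.degree ≤ n
      · obtain ⟨w, hw, hwe⟩ := hp _ (hy e he)
        exact ⟨w, hw, fun _ => hwe⟩
      · exact ⟨0, zero_mem _, fun h => (he h).elim⟩
    choose w hwJ hw using hw
    let S := (Finsupp.finite_of_degree_eq (σ := σ) n).toFinset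
    have hS : ∀ e, e ∈ S ↔ e.degree = n := fun e => by simp [S]
    refine ⟨z + ∑ e ∈ S, monomial e 1 * w e, add_mem hz (sum_mem fun e _ =>
      TwoSidedIdeal.mul_mem_left _ _ _ (hwJ e)), ?_⟩
    intro e he
    have hterm : ∀ e' ∈ S, coeff e (monomial e' 1 * w e') =
        if e' = e then coeff e (x - z) else 0 := by
      intro e' he'
      rw [hS] at he'
      rw [coeff_monomial_mul, one_mul]
      split_ifs with h1 h2 h2
      · rw [h2, tsub_self, coeff_zero_eq_constantCoeff_apply, hw e (by omega)]
      · obtain ⟨f, rfl⟩ := exists_add_of_le h1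
        rw [map_add] at he
        have : f = 0 := (Finsupp.degree_eq_zero_iff _).1 (by omega)
        exact (h2 (by rw [this, add_zero])).elim
      · exact (h1 h2.le).elim
      · rfl
    rw [map_add, map_sum, Finset.sum_congr rfl hterm, Finset.sum_ite_eq']
    split_ifs with hmem
    · rw [map_sub, add_sub_cancel]
    · rw [hS] at hmem
      rw [hxz e (by omega), add_zero]

end

/-! ### The formal algebra is topologically free -/

section

open MvPowerSeries

variable (D : Diagram)

/-- The quotient map from the completed free algebra. -/
def HHat.mk : FreeHat D →+* HHat D := RingQuot.mkRingHom (HRel D)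

theorem HHat.mk_surjective : Function.Surjective (HHat.mk D) := RingQuot.mkRingHom_surjective _

theorem HHat.mk_rel {x y : FreeHat D} (h : HRel D x y) : HHat.mk D x = HHat.mk D y :=
  RingQuot.mkRingHom_rel h

theorem HHat.smul_mk (f : MvPowerSeries D.Param ℂ[T;T⁻¹]) (x : FreeHat D) :
    f • HHat.mk D x = HHat.mk D
      (MvPowerSeries.map (algebraMap _ (FreeAlgebra ℂ[T;T⁻¹] (Fin D.m))) f * x) :=
  (smul_mkRingHom (HRel D) f x).trans (congrArg (HHat.mk D) (Algebra.smul_def f x))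

theorem HHat.complex_smul_mk (f : MvPowerSeries D.Param ℂ) (x : FreeHat D) :
    f • HHat.mk D x = HHat.mk D
      (MvPowerSeries.map (algebraMap _ (FreeAlgebra ℂ[T;T⁻¹] (Fin D.m))) f * x) :=
  (smul_mkRingHom (HRel D) f x).trans (congrArg (HHat.mk D) (Algebra.smul_def f x))

/-- Evaluation at `1 ∈ B` of a power series of endomorphisms of `B`. -/
def evalOne : MvPowerSeries D.Param (Module.End ℂ[T;T⁻¹] (B D)) →+ MvPowerSeries D.Param (B D) where
  toFun y := fun e => coeff e y 1
  map_zero' := rfl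
  map_add' _ _ := rfl

theorem coeff_evalOne (y : MvPowerSeries D.Param (Module.End ℂ[T;T⁻¹] (B D))) (e : D.Param →₀ ℕ) :
    coeff e (evalOne D y) = coeff e y 1 := rfl

theorem evalOne_map_mul (f : MvPowerSeries D.Param ℂ[T;T⁻¹])
    (y : MvPowerSeries D.Param (Module.End ℂ[T;T⁻¹] (B D))) :
    evalOne D (MvPowerSeries.map (algebraMap ℂ[T;T⁻¹] _) f * y) =
      MvPowerSeries.map (algebraMap ℂ[T;T⁻¹] (B D)) f * evalOne D y := by
  classical
  ext e
  rw [coeff_evalOne, coeff_mul, coeff_mul, LinearMap.sum_apply]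
  refine Finset.sum_congr rfl fun p _ => ?_
  rw [coeff_map, coeff_map, coeff_evalOne, Module.End.mul_apply, Module.algebraMap_end_apply,
    Algebra.smul_def]

/-- Left multiplication by the units of `B`, as invertible endomorphisms of `B`. -/
def leftMulUnit : (B D)ˣ →* (Module.End ℂ[T;T⁻¹] (B D))ˣ :=
  Units.map (Algebra.lmul ℂ[T;T⁻¹] (B D) : B D →* Module.End ℂ[T;T⁻¹] (B D))

theorem leftMulUnit_apply (x : (B D)ˣ) (y : B D) :
    (leftMulUnit D x : Module.End ℂ[T;T⁻¹] (B D)) y = x * y := rfl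

/-- The left regular module of `B` deforms to a module over the formal algebra, provided `B` has
a basis on which some element of the group generated by the `T k` and the scalars acts by shifts. -/
theorem exists_module_deformation {ι : Type*} (b : Module.Basis (ℤ × ι) ℂ[T;T⁻¹] (B D)) (x : (B D)ˣ)
    (hb : ∀ n i, (x : B D) * b (n, i) = b (n + 1, i)) (c : ℂ[T;T⁻¹]ˣ)
    (hx : Torus.scal c (B D) * x ∈ Subgroup.closure (Set.range (B.unit D))) :
    ∃ T : Fin D.m → MvPowerSeries D.Param (Module.End ℂ[T;T⁻¹] (B D)),
      (∀ k, constantCoeff (T k) = Algebra.lmul ℂ[T;T⁻¹] (B D) (B.gen D k)) ∧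
      (∀ k, (List.ofFn fun j =>
        T k - MvPowerSeries.map (algebraMap ℂ _) (u D k j)).prod = 0) ∧
      (List.ofFn T).prod = C (algebraMap ℂ[T;T⁻¹] _ qvar) := by
  have hpow : ∀ k, Algebra.lmul ℂ[T;T⁻¹] (B D) (B.gen D k) ^ D.d k = 1 := by
    intro k
    rw [← map_pow, B.gen_pow, map_one]
  choose U hU0 hU using fun k => exists_eigenvalue_deformation (σ := D.Param) (D.d_ne_zero k)
    (hpow k) (u D k) (constantCoeff_u D k)
  have hsol := exists_formal_solution
    (fun k j => MvPowerSeries.map (algebraMap ℂ (Module.End ℂ[T;T⁻¹] (B D))) (u D k j))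
    (fun k j y => commute_map_algebraMap _ _) U hU (C (algebraMap ℂ[T;T⁻¹] _ qvar)) ?_ ?_
  · obtain ⟨T, h1, h2, h3⟩ := hsol
    exact ⟨T, fun k => (h1 k).trans (hU0 k), h2, h3⟩
  · rw [constantCoeff_listProd, funext hU0, constantCoeff_C, ← AlgHom.commutes
      (Algebra.lmul ℂ[T;T⁻¹] (B D)), ← B.prod_gen, map_list_prod, List.map_ofFn]
    rfl
  · -- The scalar `c` does not matter for conjugation, which is hence conjugation by the shift `x`.
    intro η
    have hmem : leftMulUnit D (Torus.scal c (B D) * x) ∈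
        Subgroup.closure (Set.range fun k => leftMulUnit D (B.unit D k)) := by
      have := Subgroup.mem_map_of_mem (leftMulUnit D) hx
      rwa [MonoidHom.map_closure, ← Set.range_comp] at this
    have hconj : ∀ ψ : Module.End ℂ[T;T⁻¹] (B D),
        (leftMulUnit D (Torus.scal c (B D) * x) : Module.End ℂ[T;T⁻¹] (B D)) * ψ *
          (↑(leftMulUnit D (Torus.scal c (B D) * x))⁻¹ : Module.End ℂ[T;T⁻¹] (B D)) =
        leftMulUnit D x * ψ * (↑(leftMulUnit D x)⁻¹ : Module.End ℂ[T;T⁻¹] (B D)) := by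
      intro ψ
      rw [Units.mul_inv_eq_iff_eq_mul]
      have h1 : ∀ y, (leftMulUnit D (Torus.scal c (B D) * x) : Module.End ℂ[T;T⁻¹] (B D)) y =
          (c : ℂ[T;T⁻¹]) • (leftMulUnit D x : Module.End ℂ[T;T⁻¹] (B D)) y := by
        intro y
        rw [leftMulUnit_apply, leftMulUnit_apply, Units.val_mul, Algebra.smul_def, mul_assoc]
        rfl
      ext y
      rw [Module.End.mul_apply, Module.End.mul_apply, h1, h1, map_smul]
      congr 1
      rw [← Module.End.mul_apply, ← Module.End.mul_apply, Units.inv_mul_cancel_right]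
    obtain ⟨ψ, hψ⟩ := exists_derivProd_commutator (fun k => leftMulUnit D (B.unit D k)) hmem
      (fun φ => by
        obtain ⟨ψ, hψ⟩ := exists_sub_conj_eq b (leftMulUnit D x) hb φ
        exact ⟨ψ, by rw [hconj, hψ]⟩) η
    refine ⟨ψ, ?_⟩
    simp only [hU0]
    exact hψ

/-- The formal algebra is topologically free: acting on the vector `1` of the deformed regular
module identifies it with `B[[τ]]`. -/
theorem exists_equiv_series {ι : Type*} (b : Module.Basis (ℤ × ι) ℂ[T;T⁻¹] (B D)) (x : (B D)ˣ)
    (hb : ∀ n i, (x : B D) * b (n, i) = b (n + 1, i)) (c : ℂ[T;T⁻¹]ˣ)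
    (hx : Torus.scal c (B D) * x ∈ Subgroup.closure (Set.range (B.unit D))) :
    ∃ (π : HHat D →+* B D) (Φ : HHat D ≃+ MvPowerSeries D.Param (B D)),
      (∀ k, π (HHat.gen D k) = B.gen D k) ∧
      (∀ (f : MvPowerSeries D.Param ℂ[T;T⁻¹]) (a : HHat D), Φ (f • a) =
        MvPowerSeries.map (algebraMap ℂ[T;T⁻¹] (B D)) f * Φ a) ∧
      ∀ a, constantCoeff (Φ a) = π a := by
  classical
  obtain ⟨T, hT0, hTe, hTp⟩ := exists_module_deformation D b x hb c hx
  -- The action of the completed free algebra on the deformed module.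
  let θ : FreeAlgebra ℂ[T;T⁻¹] (Fin D.m) →ₐ[ℂ[T;T⁻¹]]
      MvPowerSeries D.Param (Module.End ℂ[T;T⁻¹] (B D)) := FreeAlgebra.lift _ T
  have hθι : ∀ k, θ (FreeAlgebra.ι _ k) = T k := fun k => FreeAlgebra.lift_ι_apply _ _
  have hθK : ∀ r : ℂ[T;T⁻¹], θ (algebraMap _ _ r) = C (algebraMap ℂ[T;T⁻¹] _ r) := by
    intro r
    rw [AlgHom.commutes, MvPowerSeries.algebraMap_apply]
  have hθC : ∀ r : ℂ, θ (algebraMap _ _ r) = C (algebraMap ℂ _ r) := by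
    intro r
    rw [IsScalarTower.algebraMap_apply ℂ ℂ[T;T⁻¹], hθK, ← IsScalarTower.algebraMap_apply]
  have hθ0 : ∀ a, constantCoeff (θ a) = Algebra.lmul ℂ[T;T⁻¹] (B D) (B.mk D a) := by
    intro a
    induction a using FreeAlgebra.induction with
    | grade0 r =>
      rw [hθK, constantCoeff_C, AlgHom.commutes, AlgHom.commutes]
    | grade1 k => rw [hθι, hT0]; rfl
    | mul a b ha hb => rw [map_mul, map_mul, map_mul, map_mul, ha, hb]
    | add a b ha hb => rw [map_add, map_add, map_add, map_add, ha, hb]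
  let Θ := extendHom (θ : FreeAlgebra ℂ[T;T⁻¹] (Fin D.m) →+*
      MvPowerSeries D.Param (Module.End ℂ[T;T⁻¹] (B D)))
  have hΘgen : ∀ k, Θ (FreeHat.gen D k) = T k := fun k => (extendHom_C _ _).trans (hθι k)
  have hΘJ : ∀ z ∈ relatorIdeal D, Θ z = 0 := by
    have hle : relatorIdeal D ≤ TwoSidedIdeal.ker Θ := by
      rw [relatorIdeal, TwoSidedIdeal.span_le]
      rintro r (⟨k⟩ | _)
      · change _ ∈ TwoSidedIdeal.ker Θ
        rw [TwoSidedIdeal.mem_ker, map_list_prod, List.map_ofFn, ← hTe k]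
        congr 2
        funext j
        rw [Function.comp_apply, map_sub, hΘgen]
        congr 1
        exact extendHom_map _ _ _ hθC _
      · change _ ∈ TwoSidedIdeal.ker Θ
        rw [TwoSidedIdeal.mem_ker, map_sub, map_list_prod, List.map_ofFn, sub_eq_zero,
          show Θ ∘ (fun k => FreeHat.gen D k) = T from funext hΘgen, hTp,
          MvPowerSeries.algebraMap_apply]
        exact ((extendHom_C _ _).trans (hθK _)).symm
    exact fun z hz => (TwoSidedIdeal.mem_ker _).1 (hle hz)
  -- Acting on `1 ∈ B`.
  let L : FreeHat D →+ MvPowerSeries D.Param (B D) := (evalOne D).comp Θ.toAddMonoidHom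
  have hLead : ∀ n x, degCon D.Param _ n x 0 → ∀ e : D.Param →₀ ℕ, e.degree ≤ n →
      coeff e (L x) = (B.mk D : _ →+ B D) (coeff e x) := by
    intro n x hx e he
    change coeff e (Θ x) 1 = B.mk D (coeff e x)
    rw [coeff_extendHom_of_degCon _ hx he]
    change constantCoeff (θ (coeff e x)) 1 = _
    rw [hθ0]
    exact mul_one _
  have hΘrel : ∀ ⦃x y⦄, HRel D x y → Θ x = Θ y := by
    intro x y hxy
    refine eq_of_forall_degCon fun n => ?_
    obtain ⟨z, hz, hxyz⟩ := hxy n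
    rw [degCon_sub, ← map_sub, ← hΘJ z hz, degCon_sub, ← map_sub]
    intro e he
    have h0 : degCon D.Param _ n (x - y - z) 0 := degCon_sub.1 hxyz
    rw [coeff_extendHom_of_degCon _ h0 he.le, h0 e he, map_zero, map_zero, map_zero, map_zero]
  have hπrel : ∀ ⦃x y⦄, HRel D x y →
      ((B.mk D : _ →+* B D).comp constantCoeff) x = ((B.mk D : _ →+* B D).comp constantCoeff) y := by
    intro x y hxy
    obtain ⟨z, hz, hxyz⟩ := hxy 1
    rw [← sub_eq_zero, ← map_sub, RingHom.comp_apply, ← coeff_zero_eq_constantCoeff_apply,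
      hxyz 0 (by simp), coeff_zero_eq_constantCoeff_apply]
    exact mk_constantCoeff_of_mem D hz
  let Ψ : HHat D →+* MvPowerSeries D.Param (Module.End ℂ[T;T⁻¹] (B D)) := RingQuot.lift ⟨Θ, hΘrel⟩
  have hΨ : ∀ x, Ψ (HHat.mk D x) = Θ x := RingQuot.lift_mkRingHom_apply _ _
  let π : HHat D →+* B D := RingQuot.lift ⟨_, hπrel⟩
  have hπ : ∀ x, π (HHat.mk D x) = B.mk D (constantCoeff x) :=
    RingQuot.lift_mkRingHom_apply _ hπrel
  let Φ : HHat D →+ MvPowerSeries D.Param (B D) := (evalOne D).comp Ψ.toAddMonoidHom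
  have hΦ : ∀ x, Φ (HHat.mk D x) = L x := fun x =>
    congrArg (evalOne D) (hΨ x)
  have hbij : Function.Bijective Φ := by
    constructor
    · rw [injective_iff_map_eq_zero]
      intro a ha
      obtain ⟨x, rfl⟩ := HHat.mk_surjective D a
      rw [hΦ] at ha
      rw [← map_zero (HHat.mk D)]
      refine HHat.mk_rel D fun n => ?_
      obtain ⟨z, hz, hxz⟩ := exists_mem_degCon_of_leading hLead (relatorIdeal D)
        (fun z hz => by
          change evalOne D (Θ z) = 0
          rw [hΘJ z hz, map_zero])
        (fun a ha => exists_mem_relatorIdeal D ha) ha n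
      exact ⟨z, hz, fun e he => by rw [sub_zero, hxz e he]⟩
    · intro y
      obtain ⟨x, hx⟩ := surjective_of_leading hLead (B.mk_surjective D) y
      exact ⟨_, (hΦ x).trans hx⟩
  refine ⟨π, AddEquiv.ofBijective Φ hbij, fun k => ?_, fun f a => ?_, fun a => ?_⟩
  · exact (hπ _).trans (by rw [FreeHat.gen, constantCoeff_C]; rfl)
  · obtain ⟨x, rfl⟩ := HHat.mk_surjective D a
    change Φ _ = _ * Φ _
    have hf := HHat.smul_mk D f x
    rw [hf, hΦ, hΦ]
    change evalOne D (Θ _) = _ * evalOne D (Θ x)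
    rw [map_mul, show Θ (MvPowerSeries.map _ f) = _ from extendHom_map _ _ _ hθK f,
      evalOne_map_mul]
  · obtain ⟨x, rfl⟩ := HHat.mk_surjective D a
    change constantCoeff (Φ _) = _
    rw [hΦ, hπ, ← coeff_zero_eq_constantCoeff_apply,
      hLead 0 x (fun e he => by omega) 0 (by simp)]
    rfl

end

/-! ### Specialization of the parameter `q` -/

section

open MvPowerSeries

/-- The element `q - q₀` of `ℂ[q, q⁻¹]`. -/
def specElt (q₀ : ℂˣ) : ℂ[T;T⁻¹] := qvar - algebraMap ℂ ℂ[T;T⁻¹] q₀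

theorem Spec.mk_surjective (A : Type*) [Ring A] [Algebra ℂ[T;T⁻¹] A] (q₀ : ℂˣ) :
    Function.Surjective (Spec.mk q₀ : A →+* Spec A q₀) := RingQuot.mkRingHom_surjective _

theorem Spec.mk_qvar {A : Type*} [Ring A] [Algebra ℂ[T;T⁻¹] A] (q₀ : ℂˣ) :
    Spec.mk q₀ (algebraMap ℂ[T;T⁻¹] A qvar) =
      Spec.mk q₀ (algebraMap ℂ[T;T⁻¹] A (algebraMap ℂ ℂ[T;T⁻¹] q₀)) :=
  RingQuot.mkRingHom_rel .rel

/-- As `q - q₀` is central, its multiples already form a two-sided ideal. -/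
theorem Spec.mk_eq_zero_iff {A : Type*} [Ring A] [Algebra ℂ[T;T⁻¹] A] (q₀ : ℂˣ) (a : A) :
    Spec.mk q₀ a = 0 ↔ ∃ c : A, a = specElt q₀ • c := by
  constructor
  · intro h
    let I : TwoSidedIdeal A := TwoSidedIdeal.mk' {a | ∃ c : A, a = specElt q₀ • c}
      ⟨0, (smul_zero _).symm⟩
      (by rintro _ _ ⟨x, rfl⟩ ⟨y, rfl⟩; exact ⟨x + y, (smul_add _ _ _).symm⟩)
      (by rintro _ ⟨x, rfl⟩; exact ⟨-x, (smul_neg _ _).symm⟩)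
      (by rintro a _ ⟨x, rfl⟩; exact ⟨a * x, mul_smul_comm _ _ _⟩)
      (by rintro _ a ⟨x, rfl⟩; exact ⟨x * a, smul_mul_assoc _ _ _⟩)
    have hI : ∀ a, a ∈ I ↔ ∃ c : A, a = specElt q₀ • c := fun a =>
      TwoSidedIdeal.mem_mk' _ _ _ _ _ _ _
    rw [← hI]
    refine mem_of_mkRingHom_eq_zero (r := SpecRel A q₀) I ?_ h
    rintro _ _ ⟨⟩
    rw [hI]
    exact ⟨1, by rw [← map_sub, ← Algebra.algebraMap_eq_smul_one]; rfl⟩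
  · rintro ⟨c, rfl⟩
    rw [Algebra.smul_def, specElt, map_sub, map_mul, map_sub, Spec.mk_qvar, sub_self, zero_mul]

theorem Spec.smul_mk {S A : Type*} [CommRing S] [Ring A] [Algebra ℂ[T;T⁻¹] A] [Algebra S A]
    (q₀ : ℂˣ) (c : S) (a : A) : c • Spec.mk q₀ a = Spec.mk q₀ (c • a) :=
  smul_mkRingHom _ c a

/-- Two surjections with the same kernel have isomorphic targets. -/
theorem exists_addEquiv_of_ker_eq {A B' C' : Type*} [AddCommGroup A] [AddCommGroup B']
    [AddCommGroup C'] (f : A →+ B') (g : A →+ C') (hf : Function.Surjective f)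
    (hg : Function.Surjective g) (h : ∀ a, f a = 0 ↔ g a = 0) :
    ∃ e : B' ≃+ C', ∀ a, e (f a) = g a := by
  have hker : f.ker = g.ker := by
    ext a
    exact h a
  refine ⟨(QuotientAddGroup.quotientKerEquivOfSurjective f hf).symm.trans
    ((QuotientAddGroup.quotientAddEquivOfEq hker).trans
      (QuotientAddGroup.quotientKerEquivOfSurjective g hg)), fun a => ?_⟩
  have h1 : (QuotientAddGroup.quotientKerEquivOfSurjective f hf).symm (f a) =
      QuotientAddGroup.mk a := by
    rw [AddEquiv.symm_apply_eq]
    rfl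
  rw [AddEquiv.trans_apply, h1]
  rfl

variable (D : Diagram)

theorem HHat.smul_eq_C_smul (c : ℂ[T;T⁻¹]) (a : HHat D) :
    c • a = (C c : MvPowerSeries D.Param ℂ[T;T⁻¹]) • a := by
  obtain ⟨x, rfl⟩ := HHat.mk_surjective D a
  rw [HHat.smul_mk, map_C]
  refine (smul_mkRingHom (HRel D) c x).trans (congrArg (HHat.mk D) ?_)
  rw [Algebra.smul_def, MvPowerSeries.algebraMap_apply]

theorem HHat.complex_smul (f : MvPowerSeries D.Param ℂ) (a : HHat D) :
    f • a = MvPowerSeries.map (algebraMap ℂ ℂ[T;T⁻¹]) f • a := by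
  obtain ⟨x, rfl⟩ := HHat.mk_surjective D a
  rw [HHat.smul_mk, HHat.complex_smul_mk]
  congr 2

/-- Topological freeness passes from the formal algebra to its specializations: since `q - q₀` acts
coefficientwise, `B[[τ]] / (q - q₀) = (B / (q - q₀))[[τ]]`. -/
theorem isFlatFormalDeformation_spec (π : HHat D →+* B D)
    (Φ : HHat D ≃+ MvPowerSeries D.Param (B D)) (hgen : ∀ k, π (HHat.gen D k) = B.gen D k)
    (hΦ : ∀ (f : MvPowerSeries D.Param ℂ[T;T⁻¹]) (a : HHat D), Φ (f • a) =
        MvPowerSeries.map (algebraMap ℂ[T;T⁻¹] (B D)) f * Φ a)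
    (hπ : ∀ a, constantCoeff (Φ a) = π a) (q₀ : ℂˣ) :
    ∃ π : Spec (HHat D) q₀ →+* Spec (B D) q₀,
        (∀ k : Fin D.m, π (Spec.mk q₀ (HHat.gen D k)) = Spec.mk q₀ (B.gen D k)) ∧
        IsFlatFormalDeformation (σ := D.Param) (K := ℂ) π := by
  have hΦK : ∀ (c : ℂ[T;T⁻¹]) (a : HHat D) (e : D.Param →₀ ℕ),
      coeff e (Φ (c • a)) = c • coeff e (Φ a) := by
    intro c a e
    rw [HHat.smul_eq_C_smul, hΦ, map_C, coeff_C_mul, Algebra.smul_def]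
  have hπK : ∀ c : ℂ[T;T⁻¹], π (algebraMap ℂ[T;T⁻¹] (HHat D) c) = algebraMap ℂ[T;T⁻¹] (B D) c := by
    intro c
    rw [Algebra.algebraMap_eq_smul_one, ← hπ, ← coeff_zero_eq_constantCoeff_apply, hΦK,
      coeff_zero_eq_constantCoeff_apply, hπ, map_one, Algebra.algebraMap_eq_smul_one]
  have hrel : ∀ ⦃x y⦄, SpecRel (HHat D) q₀ x y →
      ((Spec.mk q₀).comp π) x = ((Spec.mk q₀).comp π) y := by
    rintro _ _ ⟨⟩
    rw [RingHom.comp_apply, RingHom.comp_apply, hπK, hπK]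
    exact Spec.mk_qvar q₀
  let π' : Spec (HHat D) q₀ →+* Spec (B D) q₀ := RingQuot.lift ⟨_, hrel⟩
  have hπ' : ∀ a, π' (Spec.mk q₀ a) = Spec.mk q₀ (π a) :=
    RingQuot.lift_mkRingHom_apply _ hrel
  let F : HHat D →+ MvPowerSeries D.Param (Spec (B D) q₀) :=
    (MvPowerSeries.map (Spec.mk q₀ : B D →+* Spec (B D) q₀)).toAddMonoidHom.comp Φ.toAddMonoidHom
  have hF : ∀ a, F a = MvPowerSeries.map (Spec.mk q₀) (Φ a) := fun _ => rfl
  obtain ⟨Ψ, hΨ⟩ := exists_addEquiv_of_ker_eq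
    (Spec.mk q₀ : HHat D →+* Spec (HHat D) q₀).toAddMonoidHom F (Spec.mk_surjective _ q₀)
    (by
      intro y
      choose r hr using Spec.mk_surjective (B D) q₀
      let y' : MvPowerSeries D.Param (B D) := fun e => r (coeff e y)
      refine ⟨Φ.symm y', ?_⟩
      rw [hF, Φ.apply_symm_apply]
      ext e
      rw [coeff_map]
      exact hr _)
    (by
      intro a
      change Spec.mk q₀ a = 0 ↔ _
      rw [Spec.mk_eq_zero_iff, hF]
      constructor
      · rintro ⟨c, rfl⟩
        ext e
        rw [coeff_map, hΦK, map_zero, Spec.mk_eq_zero_iff]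
        exact ⟨_, rfl⟩
      · intro h
        have h1 : ∀ e, ∃ c : B D, coeff e (Φ a) = specElt q₀ • c := by
          intro e
          rw [← Spec.mk_eq_zero_iff, ← coeff_map, h, map_zero]
        choose c hc using h1
        let c' : MvPowerSeries D.Param (B D) := c
        refine ⟨Φ.symm c', Φ.injective (MvPowerSeries.ext fun e => ?_)⟩
        rw [hΦK, Φ.apply_symm_apply, hc]
        rfl)
  have hΨ' : ∀ a, Ψ (Spec.mk q₀ a) = MvPowerSeries.map (Spec.mk q₀) (Φ a) := hΨ
  refine ⟨π', fun k => (hπ' _).trans (by rw [hgen]), isFlatFormalDeformation_of_equiv Ψ ?_ π' ?_⟩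
  · intro f a
    obtain ⟨a, rfl⟩ := Spec.mk_surjective _ q₀ a
    rw [Spec.smul_mk, hΨ', hΨ', HHat.complex_smul, hΦ, map_mul]
    congr 1
    ext e
    rw [coeff_map, coeff_map, coeff_map, coeff_map, ← IsScalarTower.algebraMap_apply,
      Algebra.algebraMap_eq_smul_one, Algebra.algebraMap_eq_smul_one, ← Spec.smul_mk, map_one]
  · intro a
    obtain ⟨a, rfl⟩ := Spec.mk_surjective _ q₀ a
    rw [hΨ', constantCoeff_map, hπ, hπ']

end

/-! ### A monomial basis of the quantum torus -/

namespace Torus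

variable {K : Type*} [CommRing K]

/-- Multiplication by `X` on functions on the lattice of exponents. -/
def latticeX : (ℤ × ℤ → K) ≃ₗ[K] (ℤ × ℤ → K) where
  toFun f v := f (v.1 - 1, v.2)
  invFun f v := f (v.1 + 1, v.2)
  map_add' _ _ := rfl
  map_smul' _ _ := rfl
  left_inv f := by funext v; simp
  right_inv f := by funext v; simp

/-- Multiplication by `P` on functions on the lattice of exponents, where `P X = Q X P`. -/
def latticeP (Q : Kˣ) : (ℤ × ℤ → K) ≃ₗ[K] (ℤ × ℤ → K) where
  toFun f v := (↑(Q ^ v.1) : K) * f (v.1, v.2 - 1)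
  invFun f v := (↑(Q ^ (-v.1)) : K) * f (v.1, v.2 + 1)
  map_add' _ _ := by funext v; simp [mul_add]
  map_smul' _ _ := by funext v; simp [mul_left_comm]
  left_inv f := by funext v; simp
  right_inv f := by funext v; simp

theorem latticeX_zpow (n : ℤ) (f : ℤ × ℤ → K) (v : ℤ × ℤ) :
    ((latticeX : (ℤ × ℤ → K) ≃ₗ[K] (ℤ × ℤ → K)) ^ n) f v = f (v.1 - n, v.2) := by
  induction n generalizing f with
  | zero => simp
  | succ n ih =>
    rw [zpow_add_one, LinearEquiv.mul_apply, ih]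
    change f (v.1 - n - 1, v.2) = _
    rw [sub_sub]
  | pred n ih =>
    rw [zpow_sub_one, LinearEquiv.mul_apply, ih]
    change f (v.1 - -n + 1, v.2) = _
    congr 2
    ring

theorem latticeP_zpow (Q : Kˣ) (n : ℤ) (f : ℤ × ℤ → K) (v : ℤ × ℤ) :
    (latticeP Q ^ n) f v = (↑(Q ^ (v.1 * n)) : K) * f (v.1, v.2 - n) := by
  induction n generalizing f with
  | zero => simp
  | succ n ih =>
    rw [zpow_add_one, LinearEquiv.mul_apply, ih]
    change _ * ((↑(Q ^ v.1) : K) * f (v.1, v.2 - n - 1)) = _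
    rw [sub_sub, ← mul_assoc, ← Units.val_mul, ← zpow_add, mul_add, mul_one]
  | pred n ih =>
    rw [zpow_sub_one, LinearEquiv.mul_apply, ih]
    change _ * ((↑(Q ^ (-v.1)) : K) * f (v.1, v.2 - -n + 1)) = _
    rw [← mul_assoc, ← Units.val_mul, ← zpow_add, mul_sub, mul_one, ← sub_eq_add_neg]
    congr 3
    ring

variable (D : Diagram) (q : Kˣ)

/-- `latticeX` as a unit of the endomorphism algebra. -/
def latticeXUnit : (Module.End K (ℤ × ℤ → K))ˣ :=
  (LinearMap.GeneralLinearGroup.generalLinearEquiv K (ℤ × ℤ → K)).symm latticeX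

/-- `latticeP` as a unit of the endomorphism algebra. -/
def latticePUnit : (Module.End K (ℤ × ℤ → K))ˣ :=
  (LinearMap.GeneralLinearGroup.generalLinearEquiv K (ℤ × ℤ → K)).symm (latticeP (q ^ D.ell))

theorem latticePUnit_mul_latticeXUnit : latticePUnit D q * latticeXUnit =
    scal q _ ^ D.ell * (latticeXUnit * latticePUnit D q) := by
  apply Units.ext
  rw [Units.val_mul, Units.val_mul, Units.val_mul, scal, ← map_pow]
  refine LinearMap.ext fun f => funext fun v => ?_
  change (↑((q ^ D.ell) ^ v.1) : K) * f (v.1 - 1, v.2 - 1) =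
    ((q ^ D.ell : Kˣ) : K) * ((↑((q ^ D.ell) ^ (v.1 - 1)) : K) * f (v.1 - 1, v.2 - 1))
  rw [← mul_assoc, ← Units.val_mul, ← zpow_one_add]
  congr 3
  ring

/-- The representation of the `Q`-Weyl algebra on functions on the lattice of exponents. -/
def latticeRep : Torus D q →ₐ[K] Module.End K (ℤ × ℤ → K) :=
  lift latticeXUnit (latticePUnit D q) (latticePUnit_mul_latticeXUnit D q)

theorem mon_eq_smul (a i j : ℤ) :
    (mon D q a i j : Torus D q) = (↑(q ^ a) : K) • (mon D q 0 i j : Torus D q) := by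
  rw [mon, mon, zpow_zero, one_mul, mul_assoc, Units.val_mul, Algebra.smul_def, scal, ← map_zpow]
  rfl

/-- Applied to the delta function at `0`, the monomials give all delta functions. -/
theorem latticeRep_mon (i j : ℤ) :
    latticeRep D q (mon D q 0 i j : Torus D q) (Pi.single (0, 0) 1) = Pi.single (i, j) 1 := by
  have h := lift_gen latticeXUnit (latticePUnit D q) (latticePUnit_mul_latticeXUnit D q)
  have h1 : Units.map (latticeRep D q : Torus D q →* Module.End K (ℤ × ℤ → K)) (mon D q 0 i j) =
      latticeXUnit ^ i * latticePUnit D q ^ j := by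
    rw [mon, zpow_zero, one_mul, map_mul, map_zpow, map_zpow, latticeRep, h.1, h.2]
  have h2 := congrArg Units.val h1
  rw [latticeXUnit, latticePUnit, ← map_zpow, ← map_zpow, ← map_mul] at h2
  refine (LinearMap.congr_fun h2 _).trans ?_
  change ((latticeX : (ℤ × ℤ → K) ≃ₗ[K] (ℤ × ℤ → K)) ^ i) ((latticeP (q ^ D.ell) ^ j) _) = _
  funext v
  rw [latticeX_zpow, latticeP_zpow]
  dsimp only
  by_cases hv : v = (i, j)
  · subst hv
    simp
  · rw [Pi.single_eq_of_ne hv, Pi.single_eq_of_ne, mul_zero]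
    intro h0
    apply hv
    rw [Prod.mk.injEq, sub_eq_zero, sub_eq_zero] at h0
    exact Prod.ext h0.1 h0.2

theorem linearIndependent_mon :
    LinearIndependent K fun v : ℤ × ℤ => (mon D q 0 v.1 v.2 : Torus D q) := by
  rw [linearIndependent_iff]
  intro l hl
  ext v
  have h1 : ∀ l : ℤ × ℤ →₀ K, (latticeRep D q (Finsupp.linearCombination K
      (fun v : ℤ × ℤ => (mon D q 0 v.1 v.2 : Torus D q)) l)) (Pi.single (0, 0) 1) v = l v := by
    intro l
    induction l using Finsupp.induction_linear with
    | zero => simp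
    | add f g hf hg =>
      rw [map_add, map_add, LinearMap.add_apply, Pi.add_apply, hf, hg, Finsupp.add_apply]
    | single w r =>
      rw [Finsupp.linearCombination_single, map_smul, LinearMap.smul_apply, latticeRep_mon]
      by_cases hvw : v = w
      · subst hvw
        simp
      · rw [Finsupp.single_eq_of_ne hvw, Pi.smul_apply, Pi.single_eq_of_ne hvw, smul_zero]
  rw [← h1, hl]
  simp

theorem span_mon :
    Submodule.span K (Set.range fun v : ℤ × ℤ => (mon D q 0 v.1 v.2 : Torus D q)) = ⊤ := by
  set S := Submodule.span K (Set.range fun v : ℤ × ℤ => (mon D q 0 v.1 v.2 : Torus D q)) with hS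
  have hmon : ∀ a i j, (mon D q a i j : Torus D q) ∈ S := by
    intro a i j
    rw [mon_eq_smul]
    exact S.smul_mem _ (Submodule.subset_span ⟨(i, j), rfl⟩)
  have hmul : S * S ≤ S := by
    rw [hS, Submodule.span_mul_span, Submodule.span_le]
    rintro _ ⟨_, ⟨v, rfl⟩, _, ⟨w, rfl⟩, rfl⟩
    dsimp only
    rw [← Units.val_mul, mon_mul]
    exact hmon _ _ _
  have hone : (1 : Torus D q) ∈ S := by
    have := hmon 0 0 0
    rwa [mon_one] at this
  rw [eq_top_iff]
  rintro a -
  obtain ⟨x, rfl⟩ := RingQuot.mkAlgHom_surjective K (TorusRel K (q ^ D.ell)) a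
  change (RingQuot.mkAlgHom K (TorusRel K (q ^ D.ell)) x : Torus D q) ∈ S
  induction x using FreeAlgebra.induction with
  | grade0 r =>
    rw [AlgHom.commutes, Algebra.algebraMap_eq_smul_one]
    exact S.smul_mem _ hone
  | grade1 g =>
    cases g with
    | X => have := hmon 0 1 0; rwa [← X_eq] at this
    | Xinv => have := hmon 0 (-1) 0; rwa [mon, zpow_zero, zpow_zero, one_mul, mul_one, zpow_neg_one]
                at this
    | P => have := hmon 0 0 1; rwa [← P_eq] at this
    | Pinv => have := hmon 0 0 (-1); rwa [mon, zpow_zero, zpow_zero, one_mul, one_mul, zpow_neg_one]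
                at this
  | mul a b ha hb =>
    rw [map_mul]
    exact hmul (Submodule.mul_mem_mul ha hb)
  | add a b ha hb =>
    rw [map_add]
    exact S.add_mem ha hb

/-- The monomials `X^i P^j` form a basis of the `Q`-Weyl algebra. -/
def monBasis : Module.Basis (ℤ × ℤ) K (Torus D q) :=
  Module.Basis.mk (linearIndependent_mon D q) (span_mon D q).ge

theorem monBasis_apply (v : ℤ × ℤ) : monBasis D q v = (mon D q 0 v.1 v.2 : Torus D q) :=
  Module.Basis.mk_apply _ _ _

end Torus

/-- The crossed product as a module: finitely supported functions on `ℤ/ℓ`. -/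
def CrossedProduct.linearEquiv {K : Type*} [CommRing K] (D : Diagram) (q : Kˣ) :
    CrossedProduct D q ≃ₗ[K] (Multiplicative (ZMod D.ell) →₀ Torus D q) :=
  { SkewMonoidAlgebra.coeffAddEquiv with
    map_smul' := fun c f => SkewMonoidAlgebra.coeff_smul c f }

/-- The crossed product has a basis `X^n P^j g` on which left multiplication by `X` is a shift. -/
theorem CrossedProduct.exists_basis {K : Type*} [CommRing K] (D : Diagram) (q : Kˣ) :
    ∃ b : Module.Basis (ℤ × (ℤ × Multiplicative (ZMod D.ell))) K (CrossedProduct D q),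
      ∀ n i, SkewMonoidAlgebra.single 1 (Torus.X D q : Torus D q) * b (n, i) = b (n + 1, i) := by
  let e : (Σ _ : Multiplicative (ZMod D.ell), ℤ × ℤ) ≃
      ℤ × (ℤ × Multiplicative (ZMod D.ell)) :=
    ⟨fun p => (p.2.1, (p.2.2, p.1)), fun p => ⟨p.2.2, (p.1, p.2.1)⟩, fun _ => rfl, fun _ => rfl⟩
  let b := ((Finsupp.basis fun _ : Multiplicative (ZMod D.ell) => Torus.monBasis D q).map
    (CrossedProduct.linearEquiv D q).symm).reindex e
  have hb : ∀ n j g, b (n, (j, g)) =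
      SkewMonoidAlgebra.single g (Torus.mon D q 0 n j : Torus D q) := by
    intro n j g
    rw [Module.Basis.reindex_apply, Module.Basis.map_apply, Finsupp.coe_basis]
    change (CrossedProduct.linearEquiv D q).symm (Finsupp.single g (Torus.monBasis D q (n, j))) = _
    rw [Torus.monBasis_apply]
    rfl
  refine ⟨b, fun n i => ?_⟩
  obtain ⟨j, g⟩ := i
  rw [hb, hb, SkewMonoidAlgebra.single_mul_single, one_mul, one_smul, ← Units.val_mul,
    Torus.X_eq, Torus.mon_mul]
  congr 3 <;> ring

/-! ### Words in the two systems of generators -/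

section

variable {H : Type*} [Group H]

/-- The generator `s` of the rotation group in terms of the `T k`; the element `k` of
`Fin D.m` stands for the index `k + 1`. -/
def sWord : (D : Diagram) → (Fin D.m → H) → H
  | .D4, T => T (0 : Fin 4)
  | .E6, T => T (2 : Fin 3)
  | .E7, T => T (2 : Fin 3)
  | .E8, T => T (2 : Fin 3)

/-- The generator `X` of the quantum torus in terms of the `T k` and of the central element
`c = q`. -/
def xWord (c : H) : (D : Diagram) → (Fin D.m → H) → H
  | .D4, T => T (1 : Fin 4) * T (0 : Fin 4)
  | .E6, T => c⁻¹ * T (1 : Fin 3) * (T (2 : Fin 3))⁻¹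
  | .E7, T => (c ^ 3)⁻¹ * T (1 : Fin 3) * (T (2 : Fin 3))⁻¹
  | .E8, T => c⁻¹ * T (1 : Fin 3) * (T (2 : Fin 3) ^ 2)⁻¹

/-- The generator `P` of the quantum torus in terms of the `T k` and of the central element
`c = q`. -/
def pWord (c : H) : (D : Diagram) → (Fin D.m → H) → H
  | .D4, T => T (3 : Fin 4) * T (0 : Fin 4)
  | .E6, T => c ^ 2 * (sWord .E6 T * xWord c .E6 T * (sWord .E6 T)⁻¹)
  | .E7, T => c ^ 2 * (sWord .E7 T * xWord c .E7 T * (sWord .E7 T)⁻¹)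
  | .E8, T => c * (sWord .E8 T * xWord c .E8 T * (sWord .E8 T)⁻¹)

/-- The elements `T k` in terms of `q`, `X`, `P` and `s`. -/
def tWord (c x p s : H) : (D : Diagram) → Fin D.m → H
  | .D4 => ![s, x * s, c * x * p * s, p * s]
  | .E6 => ![c ^ 2 * p⁻¹ * s, c * x * s, s]
  | .E7 => ![c ^ 2 * x * s ^ 2, c ^ 3 * x * s, s]
  | .E8 => ![x * s ^ 3, c * x * s ^ 2, s]

/-- The image of `X` under the rotation `a ↦ s⁻¹ a s`, as a word in a group. -/
def rotXWord (c x p : H) : Diagram → H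
  | .D4 => x⁻¹
  | .E6 => c ^ (-1 : ℤ) * p⁻¹ * x⁻¹
  | .E7 => c ^ (-2 : ℤ) * p⁻¹
  | .E8 => c ^ (-2 : ℤ) * x * p⁻¹

/-- The image of `P` under the rotation `a ↦ s⁻¹ a s`, as a word in a group. -/
def rotPWord (c x p : H) : Diagram → H
  | .D4 => p⁻¹
  | .E6 => c ^ (2 : ℤ) * x
  | .E7 => c ^ (2 : ℤ) * x
  | .E8 => c ^ (1 : ℤ) * x

/-- The relations between the generators `q`, `X`, `P`, `s` of the group of monomials of the crossed
product. -/
structure CrossedRelations (D : Diagram) (c x p s : H) : Prop where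
  comm : p * x = c ^ D.ell * (x * p)
  rot_x : s⁻¹ * x * s = rotXWord c x p D
  rot_p : s⁻¹ * p * s = rotPWord c x p D
  pow_s : s ^ D.ell = 1

/-- The relations between the generators `q`, `T k` of `B`. -/
structure StarRelations (D : Diagram) (c : H) (T : Fin D.m → H) : Prop where
  pow : ∀ k, T k ^ D.d k = 1
  prod : (List.ofFn T).prod = c

variable {c : H}

theorem prod_ofFn_three (T : Fin 3 → H) : (List.ofFn T).prod = T 0 * T 1 * T 2 := by
  simp [List.ofFn_succ, mul_assoc]

theorem prod_ofFn_four (T : Fin 4 → H) : (List.ofFn T).prod = T 0 * T 1 * T 2 * T 3 := by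
  simp [List.ofFn_succ, mul_assoc]

/-- The case `D4`: here `s = T 1`, `X = T 2 T 1`, `P = T 4 T 1`, and the `T k` are involutions. -/
theorem crossedRelations_D4 (hc : ∀ h, Commute c h) {t₀ t₁ t₂ t₃ : H} (h₀ : t₀ ^ 2 = 1)
    (h₁ : t₁ ^ 2 = 1) (h₂ : t₂ ^ 2 = 1) (h₃ : t₃ ^ 2 = 1) (hp : t₀ * t₁ * t₂ * t₃ = c) :
    CrossedRelations .D4 c (t₁ * t₀) (t₃ * t₀) t₀ ∧ c * (t₁ * t₀) * (t₃ * t₀) * t₀ = t₂ := by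
  have i₀ : t₀⁻¹ = t₀ := inv_eq_of_mul_eq_one_left (by rw [← pow_two, h₀])
  have i₁ : t₁⁻¹ = t₁ := inv_eq_of_mul_eq_one_left (by rw [← pow_two, h₁])
  have i₃ : t₃⁻¹ = t₃ := inv_eq_of_mul_eq_one_left (by rw [← pow_two, h₃])
  have e₂ : t₂ = c * (t₁ * t₀ * t₃) := by
    have : t₂ = t₁⁻¹ * t₀⁻¹ * c * t₃⁻¹ := by rw [← hp]; group
    rw [this, i₀, i₁, i₃, ← (hc (t₁ * t₀)).eq]
    group
  have key : c ^ 2 * (t₁ * t₀ * t₃) = t₃ * t₀ * t₁ := by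
    rw [e₂, (hc _).mul_pow, pow_two (t₁ * t₀ * t₃), ← mul_assoc] at h₂
    rw [eq_inv_of_mul_eq_one_left h₂, mul_inv_rev, mul_inv_rev, i₀, i₁, i₃, mul_assoc]
  refine ⟨⟨?_, ?_, ?_, h₀⟩, ?_⟩
  · change _ = c ^ 2 * _
    calc t₃ * t₀ * (t₁ * t₀) = t₃ * t₀ * t₁ * t₀ := by group
      _ = _ := by rw [← key]; group
  · change t₀⁻¹ * (t₁ * t₀) * t₀ = (t₁ * t₀)⁻¹
    rw [mul_inv_rev, i₀, i₁, mul_assoc, mul_assoc, ← pow_two, h₀, mul_one]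
  · change t₀⁻¹ * (t₃ * t₀) * t₀ = (t₃ * t₀)⁻¹
    rw [mul_inv_rev, i₀, i₃, mul_assoc, mul_assoc, ← pow_two, h₀, mul_one]
  · rw [mul_assoc, mul_assoc t₃, ← pow_two, h₀, mul_one, e₂, mul_assoc]

/-- The case `E6`, in terms of `s = T 3`, `a = T 1` and `x` with `T 2 = q x s`. The product relation
expresses `T 1` by `x` and `s`; what remains are the orders of the `T k`, which become relations
between the conjugates of `x` under powers of `s`. -/
theorem crossedRelations_E6 (hc : ∀ h, Commute c h) {a x s : H} (ha : a ^ 3 = 1)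
    (hb : (c * x * s) ^ 3 = 1) (hs : s ^ 3 = 1) (hp : a * (c * x * s) * s = c) :
    CrossedRelations .E6 c x (c ^ 2 * (s * x * s⁻¹)) s ∧
      c ^ 2 * (c ^ 2 * (s * x * s⁻¹))⁻¹ * s = a := by
  have ha' : a = (x * s * s)⁻¹ := by
    rw [eq_inv_iff_mul_eq_one]
    have : c * (a * (x * s * s)) = c := by
      rw [← mul_assoc, (hc a).eq]
      nth_rewrite 2 [← hp]
      group
    exact mul_eq_left.1 this
  obtain ⟨y, hy⟩ : ∃ y, s * x * s⁻¹ = y := ⟨_, rfl⟩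
  obtain ⟨z, hz⟩ : ∃ z, s⁻¹ * x * s = z := ⟨_, rfl⟩
  -- The orders of `T 2` and `T 1` relate the three conjugates `x`, `y`, `z` of `x`.
  have F1 : c ^ 3 * (x * y * z) = 1 := by
    rw [mul_assoc, (hc _).mul_pow] at hb
    rw [← hb, ← hy, ← hz]
    congr 1
    calc _ = x * s * x * s ^ (-2 : ℤ) * x * s := by group
      _ = x * s * x * (s ^ 3 * s ^ (-2 : ℤ)) * x * s := by rw [hs, one_mul]
      _ = _ := by simp only [pow_succ, pow_zero]; group
  have F2 : x * z * y = 1 := by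
    have h1 : (x * s * s) ^ 3 = 1 := by rw [← inv_eq_one, ← inv_pow, ← ha', ha]
    rw [← h1, ← hy, ← hz]
    calc _ = x * s⁻¹ * x * (s⁻¹ * s ^ 3) * x * s⁻¹ := by
          simp only [pow_succ, pow_zero]; group
      _ = x * (s⁻¹ * s ^ 3) * x * (s⁻¹ * s ^ 3) * x * (s⁻¹ * s ^ 3) := by
        rw [hs, mul_one]
      _ = _ := by simp only [pow_succ, pow_zero]; group
  have hz2 : z = (y * x)⁻¹ := by
    calc z = x⁻¹ * (x * z * y) * y⁻¹ := by group
      _ = _ := by rw [F2]; group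
  have F3 : y * x = c ^ 3 * (x * y) := by
    rw [hz2] at F1
    calc y * x = c ^ 3 * (x * y * (y * x)⁻¹) * (y * x) := by rw [F1, one_mul]
      _ = _ := by group
  have cx : ∀ k, x * (c ^ 2 * k) = c ^ 2 * (x * k) := fun k => by
    rw [← mul_assoc, ← ((hc x).pow_left 2).eq, mul_assoc]
  have cy : (c ^ 2 * y)⁻¹ = (c ^ 2)⁻¹ * y⁻¹ := by
    rw [mul_inv_rev, ((hc y⁻¹).pow_left 2).inv_left.eq]
  rw [hy]
  refine ⟨⟨?_, ?_, ?_, hs⟩, ?_⟩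
  · change _ = c ^ 3 * _
    rw [mul_assoc, F3, cx]
    group
  · change _ = c ^ (-1 : ℤ) * (c ^ 2 * y)⁻¹ * x⁻¹
    rw [hz, cy]
    calc z = y⁻¹ * x⁻¹ * (c ^ 3)⁻¹ * (c ^ 3 * (x * y * z)) := by group
      _ = (c ^ 3)⁻¹ * (y⁻¹ * x⁻¹) := by rw [F1, mul_one, ((hc _).pow_left 3).inv_left.eq]
      _ = _ := by group
  · change _ = c ^ (2 : ℤ) * x
    rw [← mul_assoc, ← ((hc s⁻¹).pow_left 2).eq, ← hy]
    group
  · rw [cy, ha', ← hy]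
    calc _ = s * x⁻¹ := by group
      _ = s ^ 3 * (s⁻¹ * s⁻¹ * x⁻¹) := by simp only [pow_succ, pow_zero]; group
      _ = _ := by rw [hs]; group

/-- The case `E7`, in terms of `s = T 3`, `a = T 1` and `x` with `T 2 = q³ x s`. -/
theorem crossedRelations_E7 (hc : ∀ h, Commute c h) {a x s : H} (ha : a ^ 2 = 1)
    (hb : (c ^ 3 * x * s) ^ 4 = 1) (hs : s ^ 4 = 1) (hp : a * (c ^ 3 * x * s) * s = c) :
    CrossedRelations .E7 c x (c ^ 2 * (s * x * s⁻¹)) s ∧ c ^ 2 * x * s ^ 2 = a := by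
  have ia : a⁻¹ = a := inv_eq_of_mul_eq_one_left (by rw [← pow_two, ha])
  have ha' : a = c ^ 2 * (x * s ^ 2) := by
    calc a = a⁻¹ := ia.symm
      _ = (c ^ 3 * x * s) * s * (a * (c ^ 3 * x * s) * s)⁻¹ := by group
      _ = c ^ 3 * (x * s ^ 2) * c⁻¹ := by rw [hp]; simp only [pow_succ, pow_zero]; group
      _ = c⁻¹ * (c ^ 3 * (x * s ^ 2)) := by rw [(hc _).inv_left.eq]
      _ = _ := by group
  obtain ⟨y, hy⟩ : ∃ y, s * x * s⁻¹ = y := ⟨_, rfl⟩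
  -- Conjugation by `s ^ 2` inverts `x` up to a scalar.
  have F1 : c ^ 4 * (x * (s ^ 2 * x * (s ^ 2)⁻¹)) = 1 := by
    rw [ha', ((hc _).pow_left 2).mul_pow, ← pow_mul] at ha
    rw [← ha]
    congr 1
    calc _ = x * s ^ 2 * x * (s ^ 2)⁻¹ * s ^ 4 := by rw [hs]; group
      _ = _ := by simp [pow_succ, mul_assoc]
  have F2 : s ^ 2 * x * (s ^ 2)⁻¹ = (c ^ 4)⁻¹ * x⁻¹ := by
    calc _ = x⁻¹ * (c ^ 4)⁻¹ * (c ^ 4 * (x * (s ^ 2 * x * (s ^ 2)⁻¹))) := by group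
      _ = _ := by rw [F1, mul_one, ((hc _).pow_left 4).inv_left.eq]
  have F3 : s ^ 2 * y * (s ^ 2)⁻¹ = (c ^ 4)⁻¹ * y⁻¹ := by
    calc _ = s * (s ^ 2 * x * (s ^ 2)⁻¹) * s⁻¹ := by rw [← hy]; group
      _ = (c ^ 4)⁻¹ * (s * x⁻¹ * s⁻¹) := by
        rw [F2, ← mul_assoc s, ← ((hc s).pow_left 4).inv_left.eq]; group
      _ = _ := by rw [← hy]; group
  have F4 : y * x = c ^ 4 * (x * y) := by
    rw [mul_assoc, ((hc _).pow_left 3).mul_pow, ← pow_mul] at hb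
    have h1 : (x * s) ^ 4 =
        x * y * ((s ^ 2 * x * (s ^ 2)⁻¹) * (s ^ 2 * y * (s ^ 2)⁻¹)) * s ^ 4 := by
      rw [← hy]
      simp only [pow_succ, pow_zero]; group
    rw [h1, F2, F3, hs, mul_one] at hb
    have h2 : (c ^ 4)⁻¹ * x⁻¹ * ((c ^ 4)⁻¹ * y⁻¹) = (c ^ 8)⁻¹ * (y * x)⁻¹ := by
      rw [mul_assoc, ← mul_assoc x⁻¹, ← ((hc x⁻¹).pow_left 4).inv_left.eq]
      group
    rw [h2, ← mul_assoc (x * y), ← ((hc (x * y)).pow_left 8).inv_left.eq] at hb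
    calc y * x = (c ^ (3 * 4) * ((c ^ 8)⁻¹ * (x * y) * (y * x)⁻¹)) * (y * x) := by
          rw [hb, one_mul]
      _ = _ := by group
  have cx : ∀ k, x * (c ^ 2 * k) = c ^ 2 * (x * k) := fun k => by
    rw [← mul_assoc, ← ((hc x).pow_left 2).eq, mul_assoc]
  have cy : (c ^ 2 * y)⁻¹ = (c ^ 2)⁻¹ * y⁻¹ := by
    rw [mul_inv_rev, ((hc y⁻¹).pow_left 2).inv_left.eq]
  rw [hy]
  refine ⟨⟨?_, ?_, ?_, hs⟩, ?_⟩
  · change _ = c ^ 4 * _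
    rw [mul_assoc, F4, cx]
    group
  · change _ = c ^ (-2 : ℤ) * (c ^ 2 * y)⁻¹
    calc _ = s⁻¹ * s⁻¹ * y * s * s := by rw [← hy]; group
      _ = s ^ 4 * (s⁻¹ * s⁻¹ * y * s * s) * (s ^ 4)⁻¹ := by rw [hs]; group
      _ = s ^ 2 * y * (s ^ 2)⁻¹ := by simp [pow_succ, mul_assoc]
      _ = _ := by rw [F3, cy]; group
  · change _ = c ^ (2 : ℤ) * x
    rw [← mul_assoc, ← ((hc s⁻¹).pow_left 2).eq, ← hy]
    group
  · rw [ha', mul_assoc]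

/-- The case `E8`, in terms of `s = T 3`, `a = T 1` and `x` with `T 2 = q x s²`. -/
theorem crossedRelations_E8 (hc : ∀ h, Commute c h) {a x s : H} (ha : a ^ 2 = 1)
    (hb : (c * x * s ^ 2) ^ 3 = 1) (hs : s ^ 6 = 1) (hp : a * (c * x * s ^ 2) * s = c) :
    CrossedRelations .E8 c x (c * (s * x * s⁻¹)) s ∧ x * s ^ 3 = a := by
  have ia : a⁻¹ = a := inv_eq_of_mul_eq_one_left (by rw [← pow_two, ha])
  have ha' : a = x * s ^ 3 := by
    calc a = a⁻¹ := ia.symm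
      _ = (c * x * s ^ 2) * s * (a * (c * x * s ^ 2) * s)⁻¹ := by group
      _ = c * (x * s ^ 3) * c⁻¹ := by rw [hp]; simp only [pow_succ, pow_zero]; group
      _ = _ := by rw [(hc _).eq]; group
  obtain ⟨y, hy⟩ : ∃ y, s * x * s⁻¹ = y := ⟨_, rfl⟩
  obtain ⟨z, hz⟩ : ∃ z, s * y * s⁻¹ = z := ⟨_, rfl⟩
  -- Conjugation by `s ^ 3` inverts `x`.
  have F1 : s * z * s⁻¹ = x⁻¹ := by
    rw [ha'] at ha
    calc _ = x⁻¹ * (x * s ^ 3) ^ 2 * (s ^ 6)⁻¹ := by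
          rw [← hz, ← hy]; simp [pow_succ, mul_assoc]
      _ = _ := by rw [ha, hs]; group
  have F2 : c ^ 3 * (x * z * y⁻¹) = 1 := by
    rw [mul_assoc, (hc _).mul_pow] at hb
    rw [← hb]
    congr 1
    have h1 : y⁻¹ = s * s * z * (s * s)⁻¹ := by
      rw [← hy, mul_inv_rev, mul_inv_rev, inv_inv, ← F1]
      group
    rw [h1]
    calc _ = x * z * (s * s * z * (s * s)⁻¹) * s ^ 6 := by rw [hs, mul_one]
      _ = _ := by rw [← hz, ← hy]; simp [pow_succ, mul_assoc]
  have F3 : z = (c ^ 3)⁻¹ * (x⁻¹ * y) := by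
    calc z = x⁻¹ * (c ^ 3)⁻¹ * (c ^ 3 * (x * z * y⁻¹)) * y := by group
      _ = _ := by rw [F2, mul_one, ← ((hc _).pow_left 3).inv_left.eq, mul_assoc]
  have F4 : y * x = c ^ 6 * (x * y) := by
    have h1 : x⁻¹ = (c ^ 6)⁻¹ * (y⁻¹ * x⁻¹ * y) := by
      calc x⁻¹ = s * ((c ^ 3)⁻¹ * (x⁻¹ * y)) * s⁻¹ := by rw [← F3, F1]
        _ = (c ^ 3)⁻¹ * ((s * x * s⁻¹)⁻¹ * (s * y * s⁻¹)) := by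
          rw [← mul_assoc s, ← ((hc s).pow_left 3).inv_left.eq]; group
        _ = (c ^ 3)⁻¹ * (y⁻¹ * (c ^ 3)⁻¹ * (x⁻¹ * y)) := by rw [hy, hz, F3]; group
        _ = _ := by rw [← ((hc y⁻¹).pow_left 3).inv_left.eq]; group
    calc y * x = y * (c ^ 6 * (c ^ 6)⁻¹) * x := by group
      _ = c ^ 6 * (y * (c ^ 6)⁻¹ * x) := by
        rw [← mul_assoc y, ← ((hc y).pow_left 6).eq]; group
      _ = c ^ 6 * (x * y * (y⁻¹ * x⁻¹ * y) * (c ^ 6)⁻¹ * x) := by group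
      _ = c ^ 6 * (x * y * ((c ^ 6)⁻¹ * (y⁻¹ * x⁻¹ * y)) * x) := by
        rw [((hc (y⁻¹ * x⁻¹ * y)).pow_left 6).inv_left.eq]; group
      _ = _ := by rw [← h1]; group
  have cx : ∀ k, x * (c * k) = c * (x * k) := fun k => by
    rw [← mul_assoc, ← (hc x).eq, mul_assoc]
  have cy : (c * y)⁻¹ = c⁻¹ * y⁻¹ := by
    rw [mul_inv_rev, (hc y⁻¹).inv_left.eq]
  rw [hy]
  refine ⟨⟨?_, ?_, ?_, hs⟩, ha'.symm⟩
  · change _ = c ^ 6 * _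
    rw [mul_assoc, F4, cx, ← mul_assoc, ← mul_assoc, ← mul_assoc, ← pow_succ', ← pow_succ,
      mul_assoc]
  · change _ = c ^ (-2 : ℤ) * x * (c * y)⁻¹
    calc _ = (s⁻¹ * x⁻¹ * s)⁻¹ := by group
      _ = z⁻¹ := by rw [← F1]; group
      _ = (c ^ 3) * (y⁻¹ * x) := by
        rw [F3, mul_inv_rev, inv_inv, ((hc _).pow_left 3).eq]; group
      _ = (c ^ 3) * (y⁻¹ * ((c ^ 6)⁻¹ * (y * x)) * y⁻¹) := by rw [F4]; group
      _ = c ^ 3 * (c ^ 6)⁻¹ * (x * y⁻¹) := by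
        rw [← mul_assoc y⁻¹, ← ((hc y⁻¹).pow_left 6).inv_left.eq]; group
      _ = c⁻¹ * (c ^ 2)⁻¹ * x * y⁻¹ := by group
      _ = _ := by
        rw [cy, ← mul_assoc (c ^ (-2 : ℤ) * x), mul_assoc (c ^ (-2 : ℤ)) x,
          ← (hc x).inv_left.eq]
        group
  · change _ = c ^ (1 : ℤ) * x
    rw [← mul_assoc, ← (hc s⁻¹).eq, ← hy]
    group

end

section

variable {H : Type*} [Group H] {c : H}

/-- The words `xWord`, `pWord`, `sWord` in elements subject to the relations of `B` satisfy the
relations of the crossed product, and the words `tWord` recover the `T k` from them. -/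
theorem StarRelations.crossedRelations (hc : ∀ h, Commute c h) {D : Diagram} {T : Fin D.m → H}
    (h : StarRelations D c T) :
    CrossedRelations D c (xWord c D T) (pWord c D T) (sWord D T) ∧
      tWord c (xWord c D T) (pWord c D T) (sWord D T) D = T := by
  obtain ⟨h1, h2⟩ := h
  cases D
  · have hp := (prod_ofFn_four (T : Fin 4 → H)).symm.trans h2
    have e0 : T (0 : Fin 4) ^ 2 = 1 := h1 (0 : Fin 4)
    have e1 : T (1 : Fin 4) ^ 2 = 1 := h1 (1 : Fin 4)
    have e2 : T (2 : Fin 4) ^ 2 = 1 := h1 (2 : Fin 4)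
    have e3 : T (3 : Fin 4) ^ 2 = 1 := h1 (3 : Fin 4)
    have := crossedRelations_D4 hc e0 e1 e2 e3 hp
    refine ⟨this.1, ?_⟩
    funext k
    change Fin 4 at k
    fin_cases k
    · rfl
    · change T (1 : Fin 4) * T (0 : Fin 4) * T (0 : Fin 4) = T (1 : Fin 4)
      rw [mul_assoc, ← pow_two, e0, mul_one]
    · exact this.2
    · change T (3 : Fin 4) * T (0 : Fin 4) * T (0 : Fin 4) = T (3 : Fin 4)
      rw [mul_assoc, ← pow_two, e0, mul_one]
  · have hx : c * xWord c .E6 T * T (2 : Fin 3) = T (1 : Fin 3) := by rw [xWord]; group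
    have hp := (prod_ofFn_three (T : Fin 3 → H)).symm.trans h2
    have e0 : T (0 : Fin 3) ^ 3 = 1 := h1 (0 : Fin 3)
    have e1 : T (1 : Fin 3) ^ 3 = 1 := h1 (1 : Fin 3)
    have e2 : T (2 : Fin 3) ^ 3 = 1 := h1 (2 : Fin 3)
    rw [← hx] at e1 hp
    have := crossedRelations_E6 hc e0 e1 e2 hp
    refine ⟨this.1, ?_⟩
    funext k
    change Fin 3 at k
    fin_cases k
    · exact this.2
    · exact hx
    · rfl
  · have hx : c ^ 3 * xWord c .E7 T * T (2 : Fin 3) = T (1 : Fin 3) := by rw [xWord]; group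
    have hp := (prod_ofFn_three (T : Fin 3 → H)).symm.trans h2
    have e0 : T (0 : Fin 3) ^ 2 = 1 := h1 (0 : Fin 3)
    have e1 : T (1 : Fin 3) ^ 4 = 1 := h1 (1 : Fin 3)
    have e2 : T (2 : Fin 3) ^ 4 = 1 := h1 (2 : Fin 3)
    rw [← hx] at e1 hp
    have := crossedRelations_E7 hc e0 e1 e2 hp
    refine ⟨this.1, ?_⟩
    funext k
    change Fin 3 at k
    fin_cases k
    · exact this.2
    · exact hx
    · rfl
  · have hx : c * xWord c .E8 T * T (2 : Fin 3) ^ 2 = T (1 : Fin 3) := by rw [xWord]; group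
    have hp := (prod_ofFn_three (T : Fin 3 → H)).symm.trans h2
    have e0 : T (0 : Fin 3) ^ 2 = 1 := h1 (0 : Fin 3)
    have e1 : T (1 : Fin 3) ^ 3 = 1 := h1 (1 : Fin 3)
    have e2 : T (2 : Fin 3) ^ 6 = 1 := h1 (2 : Fin 3)
    rw [← hx] at e1 hp
    have := crossedRelations_E8 hc e0 e1 e2 hp
    refine ⟨this.1, ?_⟩
    funext k
    change Fin 3 at k
    fin_cases k
    · exact this.2
    · exact hx
    · rfl

theorem sWord_tWord (D : Diagram) (c x p s : H) : sWord D (tWord c x p s D) = s := by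
  cases D <;> rfl

theorem CrossedRelations.xWord_tWord {D : Diagram} {x p s : H}
    (h : CrossedRelations D c x p s) : xWord c D (tWord c x p s D) = x := by
  cases D
  · change x * s * s = x
    rw [mul_assoc, ← pow_two]
    exact (congrArg (x * ·) h.pow_s).trans (mul_one x)
  · change c⁻¹ * (c * x * s) * s⁻¹ = x
    group
  · change (c ^ 3)⁻¹ * (c ^ 3 * x * s) * s⁻¹ = x
    group
  · change c⁻¹ * (c * x * s ^ 2) * (s ^ 2)⁻¹ = x
    group

theorem CrossedRelations.pWord_tWord (hc : ∀ h, Commute c h) {D : Diagram} {x p s : H}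
    (h : CrossedRelations D c x p s) : pWord c D (tWord c x p s D) = p := by
  have hx := h.xWord_tWord
  have hp : p = s * rotPWord c x p D * s⁻¹ := by rw [← h.rot_p]; group
  have key : ∀ n : ℤ, s * (c ^ n * x) * s⁻¹ = c ^ n * (s * x * s⁻¹) := fun n => by
    rw [← mul_assoc s, ← ((hc s).zpow_left n).eq]
    group
  cases D
  · change p * s * s = p
    rw [mul_assoc, ← pow_two]
    exact (congrArg (p * ·) h.pow_s).trans (mul_one p)
  · rw [pWord, hx, sWord_tWord]
    refine Eq.trans ?_ ((key 2).symm.trans hp.symm)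
    rw [← zpow_natCast]
    rfl
  · rw [pWord, hx, sWord_tWord]
    refine Eq.trans ?_ ((key 2).symm.trans hp.symm)
    rw [← zpow_natCast]
    rfl
  · rw [pWord, hx, sWord_tWord]
    refine Eq.trans ?_ ((key 1).symm.trans hp.symm)
    rw [zpow_one]

variable {G : Type*} [Group G]

theorem map_tWord (f : H →* G) (c x p s : H) (D : Diagram) (k : Fin D.m) :
    f (tWord c x p s D k) = tWord (f c) (f x) (f p) (f s) D k := by
  cases D
  · change Fin 4 at k
    fin_cases k <;> simp [tWord]
  all_goals
    change Fin 3 at k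
    fin_cases k <;> simp [tWord]

theorem map_sWord (f : H →* G) (D : Diagram) (T : Fin D.m → H) :
    f (sWord D T) = sWord D fun k => f (T k) := by
  cases D <;> rfl

theorem map_xWord (f : H →* G) (c : H) (D : Diagram) (T : Fin D.m → H) :
    f (xWord c D T) = xWord (f c) D fun k => f (T k) := by
  cases D <;> simp only [xWord, map_mul, map_inv, map_pow]

theorem map_pWord (f : H →* G) (c : H) (D : Diagram) (T : Fin D.m → H) :
    f (pWord c D T) = pWord (f c) D fun k => f (T k) := by
  cases D <;> simp only [pWord, map_mul, map_inv, map_pow, map_sWord, map_xWord]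

end

namespace Torus

variable {K : Type*} [CommRing K] (D : Diagram) (q : Kˣ) {H : Type*} [Group H]

/-- The images `x`, `p` of `X`, `P` in a group satisfy, together with an element `s` of order
dividing `ℓ` which implements the rotation, the relations of the crossed product. -/
theorem crossedRelations (ι : (Torus D q)ˣ →* H) {s : H}
    (hι : ∀ u, ι u * s = s * ι (Units.map (rot D q : Torus D q →* Torus D q) u))
    (hs : s ^ D.ell = 1) :
    CrossedRelations D (ι (scal q _)) (ι (X D q)) (ι (P D q)) s := by
  have h := lift_gen (rotX D q) (rotP D q) (rot_comm D q)
  have hr : ∀ u, s⁻¹ * ι u * s = ι (Units.map (rot D q : Torus D q →* Torus D q) u) := by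
    intro u
    rw [mul_assoc, hι, inv_mul_cancel_left]
  refine ⟨?_, ?_, ?_, hs⟩
  · rw [← map_mul, P_mul_X, map_mul, map_pow, map_mul]
  · rw [hr, rot, h.1]
    cases D <;> simp only [rotX, rotXWord, map_mul, map_zpow, map_inv]
  · rw [hr, rot, h.2]
    cases D <;> simp only [rotP, rotPWord, map_mul, map_zpow, map_inv]

/-- The words `tWord` satisfy the relations of `B`. -/
theorem starRelations (ι : (Torus D q)ˣ →* H) {s : H}
    (hι : ∀ u, ι u * s = s * ι (Units.map (rot D q : Torus D q →* Torus D q) u))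
    (hs : s ^ D.ell = 1) :
    StarRelations D (ι (scal q _)) (tWord (ι (scal q _)) (ι (X D q)) (ι (P D q)) s D) := by
  -- With these rules `simp` moves all factors `s` to the left, where `s ^ ℓ = 1` removes them, and
  -- multiplies the remaining monomials in `q`, `X`, `P`.
  have hι' : ∀ u k, ι u * (s * k) =
      s * (ι (Units.map (rot D q : Torus D q →* Torus D q) u) * k) := fun u k => by
    rw [← mul_assoc, hι, mul_assoc]
  have hi : ∀ u, (ι u)⁻¹ = ι u⁻¹ := fun u => (map_inv ι u).symm
  have hc : scal q (Torus D q) = mon D q 1 0 0 := by rw [← scal_eq, zpow_one]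
  have hs₁ : ∀ k, s ^ D.ell * k = k := fun k => by rw [hs, one_mul]
  cases D
  · have ht : ∀ k, s * (s * (k)) = k := fun k => by
      have := hs₁ k
      simp only [Diagram.ell, pow_succ, pow_zero, one_mul, mul_assoc] at this
      exact this
    have ht' : s * (s) = 1 := by simpa only [mul_one] using ht 1
    refine ⟨fun k => ?_, (prod_ofFn_four (tWord _ _ _ s .D4 : Fin 4 → H)).trans ?_⟩
    · change Fin 4 at k
      fin_cases k
      all_goals
        simp [tWord, Diagram.d, Diagram.legLength, pow_succ, mul_assoc, ht', hι, hι', ← map_mul,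
          hc, X_eq, P_eq, rot_mon, rotX_eq, rotP_eq, mon_inv, mon_mul, mon_one, Diagram.ell]
    · simp [tWord, pow_succ, mul_assoc, ht, hι, hι', ← map_mul, hc, X_eq, P_eq, rot_mon, rotX_eq,
        rotP_eq, mon_inv, mon_mul, Diagram.ell]
  · have ht : ∀ k, s * (s * (s * (k))) = k := fun k => by
      have := hs₁ k
      simp only [Diagram.ell, pow_succ, pow_zero, one_mul, mul_assoc] at this
      exact this
    have ht' : s * (s * (s)) = 1 := by simpa only [mul_one] using ht 1
    refine ⟨fun k => ?_, (prod_ofFn_three (tWord _ _ _ s .E6 : Fin 3 → H)).trans ?_⟩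
    · change Fin 3 at k
      fin_cases k
      all_goals
        simp [tWord, Diagram.d, Diagram.legLength, pow_succ, mul_assoc, ht', hι, hι', ← map_mul,
          hc, X_eq, P_eq, hi, -map_inv, rot_mon, rotX_eq, rotP_eq, mon_inv, mon_mul, mon_one,
          Diagram.ell]
    · simp [tWord, pow_succ, mul_assoc, ht, hι, hι', ← map_mul, hc, X_eq, P_eq, hi, -map_inv,
        rot_mon, rotX_eq, rotP_eq, mon_inv, mon_mul, Diagram.ell]
  · have ht : ∀ k, s * (s * (s * (s * (k)))) = k := fun k => by
      have := hs₁ k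
      simp only [Diagram.ell, pow_succ, pow_zero, one_mul, mul_assoc] at this
      exact this
    have ht' : s * (s * (s * (s))) = 1 := by simpa only [mul_one] using ht 1
    refine ⟨fun k => ?_, (prod_ofFn_three (tWord _ _ _ s .E7 : Fin 3 → H)).trans ?_⟩
    · change Fin 3 at k
      fin_cases k
      all_goals
        simp [tWord, Diagram.d, Diagram.legLength, pow_succ, mul_assoc, ht', hι, hι', ← map_mul,
          hc, X_eq, rot_mon, rotX_eq, rotP_eq, mon_inv, mon_mul, mon_one, Diagram.ell]
    · simp [tWord, pow_succ, mul_assoc, ht, hι, hι', ← map_mul, hc, X_eq, rot_mon, rotX_eq,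
        rotP_eq, mon_inv, mon_mul, Diagram.ell]
  · have ht : ∀ k, s * (s * (s * (s * (s * (s * (k)))))) = k := fun k => by
      have := hs₁ k
      simp only [Diagram.ell, pow_succ, pow_zero, one_mul, mul_assoc] at this
      exact this
    have ht' : s * (s * (s * (s * (s * (s))))) = 1 := by simpa only [mul_one] using ht 1
    refine ⟨fun k => ?_, (prod_ofFn_three (tWord _ _ _ s .E8 : Fin 3 → H)).trans ?_⟩
    · change Fin 3 at k
      fin_cases k
      all_goals
        simp [tWord, Diagram.d, Diagram.legLength, pow_succ, mul_assoc, ht', hι, hι', ← map_mul,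
          hc, X_eq, rot_mon, rotX_eq, rotP_eq, mon_inv, mon_mul, mon_one, Diagram.ell]
    · simp [tWord, pow_succ, mul_assoc, ht, hι, hι', ← map_mul, hc, X_eq, rot_mon, rotX_eq,
        rotP_eq, mon_inv, mon_mul, Diagram.ell]

end Torus

/-! ### The universal property of the crossed product -/

namespace CrossedProduct

variable {K : Type*} [CommRing K] (D : Diagram) (q : Kˣ)

/-- The inclusion of the `Q`-Weyl algebra into the crossed product. -/
def incl : Torus D q →ₐ[K] CrossedProduct D q :=
  { SkewMonoidAlgebra.singleOneRingHom with
    commutes' := fun _ => rfl }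

theorem incl_apply (a : Torus D q) : incl D q a = SkewMonoidAlgebra.single 1 a := rfl

/-- The inclusion of the `Q`-Weyl algebra on units. -/
def inclUnits : (Torus D q)ˣ →* (CrossedProduct D q)ˣ :=
  Units.map (incl D q : Torus D q →* CrossedProduct D q)

/-- The elements of `ℤ/ℓ` as units of the crossed product. -/
def ofUnits : Multiplicative (ZMod D.ell) →* (CrossedProduct D q)ˣ :=
  (Units.map (SkewMonoidAlgebra.of (Torus D q) (Multiplicative (ZMod D.ell)))).comp
    (toUnits : _ ≃* _).toMonoidHom

theorem val_ofUnits (g : Multiplicative (ZMod D.ell)) :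
    (ofUnits D q g : CrossedProduct D q) = SkewMonoidAlgebra.single g 1 :=
  SkewMonoidAlgebra.of_apply _ _ g

/-- The element `s` with `s⁻¹ a s` the rotation of `a`. Since `g a g⁻¹ = g • a` in the crossed
product, it is the inverse of the generator `1 ∈ ℤ/ℓ`, which acts by the rotation. -/
def s : (CrossedProduct D q)ˣ := (ofUnits D q (Multiplicative.ofAdd 1))⁻¹

theorem ofAdd_one_pow : (Multiplicative.ofAdd (1 : ZMod D.ell)) ^ D.ell = 1 := by
  rw [← ofAdd_nsmul, nsmul_eq_mul, ZMod.natCast_self, zero_mul, ofAdd_zero]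

theorem exists_ofAdd_one_pow (g : Multiplicative (ZMod D.ell)) :
    ∃ n : ℕ, g = Multiplicative.ofAdd (1 : ZMod D.ell) ^ n := by
  have : NeZero D.ell := ⟨(Torus.ell_pos D).ne'⟩
  obtain ⟨n, hn⟩ := ZMod.natCast_zmod_surjective (Multiplicative.toAdd g)
  refine ⟨n, ?_⟩
  rw [← ofAdd_nsmul, nsmul_eq_mul, mul_one, hn, ofAdd_toAdd]

theorem s_pow : s D q ^ D.ell = 1 := by
  rw [s, inv_pow, ← map_pow, ofAdd_one_pow, map_one, inv_one]

theorem incl_mul_s (u : (Torus D q)ˣ) : inclUnits D q u * s D q =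
    s D q * inclUnits D q (Units.map (Torus.rot D q : Torus D q →* Torus D q) u) := by
  rw [s, mul_inv_eq_iff_eq_mul, mul_assoc, eq_inv_mul_iff_mul_eq]
  apply Units.ext
  rw [Units.val_mul, Units.val_mul, val_ofUnits]
  change SkewMonoidAlgebra.single _ _ * SkewMonoidAlgebra.single _ _ =
    SkewMonoidAlgebra.single _ _ * SkewMonoidAlgebra.single _ _
  rw [SkewMonoidAlgebra.single_mul_single, SkewMonoidAlgebra.single_mul_single, Torus.smul_eq,
    Torus.rotHom_one, one_mul, mul_one, one_mul, one_smul, mul_one]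
  rfl

theorem inclUnits_scal : inclUnits D q (Torus.scal q (Torus D q)) = Torus.scal q _ :=
  Torus.map_scal (incl D q)

theorem crossedRelations : CrossedRelations D (Torus.scal q (CrossedProduct D q))
    (inclUnits D q (Torus.X D q)) (inclUnits D q (Torus.P D q)) (s D q) := by
  rw [← inclUnits_scal]
  exact Torus.crossedRelations D q (inclUnits D q) (incl_mul_s D q) (s_pow D q)

/-- The elements `T k` of the crossed product. -/
def t : Fin D.m → (CrossedProduct D q)ˣ :=
  tWord (Torus.scal q _) (inclUnits D q (Torus.X D q)) (inclUnits D q (Torus.P D q)) (s D q) D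

theorem starRelations : StarRelations D (Torus.scal q (CrossedProduct D q)) (t D q) := by
  have := Torus.starRelations D q (inclUnits D q) (incl_mul_s D q) (s_pow D q)
  rwa [inclUnits_scal] at this

variable {D q} {A : Type*} [Ring A] [Algebra K A]

theorem hom_ext {f g : CrossedProduct D q →ₐ[K] A}
    (hX : f (inclUnits D q (Torus.X D q)) = g (inclUnits D q (Torus.X D q)))
    (hP : f (inclUnits D q (Torus.P D q)) = g (inclUnits D q (Torus.P D q)))
    (hs : f (s D q) = g (s D q)) : f = g := by
  have h1 : f.comp (incl D q) = g.comp (incl D q) :=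
    Torus.algHom_ext (Units.ext hX) (Units.ext hP)
  have h2 : (Units.map (f : CrossedProduct D q →* A)).comp (ofUnits D q) =
      (Units.map (g : CrossedProduct D q →* A)).comp (ofUnits D q) := by
    have h3 : Units.map (f : CrossedProduct D q →* A) (ofUnits D q (Multiplicative.ofAdd 1)) =
        Units.map (g : CrossedProduct D q →* A) (ofUnits D q (Multiplicative.ofAdd 1)) := by
      rw [← inv_inj, ← map_inv, ← map_inv]
      exact Units.ext hs
    refine MonoidHom.ext fun y => ?_
    obtain ⟨n, rfl⟩ := exists_ofAdd_one_pow D y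
    rw [map_pow, map_pow]
    exact congrArg (· ^ n) h3
  have h4 : (f : CrossedProduct D q →+ A) = (g : CrossedProduct D q →+ A) := by
    refine SkewMonoidAlgebra.addHom_ext fun y a => ?_
    have h5 : (SkewMonoidAlgebra.single y a : CrossedProduct D q) =
        incl D q a * ofUnits D q y := by
      rw [val_ofUnits, incl_apply, SkewMonoidAlgebra.single_mul_single, one_mul, one_smul, mul_one]
    change f _ = g _
    rw [h5, map_mul, map_mul]
    exact congrArg₂ (· * ·) (DFunLike.congr_fun h1 a)
      (congrArg Units.val (DFunLike.congr_fun h2 y))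
  ext1 a
  exact DFunLike.congr_fun h4 a

/-- Units subject to the relations of the crossed product define a homomorphism. -/
theorem exists_lift {x p s' : Aˣ} (h : CrossedRelations D (Torus.scal q A) x p s') :
    ∃ f : CrossedProduct D q →ₐ[K] A, Units.map (f : _ →* A) (inclUnits D q (Torus.X D q)) = x ∧
      Units.map (f : _ →* A) (inclUnits D q (Torus.P D q)) = p ∧
      Units.map (f : _ →* A) (s D q) = s' := by
  let f₀ : Torus D q →ₐ[K] A := Torus.lift x p h.comm
  have hf₀ := Torus.lift_gen x p h.comm
  let g₀ : Multiplicative (ZMod D.ell) →* Aˣ := AddMonoidHom.toMultiplicativeLeft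
    (ZMod.lift D.ell ⟨zmultiplesHom _ (Additive.ofMul s'⁻¹), by
      rw [zmultiplesHom_apply, natCast_zsmul, ← ofMul_pow, inv_pow, h.pow_s, inv_one, ofMul_one]⟩)
  have hg₀ : g₀ (Multiplicative.ofAdd 1) = s'⁻¹ := by
    have h1 := ZMod.lift_coe D.ell (⟨zmultiplesHom _ (Additive.ofMul s'⁻¹), by
      rw [zmultiplesHom_apply, natCast_zsmul, ← ofMul_pow, inv_pow, h.pow_s, inv_one, ofMul_one]⟩ :
      {f : ℤ →+ Additive Aˣ // f D.ell = 0}) 1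
    rw [Int.cast_one] at h1
    have h2 : g₀ (Multiplicative.ofAdd 1) = Additive.toMul _ := congrArg Additive.toMul h1
    rw [h2]
    simp
  -- The two maps `a ↦ f₀ (rot a)` and `a ↦ s'⁻¹ (f₀ a) s'` agree on generators.
  let conj : Torus D q →ₐ[K] A :=
    { toFun := fun a => ↑s'⁻¹ * f₀ a * s'
      map_one' := by simp
      map_mul' := fun a b => by simp [mul_assoc]
      map_zero' := by simp
      map_add' := fun a b => by simp [mul_add, add_mul]
      commutes' := fun r => by
        rw [AlgHom.commutes, ← Algebra.commutes, mul_assoc, Units.inv_mul, mul_one] }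
  have hrot := Torus.lift_gen (Torus.rotX D q) (Torus.rotP D q) (Torus.rot_comm D q)
  have hconj : f₀.comp (Torus.rot D q) = conj := by
    apply Torus.algHom_ext
    · have h1 : Units.map (conj : Torus D q →* A) (Torus.X D q) = s'⁻¹ * x * s' := by
        apply Units.ext
        change ↑s'⁻¹ * f₀ (Torus.X D q) * ↑s' = _
        rw [← hf₀.1]
        rfl
      have h2 : Units.map (f₀.comp (Torus.rot D q) : Torus D q →* A) (Torus.X D q) =
          Units.map (f₀ : Torus D q →* A) (Torus.rotX D q) := by
        rw [← hrot.1]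
        rfl
      rw [h1, h2, h.rot_x]
      cases D <;> simp only [Torus.rotX, rotXWord, map_mul, map_zpow, map_inv, Torus.map_scal,
        f₀, hf₀.1, hf₀.2]
    · have h1 : Units.map (conj : Torus D q →* A) (Torus.P D q) = s'⁻¹ * p * s' := by
        apply Units.ext
        change ↑s'⁻¹ * f₀ (Torus.P D q) * ↑s' = _
        rw [← hf₀.2]
        rfl
      have h2 : Units.map (f₀.comp (Torus.rot D q) : Torus D q →* A) (Torus.P D q) =
          Units.map (f₀ : Torus D q →* A) (Torus.rotP D q) := by
        rw [← hrot.2]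
        rfl
      rw [h1, h2, h.rot_p]
      cases D <;> simp only [Torus.rotP, rotPWord, map_mul, map_zpow, map_inv, Torus.map_scal,
        f₀, hf₀.1, hf₀.2]
  have hcomm : ∀ (y : Multiplicative (ZMod D.ell)) (a : Torus D q),
      f₀ (y • a) * (g₀ y : A) = (g₀ y : A) * f₀ a := by
    intro y
    obtain ⟨n, rfl⟩ := exists_ofAdd_one_pow D y
    induction n with
    | zero => intro a; simp
    | succ n ih =>
      intro a
      have h1 : f₀ (Multiplicative.ofAdd (1 : ZMod D.ell) • a) = ↑s'⁻¹ * f₀ a * s' := by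
        rw [Torus.smul_eq, Torus.rotHom_one]
        exact DFunLike.congr_fun hconj a
      rw [pow_succ, mul_smul, map_mul, Units.val_mul, ← mul_assoc, ih, h1, hg₀]
      simp only [mul_assoc, Units.mul_inv, mul_one]
  refine ⟨SkewMonoidAlgebra.liftNCAlgHom f₀ ((Units.coeHom A).comp g₀) (fun {a y} => hcomm y a),
    ?_, ?_, ?_⟩
  · apply Units.ext
    refine (SkewMonoidAlgebra.liftNC_single _ _ _ _).trans ?_
    refine (congrArg (f₀ (Torus.X D q) * ·) (map_one _)).trans ?_
    rw [mul_one, ← hf₀.1]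
    rfl
  · apply Units.ext
    refine (SkewMonoidAlgebra.liftNC_single _ _ _ _).trans ?_
    refine (congrArg (f₀ (Torus.P D q) * ·) (map_one _)).trans ?_
    rw [mul_one, ← hf₀.2]
    rfl
  · rw [s, map_inv, inv_eq_iff_eq_inv, ← hg₀]
    apply Units.ext
    change SkewMonoidAlgebra.liftNCAlgHom f₀ ((Units.coeHom A).comp g₀) (fun {a y} => hcomm y a)
      (ofUnits D q _ : CrossedProduct D q) = _
    rw [val_ofUnits]
    refine (SkewMonoidAlgebra.liftNC_single _ _ _ _).trans ?_
    refine (congrArg (· * _) (map_one f₀)).trans (one_mul _)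

/-- An algebra with elements `T k` subject to the relations of `B` is the crossed product, as soon as
its endomorphisms are determined by their values on the `T k` and it has a homomorphism to the
crossed product given by the words `tWord`. -/
theorem exists_equiv (T : Fin D.m → Aˣ) (hT : StarRelations D (Torus.scal q A) T)
    (hext : ∀ f g : A →ₐ[K] A, (∀ k, f (T k) = g (T k)) → f = g)
    (ψ : A →ₐ[K] CrossedProduct D q) (hψ : ∀ k, ψ (T k) = t D q k) :
    ∃ e : CrossedProduct D q ≃ₐ[K] A,
      e (inclUnits D q (Torus.X D q)) = xWord (Torus.scal q A) D T := by
  obtain ⟨h1, h2⟩ := hT.crossedRelations (Torus.scal_comm q)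
  obtain ⟨φ, hX, hP, hs⟩ := exists_lift h1
  have hmap : ∀ (f : CrossedProduct D q →ₐ[K] A),
      Units.map (f : CrossedProduct D q →* A) (Torus.scal q _) = Torus.scal q A :=
    fun f => Units.ext (f.commutes _)
  have hmap' : Units.map (ψ : A →* CrossedProduct D q) (Torus.scal q _) = Torus.scal q _ :=
    Units.ext (ψ.commutes _)
  have hφ : ∀ k, φ (t D q k) = T k := by
    intro k
    have h3 : Units.map (φ : CrossedProduct D q →* A) (t D q k) = T k := by
      rw [t, map_tWord, hmap, hX, hP, hs, h2]
    exact congrArg Units.val h3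
  have hψ' : (fun k => Units.map (ψ : A →* CrossedProduct D q) (T k)) = t D q :=
    funext fun k => Units.ext (hψ k)
  have hc := crossedRelations D q
  have h3 : φ.comp ψ = AlgHom.id K A := by
    refine hext _ _ fun k => ?_
    change φ (ψ (T k)) = T k
    rw [hψ, hφ]
  have h4 : ψ.comp φ = AlgHom.id K _ := by
    apply hom_ext
    · have : Units.map (ψ : A →* CrossedProduct D q) (Units.map (φ : CrossedProduct D q →* A)
          (inclUnits D q (Torus.X D q))) = inclUnits D q (Torus.X D q) := by
        rw [hX, map_xWord, hmap', hψ', t, hc.xWord_tWord]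
      exact congrArg Units.val this
    · have : Units.map (ψ : A →* CrossedProduct D q) (Units.map (φ : CrossedProduct D q →* A)
          (inclUnits D q (Torus.P D q))) = inclUnits D q (Torus.P D q) := by
        rw [hP, map_pWord, hmap', hψ', t, hc.pWord_tWord (Torus.scal_comm q)]
      exact congrArg Units.val this
    · have : Units.map (ψ : A →* CrossedProduct D q) (Units.map (φ : CrossedProduct D q →* A)
          (s D q)) = s D q := by
        rw [hs, map_sWord, hψ', t, sWord_tWord]
      exact congrArg Units.val this
  exact ⟨AlgEquiv.ofAlgHom φ ψ h3 h4, congrArg Units.val hX⟩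

end CrossedProduct

/-! ### The algebra `B` and its specializations as crossed products -/

theorem B.starRelations (D : Diagram) :
    StarRelations D (Torus.scal qvar (B D)) (B.unit D) where
  pow k := Units.ext (B.gen_pow D k)
  prod := by
    apply Units.ext
    rw [← Units.coeHom_apply, map_list_prod, List.map_ofFn]
    exact B.prod_gen D

/-- Units subject to the relations of `B` define a homomorphism, semilinear with respect to a given
ring homomorphism from `ℂ[q, q⁻¹]` to the centre. -/
theorem B.exists_lift {D : Diagram} {A : Type*} [Ring A] (f : ℂ[T;T⁻¹] →+* A)
    (hf : ∀ r a, f r * a = a * f r) {c : Aˣ} {t : Fin D.m → Aˣ} (ht : StarRelations D c t)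
    (hc : f qvar = c) : ∃ g : B D →+* A, (∀ k, g (B.gen D k) = t k) ∧
      ∀ r, g (algebraMap ℂ[T;T⁻¹] (B D) r) = f r := by
  let : Algebra ℂ[T;T⁻¹] A := f.toAlgebra' hf
  let g : B D →ₐ[ℂ[T;T⁻¹]] A := RingQuot.liftAlgHom ℂ[T;T⁻¹]
    ⟨FreeAlgebra.lift ℂ[T;T⁻¹] fun k => (t k : A), by
      intro a b hab
      cases hab with
      | pow k =>
        rw [map_pow, FreeAlgebra.lift_ι_apply, map_one, ← Units.val_pow_eq_pow_val, ht.pow,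
          Units.val_one]
      | prod =>
        rw [map_list_prod, List.map_ofFn, AlgHom.commutes]
        refine Eq.trans ?_ hc.symm
        rw [← ht.prod, ← Units.coeHom_apply, map_list_prod, List.map_ofFn]
        congr 2
        funext k
        exact FreeAlgebra.lift_ι_apply _ _⟩
  refine ⟨g, fun k => ?_, fun r => g.commutes r⟩
  change RingQuot.liftAlgHom ℂ[T;T⁻¹] _ (RingQuot.mkAlgHom _ _ _) = _
  rw [RingQuot.liftAlgHom_mkAlgHom_apply, FreeAlgebra.lift_ι_apply]

theorem B.hom_ext {D : Diagram} {A : Type*} [Ring A] {f g : B D →+* A}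
    (h : ∀ k, f (B.gen D k) = g (B.gen D k))
    (h' : ∀ r, f (algebraMap ℂ[T;T⁻¹] (B D) r) = g (algebraMap ℂ[T;T⁻¹] (B D) r)) : f = g := by
  ext a
  obtain ⟨x, rfl⟩ := B.mk_surjective D a
  induction x using FreeAlgebra.induction with
  | grade0 r => rw [AlgHom.commutes, h']
  | grade1 k => exact h k
  | mul a b ha hb => rw [map_mul, map_mul, map_mul, ha, hb]
  | add a b ha hb => rw [map_add, map_add, map_add, ha, hb]

/-- The algebra `B` is the crossed product, with `X` the word `xWord` in the generators of `B`. -/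
theorem B.exists_equiv (D : Diagram) : ∃ e : CrossedProduct D qvar ≃ₐ[ℂ[T;T⁻¹]] B D,
    e (CrossedProduct.inclUnits D qvar (Torus.X D qvar)) =
      xWord (Torus.scal qvar (B D)) D (B.unit D) := by
  obtain ⟨g, hg, hg'⟩ := B.exists_lift (algebraMap ℂ[T;T⁻¹] (CrossedProduct D qvar))
    Algebra.commutes (CrossedProduct.starRelations D qvar) rfl
  refine CrossedProduct.exists_equiv (B.unit D) (B.starRelations D) (fun f g h => ?_)
    { g with commutes' := hg' } hg
  have : (f : B D →+* B D) = g := B.hom_ext h fun r => by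
    change f _ = g _
    rw [AlgHom.commutes, AlgHom.commutes]
  exact AlgHom.ext fun a => DFunLike.congr_fun this a

/-- Evaluation at `q = q₀`. -/
def evalAt (q₀ : ℂˣ) : ℂ[T;T⁻¹] →+* ℂ := LaurentPolynomial.eval₂ (RingHom.id ℂ) q₀

theorem T_eq_qvar_zpow (n : ℤ) : (LaurentPolynomial.T n : ℂ[T;T⁻¹]) = ↑(qvar ^ n) := by
  induction n with
  | zero => rfl
  | succ n ih => rw [zpow_add_one, Units.val_mul, ← ih, LaurentPolynomial.T_add]; rfl
  | pred n ih =>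
    rw [zpow_sub_one, Units.val_mul, ← ih, sub_eq_add_neg, LaurentPolynomial.T_add]; rfl

theorem evalAt_qvar (q₀ : ℂˣ) : evalAt q₀ qvar = q₀ := by
  rw [evalAt]
  change LaurentPolynomial.eval₂ _ _ (LaurentPolynomial.T 1) = _
  rw [LaurentPolynomial.eval₂_T, zpow_one]

theorem evalAt_algebraMap (q₀ : ℂˣ) (z : ℂ) : evalAt q₀ (algebraMap ℂ ℂ[T;T⁻¹] z) = z :=
  LaurentPolynomial.eval₂_C _ _ _

theorem Spec.algebraMap_eq (D : Diagram) (q₀ : ℂˣ) (z : ℂ) :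
    algebraMap ℂ (Spec (B D) q₀) z =
      Spec.mk q₀ (algebraMap ℂ[T;T⁻¹] (B D) (algebraMap ℂ ℂ[T;T⁻¹] z)) := by
  rw [← IsScalarTower.algebraMap_apply ℂ ℂ[T;T⁻¹] (B D), Algebra.algebraMap_eq_smul_one,
    Algebra.algebraMap_eq_smul_one, ← Spec.smul_mk, map_one]

theorem Spec.mk_algebraMap (D : Diagram) (q₀ : ℂˣ) (r : ℂ[T;T⁻¹]) :
    Spec.mk q₀ (algebraMap ℂ[T;T⁻¹] (B D) r) = algebraMap ℂ (Spec (B D) q₀) (evalAt q₀ r) := by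
  have h1 : Units.map ((Spec.mk q₀ : B D →+* _).comp (algebraMap ℂ[T;T⁻¹] (B D))).toMonoidHom qvar =
      Torus.scal q₀ (Spec (B D) q₀) := by
    apply Units.ext
    change Spec.mk q₀ (algebraMap ℂ[T;T⁻¹] (B D) qvar) = algebraMap ℂ (Spec (B D) q₀) q₀
    rw [Spec.mk_qvar, Spec.algebraMap_eq]
  induction r using LaurentPolynomial.induction_on' with
  | add p r hp hr => simp only [map_add, hp, hr]
  | C_mul_T n a =>
    have h2 := T_eq_qvar_zpow n
    rw [h2, map_mul, map_mul, map_mul, map_mul]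
    congr 1
    · rw [evalAt, LaurentPolynomial.eval₂_C, Spec.algebraMap_eq]
      rfl
    · have h3 := congrArg (fun u => ((u ^ n : (Spec (B D) q₀)ˣ) : Spec (B D) q₀)) h1
      rw [← map_zpow, Torus.scal, ← map_zpow] at h3
      refine h3.trans ?_
      rw [← h2, evalAt, LaurentPolynomial.eval₂_T]
      rfl

/-- The specialization of `B` is the crossed product at `q₀`. -/
theorem B.exists_equiv_spec (D : Diagram) (q₀ : ℂˣ) :
    Nonempty (Spec (B D) q₀ ≃ₐ[ℂ] CrossedProduct D q₀) := by
  have hq : (algebraMap ℂ (CrossedProduct D q₀)).comp (evalAt q₀) qvar =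
      (Torus.scal q₀ (CrossedProduct D q₀) : CrossedProduct D q₀) := by
    rw [RingHom.comp_apply, evalAt_qvar]
    rfl
  obtain ⟨g, hg, hg'⟩ := B.exists_lift
    ((algebraMap ℂ (CrossedProduct D q₀)).comp (evalAt q₀)) (fun r => Algebra.commutes (evalAt q₀ r))
    (CrossedProduct.starRelations D q₀) hq
  let ψ : Spec (B D) q₀ →+* CrossedProduct D q₀ := RingQuot.lift ⟨g, by
    rintro _ _ ⟨⟩
    rw [hg', hg', RingHom.comp_apply, RingHom.comp_apply, evalAt_qvar, evalAt_algebraMap]⟩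
  have hψ : ∀ a, ψ (Spec.mk q₀ a) = g a := fun a => RingQuot.lift_mkRingHom_apply _ _ _
  let T : Fin D.m → (Spec (B D) q₀)ˣ := fun k =>
    Units.map (Spec.mk q₀ : B D →+* Spec (B D) q₀).toMonoidHom (B.unit D k)
  have hT : StarRelations D (Torus.scal q₀ (Spec (B D) q₀)) T := by
    obtain ⟨h1, h2⟩ := B.starRelations D
    refine ⟨fun k => by rw [← map_pow, h1, map_one], ?_⟩
    have h3 : (List.ofFn T).prod =
        Units.map (Spec.mk q₀ : B D →+* Spec (B D) q₀).toMonoidHom (List.ofFn (B.unit D)).prod := by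
      rw [map_list_prod, List.map_ofFn]
      rfl
    rw [h3, h2]
    apply Units.ext
    refine (Spec.mk_algebraMap D q₀ qvar).trans ?_
    rw [evalAt_qvar]
    rfl
  have hψ' : ∀ z : ℂ, ψ (algebraMap ℂ _ z) = algebraMap ℂ (CrossedProduct D q₀) z := fun z => by
    rw [Spec.algebraMap_eq, hψ, hg', RingHom.comp_apply, evalAt_algebraMap]
  have hext : ∀ f g : Spec (B D) q₀ →ₐ[ℂ] Spec (B D) q₀, (∀ k, f (T k) = g (T k)) → f = g := by
    intro f g h
    have : (f : Spec (B D) q₀ →+* Spec (B D) q₀).comp (Spec.mk q₀) =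
        (g : Spec (B D) q₀ →+* Spec (B D) q₀).comp (Spec.mk q₀) := B.hom_ext h fun r => by
      change f (Spec.mk q₀ _) = g (Spec.mk q₀ _)
      rw [Spec.mk_algebraMap, AlgHom.commutes, AlgHom.commutes]
    refine AlgHom.ext fun a => ?_
    obtain ⟨b, rfl⟩ := Spec.mk_surjective _ q₀ a
    exact DFunLike.congr_fun this b
  obtain ⟨e, -⟩ := CrossedProduct.exists_equiv (q := q₀) T hT hext
    { ψ with commutes' := hψ' } fun k => (hψ _).trans (hg k)
  exact ⟨e.symm⟩

/-! ### Flatness -/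

/-- Up to a power of `q`, the element `X` lies in the group generated by the `T k`. -/
theorem B.exists_scal_mul_xWord_mem (D : Diagram) : ∃ c : ℂ[T;T⁻¹]ˣ,
    Torus.scal c (B D) * xWord (Torus.scal qvar (B D)) D (B.unit D) ∈
      Subgroup.closure (Set.range (B.unit D)) := by
  have hm : ∀ k, B.unit D k ∈ Subgroup.closure (Set.range (B.unit D)) := fun k =>
    Subgroup.subset_closure ⟨k, rfl⟩
  cases D
  · refine ⟨1, ?_⟩
    rw [Torus.scal, map_one, one_mul]
    exact mul_mem (hm _) (hm _)
  · refine ⟨qvar, ?_⟩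
    rw [xWord, mul_assoc, mul_inv_cancel_left]
    exact mul_mem (hm _) (inv_mem (hm _))
  · refine ⟨qvar ^ 3, ?_⟩
    rw [xWord, mul_assoc (_)⁻¹, Torus.scal, map_pow]
    refine (congrArg (· ∈ _) (mul_inv_cancel_left _ _)).mpr ?_
    exact mul_mem (hm _) (inv_mem (hm _))
  · refine ⟨qvar, ?_⟩
    rw [xWord, mul_assoc, mul_inv_cancel_left]
    exact mul_mem (hm _) (inv_mem (pow_mem (hm _) _))

/-- The algebra `B` is free over `ℂ[q, q⁻¹]`, and the formal algebra is topologically free. -/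
theorem exists_deformation_series (D : Diagram) :
    Module.Free ℂ[T;T⁻¹] (B D) ∧
    ∃ (π : HHat D →+* B D) (Φ : HHat D ≃+ MvPowerSeries D.Param (B D)),
      (∀ k, π (HHat.gen D k) = B.gen D k) ∧
      (∀ (f : MvPowerSeries D.Param ℂ[T;T⁻¹]) (a : HHat D), Φ (f • a) =
        MvPowerSeries.map (algebraMap ℂ[T;T⁻¹] (B D)) f * Φ a) ∧
      ∀ a, MvPowerSeries.constantCoeff (Φ a) = π a := by
  obtain ⟨e, he⟩ := B.exists_equiv D
  obtain ⟨b, hb⟩ := CrossedProduct.exists_basis D qvar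
  obtain ⟨c, hc⟩ := B.exists_scal_mul_xWord_mem D
  refine ⟨Module.Free.of_basis (b.map e.toLinearEquiv), ?_⟩
  refine exists_equiv_series D (b.map e.toLinearEquiv) _ (fun n i => ?_) c hc
  rw [Module.Basis.map_apply, Module.Basis.map_apply, ← hb, ← he]
  exact (map_mul e _ _).symm

end GDAHA

end

open GDAHA in
theorem theorem3p3 (D : Diagram) :
    Nonempty (B D ≃ₐ[ℂ[T;T⁻¹]] CrossedProduct D qvar) ∧
    (∃ π : HHat D →+* B D, (∀ k : Fin D.m, π (HHat.gen D k) = B.gen D k) ∧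
      IsFlatFormalDeformation (σ := D.Param) (K := ℂ[T;T⁻¹]) π) ∧
    ∀ q₀ : ℂˣ,
      Nonempty (Spec (B D) q₀ ≃ₐ[ℂ] CrossedProduct D q₀) ∧
      ∃ π : Spec (HHat D) q₀ →+* Spec (B D) q₀,
        (∀ k : Fin D.m, π (Spec.mk q₀ (HHat.gen D k)) = Spec.mk q₀ (B.gen D k)) ∧
        IsFlatFormalDeformation (σ := D.Param) (K := ℂ) π := by
  obtain ⟨e, -⟩ := B.exists_equiv D
  obtain ⟨hfree, π, Φ, hgen, hΦ, hπ⟩ := exists_deformation_series D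
  exact ⟨⟨e.symm⟩, ⟨π, hgen, isFlatFormalDeformation_of_equiv Φ hΦ π hπ⟩, fun q₀ =>
    ⟨B.exists_equiv_spec D q₀, isFlatFormalDeformation_spec D π Φ hgen hΦ hπ q₀⟩⟩
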